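/- Work with finite-dimensional complex representations of the symmetric groups $S_n$. Let $h_n$, $p_n$, $s_\lambda$ be the complete homogeneous, power-sum and Schur symmetric functions, $p_\lambda=\prod_i p_{\lambda_i}$, let $f[g]$ denote plethysm, and let $\mathrm{ch}(V)=\frac1{n!}\sum_{\sigma\in S_n}\chi_V(\sigma)\,p_{\mathrm{type}(\sigma)}$ be the Frobenius characteristic of an $S_n$-module $V$. For $n\ge 1$ let $2^{k_n}$ be the highest power of $2$ dividing $n$, let $C_n\subseteq S_n$ be the cyclic group generated by an $n$-cycle, and let $Lie^{(2)}_n$ be the $S_n$-module induced from the character of $C_n$ that sends the generator to $\exp(\frac{2\pi i}{n}2^{k_n})$. Put $Lie^{(2)}=\sum_{n\ge1}\mathrm{ch}(Lie^{(2)}_n)$. For all $n\ge 0$ and $0\le r\le n$ there is an $S_n$-module $V\!h_r(n)$ whose Frobenius characteristic is the degree $n$ term $h_{n-r}[Lie^{(2)}]|_{\deg n}$. Given such modules, let $V\!h_{odd}(n)$ and $V\!h_{even}(n)$ be the direct sums of the $V\!h_r(n)$, $0\le r\le n$, over odd $r$ and over even $r$ respectively, and let $V\!h(n)=V\!h_{odd}(n)\oplus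 V\!h_{even}(n)$. Then the following hold. 1. For $n\ge2$, $V\!h_{odd}(n)\cong V\!h_{even}(n)$ as $S_n$-modules, and $$\mathrm{ch}\,V\!h_{odd}(n)=\mathrm{ch}\,V\!h_{even}(n)=\frac12\sum_{\lambda\vdash n,\ \text{all }\lambda_i\text{ powers of }2}p_\lambda .$$ 2. For $n\ge 0$, $$\mathrm{ch}\,V\!h(n)=\sum_{\lambda\vdash n,\ \text{all }\lambda_i\text{ powers of }2}p_\lambda .$$ 3. For $n\ge2$, with $\mathrm{sgn}$ the sign representation of $S_n$ and $\ell(\lambda)$ the number of parts of $\lambda$, $$\mathrm{ch}\bigl(V\!h_{odd}(n)\oplus(\mathrm{sgn}\otimes V\!h_{odd}(n))\bigr)=\sum_{\lambda\vdash n,\ n-\ell(\lambda)\text{ even},\ \text{all }\lambda_i\text{ powers of }2}p_\lambda .$$ 4. For $n\ge 0$, $V\!h(2n+1)\cong V\!h(2n)\uparrow_{S_{2n}}^{S_{2n+1}}$ as $S_{2n+1}$-modules. Moreover, the symmetric functions on the right-hand sides in 1, 2 and 3 (for the stated $n$) are Schur-positive with integer coefficients: each is a linear combination of the $s_\lambda$,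 $\lambda\vdash n$, with nonnegative integer coefficients. Here $1=2^0$ counts as a power of $2$. -/

import Mathlib

open scoped DirectSum

universe u

noncomputable section

/-! ### Symmetric functions with complex coefficients

The ring of symmetric functions over `ℂ` is the polynomial ring in the power sums
`p₁, p₂, …`, where `p_k` has degree `k`; formal infinite sums of symmetric functions of
increasing degrees are power series in the `p_k`. -/

/-- The ring of symmetric functions over `ℂ`; the variable `X k` is the power sum `p_k`. -/
abbrev SymmFun : Type := MvPolynomial ℕ+ ℂ

/-- Formal (possibly infinite) sums of symmetric functions. -/
abbrev SymmSeries : Type := MvPowerSeries ℕ+ ℂ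

/-- `p_ν = ∏ p_{ν_i}`. (The parts of a partition are positive.) -/
def powerSumPart {n : ℕ} (ν : n.Partition) : SymmFun :=
  (ν.parts.map fun k => (MvPolynomial.X k.toPNat' : SymmFun)).prod

/-- The Frobenius characteristic `(1/n!) ∑_{σ ∈ S_n} χ(σ) p_{type σ}` of a (finite-dimensional)
representation of `S_n` with character `χ`. -/
def frobeniusChar {n : ℕ} {W : Type u} [AddCommGroup W] [Module ℂ W]
    (ρ : Representation ℂ (Equiv.Perm (Fin n)) W) : SymmFun :=
  ((n.factorial : ℂ)⁻¹) •
    ∑ σ : Equiv.Perm (Fin n), LinearMap.trace ℂ W (ρ σ) • powerSumPart σ.partition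

/-- The complete homogeneous symmetric function `h_n`, the characteristic of the trivial
representation of `S_n`, that is `h_n = ∑_{ν ⊢ n} p_ν / z_ν`. -/
def completeHomog (n : ℕ) : SymmFun :=
  frobeniusChar (Representation.trivial ℂ (Equiv.Perm (Fin n)) ℂ)

/-- `h_m` for an integer `m`, with `h_m = 0` for `m < 0`. -/
def completeHomogInt (m : ℤ) : SymmFun :=
  if m < 0 then 0 else completeHomog m.toNat

/-- The parts `ν₁ ≥ ν₂ ≥ …` of a partition, as a list. -/
def sortedParts {n : ℕ} (ν : n.Partition) : List ℕ := ν.parts.sort (· ≥ ·)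

/-- The Schur function `s_ν = det (h_{ν_i - i + j})` (Jacobi–Trudi). -/
def schurFun {n : ℕ} (ν : n.Partition) : SymmFun :=
  Matrix.det (Matrix.of fun i j : Fin (sortedParts ν).length =>
    completeHomogInt (((sortedParts ν).get i : ℤ) - (i : ℤ) + (j : ℤ)))

/-- A symmetric function, homogeneous of degree `n`, is Schur-positive with integer coefficients
if it is a combination of the `s_ν`, `ν ⊢ n`, with nonnegative integer coefficients. -/
def IsSchurPositive (n : ℕ) (f : SymmFun) : Prop :=
  ∃ c : n.Partition → ℕ, f = ∑ ν : n.Partition, (c ν : ℂ) • schurFun ν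

/-! ### Plethysm -/

instance tendstoCofinite_pnat_mul (k : ℕ+) :
    Filter.TendstoCofinite (fun i : ℕ+ => k * i) :=
  Filter.tendstoCofinite_of_injective fun _ _ h => mul_left_cancel h

/-- `p_k[g]`: every `p_i` in `g` is replaced by `p_{k i}`. -/
def adams (k : ℕ+) : SymmSeries →ₐ[ℂ] SymmSeries :=
  MvPowerSeries.rename fun i : ℕ+ => k * i

/-- The plethysm `f[g]`: the algebra homomorphism in `f` with `p_k[g]` as above. -/
def plethysm (f : SymmFun) (g : SymmSeries) : SymmSeries :=
  MvPolynomial.aeval (fun k => adams k g) f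

/-- The term of degree `n` of a formal sum of symmetric functions, where `p_k` has degree `k`. -/
def degreeTerm (n : ℕ) (g : SymmSeries) : SymmSeries :=
  fun m => if Finsupp.weight (fun k : ℕ+ => (k : ℕ)) m = n then MvPowerSeries.coeff m g else 0

/-! ### The modules `Lie_n^{(2)}` -/

/-- The one-dimensional representation given by a multiplicative character. -/
def linearCharRep {G : Type*} [Group G] (χ : G →* ℂ) : Representation ℂ G ℂ where
  toFun g := χ g • LinearMap.id
  map_one' := by simp; rfl
  map_mul' g h := by ext; simp [mul_comm]

theorem finRotate_pow_self (n : ℕ) : finRotate n ^ n = 1 := by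
  rcases n with _ | _ | n
  · simp
  · exact (inferInstance : Subsingleton (Equiv.Perm (Fin 1))).elim _ _
  · have h := (isCycle_finRotate (n := n)).orderOf
    rw [support_finRotate, Finset.card_univ, Fintype.card_fin] at h
    exact orderOf_dvd_iff_pow_eq_one.mp (dvd_of_eq h)

/-- The embedding of the cyclic group `C_n` in `S_n` that sends the generator to the standard
`n`-cycle. -/
def cyclicToPerm (n : ℕ) : Multiplicative (ZMod n) →* Equiv.Perm (Fin n) :=
  AddMonoidHom.toMultiplicativeLeft (ZMod.lift n ⟨zmultiplesHom (Additive (Equiv.Perm (Fin n)))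
    (Additive.ofMul (finRotate n)), by
      simp [← ofMul_pow, finRotate_pow_self]⟩)

/-- The character of `C_n` that sends the generator to `exp((2πi/n) 2^k)`, where `2^k` is the
highest power of `2` dividing `n`. -/
def lieTwoCharacter (n : ℕ) [NeZero n] : Multiplicative (ZMod n) →* ℂ :=
  ((ZMod.stdAddChar (N := n)).mulShift ((2 ^ padicValNat 2 n : ℕ) : ZMod n)).toMonoidHom

/-- The `S_n`-module `Lie_n^{(2)}`, induced from that character. -/
def lieTwoRep (n : ℕ) [NeZero n] :=
  Representation.ind (cyclicToPerm n) (linearCharRep (lieTwoCharacter n))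

/-- The formal sum `Lie^{(2)} = ∑_{n ≥ 1} ch Lie_n^{(2)}`. -/
def lieTwoSeries : SymmSeries :=
  fun m => ∑ᶠ n : ℕ+, MvPolynomial.coeff m (frobeniusChar (lieTwoRep n))

/-- The degree `n` term of `h_{n-r}[Lie^{(2)}]`, for `0 ≤ r ≤ n`. -/
def vhChar (n : ℕ) (r : Fin (n + 1)) : SymmSeries :=
  degreeTerm n (plethysm (completeHomog (n - (r : ℕ))) lieTwoSeries)

/-! ### Modules with prescribed characteristic -/

/-- The sign representation of `S_n`. -/
def signRep (n : ℕ) : Representation ℂ (Equiv.Perm (Fin n)) ℂ :=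
  linearCharRep ((Int.castRingHom ℂ : ℤ →* ℂ).comp
    ((Units.coeHom ℤ).comp Equiv.Perm.sign))

/-- The standard embedding of `S_m` in `S_{m+1}`, as the stabiliser of the last point. -/
def permSucc (m : ℕ) : Equiv.Perm (Fin m) →* Equiv.Perm (Fin (m + 1)) :=
  Equiv.Perm.viaEmbeddingHom Fin.castSuccEmb

section Family

variable {n : ℕ} {W : Fin (n + 1) → Type u} [∀ r, AddCommGroup (W r)] [∀ r, Module ℂ (W r)]

/-- The family `ρ₀, …, ρ_n` of finite-dimensional `S_n`-modules is `Vh_0(n), …, Vh_n(n)`: the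
Frobenius characteristic of `ρ_r` is the degree `n` term of `h_{n-r}[Lie^{(2)}]`. -/
def IsVhFamily (ρ : ∀ r, Representation ℂ (Equiv.Perm (Fin n)) (W r)) : Prop :=
  ∀ r, FiniteDimensional ℂ (W r) ∧ (frobeniusChar (ρ r) : SymmSeries) = vhChar n r

/-- The direct sum of the modules of odd index. -/
def vhOdd (ρ : ∀ r, Representation ℂ (Equiv.Perm (Fin n)) (W r)) :
    Representation ℂ (Equiv.Perm (Fin n)) (⨁ r : {r : Fin (n + 1) // Odd (r : ℕ)}, W r) :=
  Representation.directSum fun r : {r : Fin (n + 1) // Odd (r : ℕ)} => ρ r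

/-- The direct sum of the modules of even index. -/
def vhEven (ρ : ∀ r, Representation ℂ (Equiv.Perm (Fin n)) (W r)) :
    Representation ℂ (Equiv.Perm (Fin n)) (⨁ r : {r : Fin (n + 1) // Even (r : ℕ)}, W r) :=
  Representation.directSum fun r : {r : Fin (n + 1) // Even (r : ℕ)} => ρ r

/-- `Vh(n) = Vh_odd(n) ⊕ Vh_even(n)`. -/
def vhTotal (ρ : ∀ r, Representation ℂ (Equiv.Perm (Fin n)) (W r)) :=
  (vhOdd ρ).prod (vhEven ρ)

end Family

/-- All parts are powers of `2` (with `1 = 2 ^ 0` included). -/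
def PartsPowTwo {n : ℕ} (ν : n.Partition) : Prop := ∀ i ∈ ν.parts, ∃ a : ℕ, i = 2 ^ a

open Classical in
/-- The sum of `p_ν` over the partitions `ν` of `n` all of whose parts are powers of `2`. -/
def sumPowTwo (n : ℕ) : SymmFun :=
  ∑ ν : n.Partition with PartsPowTwo ν, powerSumPart ν

open Classical in
/-- The same sum restricted to the partitions with `n - ℓ(ν)` even. -/
def sumPowTwoEven (n : ℕ) : SymmFun :=
  ∑ ν : n.Partition with PartsPowTwo ν ∧ Even (n - ν.parts.card), powerSumPart ν

end

/-! Write L for the series Lie^(2) and D for the Euler derivation, which multiplies a term by its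
degree. An element of order d in C_n has cycle monomial p_d^(n/d), so ch Lie_n^(2) = (1/n) Σ_{d∣n}
c_d p_d^(n/d), where c_d sums the character over the elements of order d. Summing the character over
the subgroup of order m shows that Σ_{d∣m} c_d is m if m is a power of 2 and 0 otherwise
(`sum_divisors_orderSum`). In particular c_d does not depend on n, and D L = Σ_{d,e≥1} c_d p_d^e.

The series H_ε = Σ_m ε^m h_m[L] = exp(Σ_k ε^k p_k[L]/k) satisfies D H_ε = S_ε H_ε with S_ε = Σ_k ε^k
p_k[D L]. The coefficient of p_m^e in S_ε is Σ_{k∣m} ε^k c_{m/k}. For ε = 1 this is m on powers of 2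
and 0 elsewhere; for ε = -1 it is -1 at m = 1 and 0 elsewhere. The equation and the constant term 1
determine H_ε, so H_1 = ∏_a 1/(1 - p_{2^a}) and H_{-1} = 1 - p_1. Infinite sums are avoided by
truncating and working modulo terms of high degree.

In degree n, H_1 gives ch Vh(n), and the absence of terms of degree at least 2 in H_{-1} gives
equality of the odd and even halves. Tensoring with the sign multiplies p_λ by (-1)^(n-ℓ(λ)). In odd
degree every monomial in the p_{2^a} contains p_1, and multiplication by p_1 is induction from
S_{2n} to S_{2n+1}. Isomorphisms follow because complex representations are determined by their
characters (`nonempty_equiv_of_character_eq`).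

Existence of the modules comes from polynomial functors on matrices. Images of projectors on tensor
powers realise h_m[L] up to degree n, and evaluation on permutation matrices, restricted to words
using every letter once, gives an S_n-module with the required characteristic (`exists_isVhFamily`).

Schur positivity holds for the characteristic of any module. For an irreducible module the Schur
coefficients are integers whose squares sum to 1, so the characteristic is plus or minus a Schur
function; the sign is fixed by a lexicographic leading coefficient
(`exists_frobeniusChar_eq_schurFun`). -/

noncomputable section

/-! ### Power sum monomials of permutations and traces of twisted tensor powers -/

section CycleMonomial

open Equiv Equiv.Perm

variable {ι κ : Type*} [Fintype ι] [DecidableEq ι] [Fintype κ] [DecidableEq κ]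

/-- `p_{type σ}`. -/
def cycleMonomial (σ : Perm ι) : SymmFun := powerSumPart σ.partition

theorem cycleMonomial_eq (σ : Perm ι) :
    cycleMonomial σ = (σ.cycleType.map fun k => (MvPolynomial.X k.toPNat' : SymmFun)).prod *
      MvPolynomial.X 1 ^ (Fintype.card ι - σ.cycleType.sum) := by
  rw [cycleMonomial, powerSumPart, parts_partition, Multiset.map_add, Multiset.prod_add,
    Multiset.map_replicate, Multiset.prod_replicate, sum_cycleType]
  rfl

theorem cycleType_permCongr (e : ι ≃ κ) (σ : Perm ι) :
    (e.permCongr σ).cycleType = σ.cycleType := by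
  have h : e.permCongr σ = σ.extendDomain (e.trans (Equiv.Set.univ κ).symm) := by
    ext x
    rw [extendDomain_apply_subtype _ _ (Set.mem_univ x)]
    simp
  rw [h, cycleType_extendDomain]

theorem cycleMonomial_permCongr (e : ι ≃ κ) (σ : Perm ι) :
    cycleMonomial (e.permCongr σ) = cycleMonomial σ := by
  rw [cycleMonomial_eq, cycleMonomial_eq, cycleType_permCongr, Fintype.card_congr e]

theorem cycleType_sumCongr (σ : Perm ι) (τ : Perm κ) :
    (Perm.sumCongr σ τ).cycleType = σ.cycleType + τ.cycleType := by
  have h : Perm.sumCongr σ τ = Perm.sumCongr σ 1 * Perm.sumCongr 1 τ := by simp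
  have h1 : (Perm.sumCongr σ (1 : Perm κ)).cycleType = σ.cycleType := by
    have : Perm.sumCongr σ (1 : Perm κ) =
        σ.extendDomain (Equiv.ofInjective (Sum.inl : ι → ι ⊕ κ) Sum.inl_injective) := by
      ext x
      rcases x with x | x
      · exact (extendDomain_apply_image σ
          (Equiv.ofInjective (Sum.inl : ι → ι ⊕ κ) Sum.inl_injective) x).symm
      · rw [extendDomain_apply_not_subtype _ _ (by simp)]
        rfl
    rw [this, cycleType_extendDomain]
  have h2 : (Perm.sumCongr (1 : Perm ι) τ).cycleType = τ.cycleType := by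
    have : Perm.sumCongr (1 : Perm ι) τ =
        τ.extendDomain (Equiv.ofInjective (Sum.inr : κ → ι ⊕ κ) Sum.inr_injective) := by
      ext x
      rcases x with x | x
      · rw [extendDomain_apply_not_subtype _ _ (by simp)]
        rfl
      · exact (extendDomain_apply_image τ
          (Equiv.ofInjective (Sum.inr : κ → ι ⊕ κ) Sum.inr_injective) x).symm
    rw [this, cycleType_extendDomain]
  rw [h, Disjoint.cycleType_mul, h1, h2]
  rintro (x | x) <;> simp

theorem cycleMonomial_sumCongr (σ : Perm ι) (τ : Perm κ) :
    cycleMonomial (Perm.sumCongr σ τ) = cycleMonomial σ * cycleMonomial τ := by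
  have h : Fintype.card (ι ⊕ κ) - (σ.cycleType + τ.cycleType).sum =
      (Fintype.card ι - σ.cycleType.sum) + (Fintype.card κ - τ.cycleType.sum) := by
    have := sum_cycleType_le σ
    have := sum_cycleType_le τ
    rw [Fintype.card_sum, Multiset.sum_add]
    omega
  rw [cycleMonomial_eq, cycleMonomial_eq, cycleMonomial_eq, cycleType_sumCongr, h,
    Multiset.map_add, Multiset.prod_add, pow_add]
  ring

theorem cycleMonomial_finRotate (n : ℕ) :
    cycleMonomial (finRotate (n + 1)) = MvPolynomial.X n.succPNat := by
  rcases n with _ | n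
  · rw [cycleMonomial_eq, show finRotate (0 + 1) = 1 from
      (inferInstance : Subsingleton (Perm (Fin 1))).elim _ _]
    simp
    rfl
  · rw [cycleMonomial_eq, cycleType_finRotate]
    simp
    rfl

theorem cycleMonomial_of_isConj {σ τ : Perm ι} (h : IsConj σ τ) :
    cycleMonomial σ = cycleMonomial τ := by
  rw [cycleMonomial, cycleMonomial, partition_eq_of_isConj.mp h]

/-- The trace of `A ⊗ ⋯ ⊗ A` composed with the permutation `σ` of the tensor factors. -/
def twistedTrace {Ω R : Type*} [Fintype Ω] [CommSemiring R] (A : Matrix Ω Ω R) (σ : Perm ι) : R :=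
  ∑ f : ι → Ω, ∏ i, A (f i) (f (σ i))

section Trace

variable {Ω R : Type*} [Fintype Ω] [CommSemiring R] (A : Matrix Ω Ω R)

theorem twistedTrace_permCongr (e : ι ≃ κ) (σ : Perm ι) :
    twistedTrace A (e.permCongr σ) = twistedTrace A σ := by
  refine Fintype.sum_equiv (Equiv.arrowCongr e.symm (Equiv.refl Ω)) _ _ fun f => ?_
  exact Fintype.prod_equiv e.symm _ _ fun i => by simp

theorem twistedTrace_sumCongr (σ : Perm ι) (τ : Perm κ) :
    twistedTrace A (Perm.sumCongr σ τ) = twistedTrace A σ * twistedTrace A τ := by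
  rw [twistedTrace, twistedTrace, twistedTrace, Finset.sum_mul_sum, ← Finset.sum_product',
    Finset.univ_product_univ]
  refine Fintype.sum_equiv (Equiv.sumArrowEquivProdArrow ι κ Ω) _ _ fun f => ?_
  rw [Fintype.prod_sum_type]
  rfl

/-- Walks with n steps from x, weighted by entries of A and by v at the end. The start is fixed by
an indicator, so the induction can prepend a vertex. -/
theorem sum_path_eq_pow_mulVec [DecidableEq Ω] (n : ℕ) (v : Ω → R) (x : Ω) :
    ∑ f : Fin (n + 1) → Ω, (if f 0 = x then 1 else 0) *
      ((∏ i : Fin n, A (f i.castSucc) (f i.succ)) * v (f (Fin.last n))) =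
      ((A ^ n).mulVec v) x := by
  induction n generalizing x with
  | zero =>
    rw [Fintype.sum_equiv (Equiv.funUnique (Fin 1) Ω) _
      (fun y => (if y = x then 1 else 0) * v y) (fun f => by simp)]
    simp
  | succ n ih =>
    rw [← (Fin.consEquiv fun _ => Ω).sum_comp, Fintype.sum_prod_type]
    have h : ∀ (y : Ω) (g : Fin (n + 1) → Ω),
        (if (Fin.consEquiv fun _ => Ω) (y, g) 0 = x then (1 : R) else 0) *
        ((∏ i : Fin (n + 1), A ((Fin.consEquiv fun _ => Ω) (y, g) i.castSucc)
          ((Fin.consEquiv fun _ => Ω) (y, g) i.succ)) *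
            v ((Fin.consEquiv fun _ => Ω) (y, g) (Fin.last (n + 1)))) =
        (if y = x then 1 else 0) * (A y (g 0) *
          ((∏ i : Fin n, A (g i.castSucc) (g i.succ)) * v (g (Fin.last n)))) := by
      intro y g
      rw [Fin.prod_univ_succ, ← Fin.succ_last]
      simp only [Fin.consEquiv_apply, Fin.cons_zero, Fin.cons_succ, Fin.castSucc_zero,
        ← Fin.succ_castSucc, mul_assoc]
    simp_rw [h, ← Finset.mul_sum, ite_mul, one_mul, zero_mul]
    rw [Finset.sum_ite_eq' Finset.univ x, if_pos (Finset.mem_univ x), pow_succ',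
      ← Matrix.mulVec_mulVec, Matrix.mulVec, dotProduct]
    simp_rw [← ih, Finset.mul_sum]
    rw [Finset.sum_comm]
    refine Finset.sum_congr rfl fun g _ => ?_
    simp

/-- A closed walk of n + 1 steps is an open walk of n steps followed by the edge back to its start.
That closing edge is put into the end weight v. -/
theorem twistedTrace_finRotate [DecidableEq Ω] (n : ℕ) :
    twistedTrace A (finRotate (n + 1)) = (A ^ (n + 1)).trace := by
  have h : ∀ x, (A ^ (n + 1)) x x = ((A ^ n).mulVec fun y => A y x) x := fun x => by
    rw [pow_succ]; rfl
  simp_rw [Matrix.trace, Matrix.diag, h, ← sum_path_eq_pow_mulVec, twistedTrace]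
  rw [Finset.sum_comm]
  refine Finset.sum_congr rfl fun f _ => ?_
  rw [Finset.sum_eq_single (f 0) (fun x _ hx => by rw [if_neg (Ne.symm hx), zero_mul])
    (fun h => absurd (Finset.mem_univ _) h), if_pos rfl, one_mul, Fin.prod_univ_castSucc,
    finRotate_last]
  congr 1
  refine Finset.prod_congr rfl fun i _ => ?_
  rw [finRotate_apply, Fin.coeSucc_eq_succ]

/-- A permutation splits as a rotation and a permutation of a smaller set. -/
theorem exists_permCongr_eq_sumCongr_finRotate [Nonempty ι] (σ : Perm ι) :
    ∃ (p : ι → Prop) (n : ℕ) (τ : Perm {x // p x})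
      (e : Fin (n + 1) ⊕ {x // p x} ≃ ι),
      e.permCongr (Perm.sumCongr (finRotate (n + 1)) τ) = σ := by
  classical
  obtain ⟨a⟩ := ‹Nonempty ι›
  obtain ⟨n, hn⟩ : ∃ n, Function.minimalPeriod σ a = n + 1 :=
    Nat.exists_eq_succ_of_ne_zero (Function.minimalPeriod_pos_of_mem_periodicPts
      (Function.mk_mem_periodicPts (orderOf_pos σ) (by
        rw [Function.IsPeriodicPt, Function.IsFixedPt, ← coe_pow, pow_orderOf_eq_one]
        rfl))).ne'
  -- This lists the orbit of a, on which σ acts as the rotation; the complement of the orbit is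
  -- σ-stable.
  set g : Fin (n + 1) → ι := fun i => σ^[i] a with hg
  have hgi : Function.Injective g := fun i j hij =>
    Fin.ext (Function.iterate_injOn_Iio_minimalPeriod (by simp [hn]; omega)
      (by simp [hn]; omega) hij)
  have hmem : ∀ k : ℕ, σ^[k] a ∈ Set.range g := fun k =>
    ⟨⟨k % (n + 1), Nat.mod_lt _ n.succ_pos⟩, by
      simp only [hg, ← hn, Function.iterate_mod_minimalPeriod_eq]⟩
  have hrot : ∀ i, g (finRotate (n + 1) i) = σ (g i) := fun i => by
    rw [finRotate_apply]
    simp only [hg]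
    rw [← Function.iterate_succ_apply' σ, ← Function.iterate_mod_minimalPeriod_eq (n := _ + 1), hn,
      Fin.val_add, Fin.val_one']
    simp
  have hiff : ∀ x, σ x ∉ Set.range g ↔ x ∉ Set.range g := fun x => not_congr ⟨by
    rintro ⟨i, hi⟩
    have : x = g ((finRotate (n + 1)).symm i) := σ.injective (by
      rw [← hi, ← hrot, Equiv.apply_symm_apply])
    exact ⟨_, this.symm⟩, by
    rintro ⟨i, rfl⟩
    exact ⟨_, hrot i⟩⟩
  have hbij : Function.Bijective (Sum.elim g (Subtype.val : {x // x ∉ Set.range g} → ι)) := by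
    refine ⟨hgi.sumElim Subtype.val_injective fun i x h => x.2 ⟨i, h⟩, fun x => ?_⟩
    by_cases hx : x ∈ Set.range g
    · obtain ⟨i, rfl⟩ := hx
      exact ⟨Sum.inl i, rfl⟩
    · exact ⟨Sum.inr ⟨x, hx⟩, rfl⟩
  refine ⟨fun x => x ∉ Set.range g, n, σ.subtypePerm hiff, Equiv.ofBijective _ hbij, ?_⟩
  ext x
  obtain ⟨z, rfl⟩ := (Equiv.ofBijective _ hbij).surjective x
  rw [permCongr_apply, Equiv.symm_apply_apply]
  rcases z with i | y
  · exact hrot i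
  · rfl

/-- Both sides are multiplicative over cycles, and a cycle of length k contributes tr A^k. Cycles
are split off one at a time. Through this identity power sums become traces, which is used both for
the functors and for words. -/
theorem twistedTrace_eq {R : Type*} [CommRing R] [Algebra ℂ R] [DecidableEq Ω] (A : Matrix Ω Ω R)
    (σ : Perm ι) :
    twistedTrace A σ = MvPolynomial.aeval (fun k : ℕ+ => (A ^ (k : ℕ)).trace) (cycleMonomial σ) := by
  induction hN : Fintype.card ι using Nat.strong_induction_on generalizing ι with
  | _ N ih =>
    rcases isEmpty_or_nonempty ι with h | h
    · rw [cycleMonomial_eq, twistedTrace]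
      simp [Subsingleton.elim σ 1]
    · classical
      obtain ⟨p, n, τ, e, rfl⟩ := exists_permCongr_eq_sumCongr_finRotate σ
      have hc := Fintype.card_congr e
      rw [Fintype.card_sum, Fintype.card_fin] at hc
      rw [twistedTrace_permCongr, cycleMonomial_permCongr, twistedTrace_sumCongr,
        cycleMonomial_sumCongr, map_mul, twistedTrace_finRotate, cycleMonomial_finRotate,
        ih (Fintype.card {x // p x}) (by omega) τ rfl]
      simp

end Trace

end CycleMonomial

/-! ### Characters of representations and the Frobenius characteristic -/

section PartExp

/-- The exponent of the monomial `p_ν`. -/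
def partExp {n : ℕ} (ν : n.Partition) : ℕ+ →₀ ℕ :=
  Multiset.toFinsupp (ν.parts.map Nat.toPNat')

theorem powerSumPart_eq_monomial {n : ℕ} (ν : n.Partition) :
    powerSumPart ν = MvPolynomial.monomial (partExp ν) 1 := by
  have h : ∀ s : Multiset ℕ+, (s.map fun k => (MvPolynomial.X k : SymmFun)).prod =
      MvPolynomial.monomial (Multiset.toFinsupp s) 1 := by
    intro s
    induction s using Multiset.induction_on with
    | empty => simp
    | cons a s ih =>
      rw [Multiset.map_cons, Multiset.prod_cons, ih, ← Multiset.singleton_add, map_add,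
        Multiset.toFinsupp_singleton, MvPolynomial.X, MvPolynomial.monomial_mul, one_mul]
  rw [powerSumPart, partExp, ← h, Multiset.map_map]
  rfl

theorem partExp_apply {n : ℕ} (ν : n.Partition) (k : ℕ+) :
    partExp ν k = ν.parts.count (k : ℕ) := by
  rw [partExp, Multiset.toFinsupp_apply, ← Multiset.count_map_eq_count' _ _ PNat.coe_injective,
    Multiset.map_map]
  congr 1
  conv_rhs => rw [← Multiset.map_id ν.parts]
  refine Multiset.map_congr rfl fun x hx => ?_
  simp [Nat.toPNat'_coe, ν.parts_pos hx]

theorem partExp_injective {n : ℕ} : Function.Injective (partExp : n.Partition → ℕ+ →₀ ℕ) := by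
  intro ν μ h
  refine Nat.Partition.ext (Multiset.ext.mpr fun a => ?_)
  rcases Nat.eq_zero_or_pos a with rfl | ha
  · rw [Multiset.count_eq_zero_of_notMem fun h => (ν.parts_pos h).ne rfl,
      Multiset.count_eq_zero_of_notMem fun h => (μ.parts_pos h).ne rfl]
  · obtain ⟨k, rfl⟩ : ∃ k : ℕ+, (k : ℕ) = a := ⟨⟨a, ha⟩, rfl⟩
    rw [← partExp_apply, ← partExp_apply, h]

theorem weight_toFinsupp (s : Multiset ℕ+) :
    Finsupp.weight (fun k : ℕ+ => (k : ℕ)) (Multiset.toFinsupp s) =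
      (s.map fun k : ℕ+ => (k : ℕ)).sum := by
  induction s using Multiset.induction_on with
  | empty => simp
  | cons a s ih =>
    rw [← Multiset.singleton_add, map_add, map_add, ih, Multiset.toFinsupp_singleton,
      Finsupp.weight_single]
    simp

theorem weight_partExp {n : ℕ} (ν : n.Partition) :
    Finsupp.weight (fun k : ℕ+ => (k : ℕ)) (partExp ν) = n := by
  rw [partExp, weight_toFinsupp, Multiset.map_map]
  conv_rhs => rw [← ν.parts_sum, ← Multiset.map_id ν.parts]
  congr 1
  refine Multiset.map_congr rfl fun x hx => ?_
  simp [Nat.toPNat'_coe, ν.parts_pos hx]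

theorem exists_partExp_eq {n : ℕ} {m : ℕ+ →₀ ℕ}
    (hm : Finsupp.weight (fun k : ℕ+ => (k : ℕ)) m = n) : ∃ ν : n.Partition, partExp ν = m := by
  refine ⟨⟨(Finsupp.toMultiset m).map fun k : ℕ+ => (k : ℕ), ?_, ?_⟩, ?_⟩
  · intro i hi
    obtain ⟨k, -, rfl⟩ := Multiset.mem_map.mp hi
    exact k.pos
  · rw [← weight_toFinsupp, Finsupp.toMultiset_toFinsupp, hm]
  · ext k
    rw [partExp_apply]
    change Multiset.count (k : ℕ) (Multiset.map _ _) = _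
    rw [Multiset.count_map_eq_count' _ _ PNat.coe_injective, Finsupp.count_toMultiset]

end PartExp

section ClassFunction

open Equiv

/-- `(1/n!) ∑_σ φ(σ) p_{type σ}`. -/
def charSum {n : ℕ} (φ : Perm (Fin n) → ℂ) : SymmFun :=
  ((n.factorial : ℂ)⁻¹) • ∑ σ, φ σ • cycleMonomial σ

theorem frobeniusChar_eq_charSum {n : ℕ} {W : Type*} [AddCommGroup W] [Module ℂ W]
    (ρ : Representation ℂ (Perm (Fin n)) W) : frobeniusChar ρ = charSum ρ.character := rfl

theorem charSum_add {n : ℕ} (φ ψ : Perm (Fin n) → ℂ) :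
    charSum (φ + ψ) = charSum φ + charSum ψ := by
  simp [charSum, add_smul, Finset.sum_add_distrib]

theorem charSum_sum {n : ℕ} {ι : Type*} (s : Finset ι) (φ : ι → Perm (Fin n) → ℂ) :
    charSum (fun σ => ∑ i ∈ s, φ i σ) = ∑ i ∈ s, charSum (φ i) := by
  simp only [charSum, Finset.sum_smul, Finset.smul_sum]
  rw [Finset.sum_comm]

theorem coeff_cycleMonomial {n : ℕ} (σ τ : Perm (Fin n)) :
    MvPolynomial.coeff (partExp τ.partition) (cycleMonomial σ) =
      open Classical in if IsConj σ τ then 1 else 0 := by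
  classical
  rw [cycleMonomial, powerSumPart_eq_monomial, MvPolynomial.coeff_monomial]
  simp only [partExp_injective.eq_iff, Perm.partition_eq_of_isConj]

/-- The coefficient at the cycle type of τ sees only the conjugacy class of τ. It is the value at τ
times the class size over n!, and this factor is nonzero. -/
theorem charSum_injective {n : ℕ} {φ ψ : Perm (Fin n) → ℂ}
    (hφ : ∀ σ τ, IsConj σ τ → φ σ = φ τ) (hψ : ∀ σ τ, IsConj σ τ → ψ σ = ψ τ)
    (h : charSum φ = charSum ψ) : φ = ψ := by
  classical
  have key : ∀ χ : Perm (Fin n) → ℂ, (∀ σ τ, IsConj σ τ → χ σ = χ τ) → ∀ τ,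
      MvPolynomial.coeff (partExp τ.partition) (charSum χ) =
        (n.factorial : ℂ)⁻¹ * ((Finset.univ.filter fun σ => IsConj σ τ).card * χ τ) := by
    intro χ hχ τ
    rw [charSum, MvPolynomial.coeff_smul, MvPolynomial.coeff_sum, smul_eq_mul]
    simp_rw [MvPolynomial.coeff_smul, coeff_cycleMonomial, smul_eq_mul, mul_ite, mul_one, mul_zero]
    rw [← Finset.sum_filter, ← nsmul_eq_mul, ← Finset.sum_const]
    congr 1
    exact Finset.sum_congr rfl fun σ hσ => hχ _ _ (Finset.mem_filter.mp hσ).2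
  ext τ
  have h' := congrArg (MvPolynomial.coeff (partExp τ.partition)) h
  rw [key φ hφ, key ψ hψ] at h'
  have h1 : (n.factorial : ℂ)⁻¹ ≠ 0 := inv_ne_zero (by exact_mod_cast n.factorial_ne_zero)
  have h2 : (((Finset.univ.filter fun σ => IsConj σ τ).card : ℕ) : ℂ) ≠ 0 := by
    rw [Nat.cast_ne_zero]
    exact (Finset.card_pos.mpr ⟨τ, by simpa using ⟨1, by simp⟩⟩).ne'
  exact mul_left_cancel₀ h2 (mul_left_cancel₀ h1 h')

theorem character_eq_of_isConj {G W : Type*} [Group G] [AddCommGroup W] [Module ℂ W]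
    (ρ : Representation ℂ G W) (σ τ : G) (h : IsConj σ τ) :
    ρ.character σ = ρ.character τ := by
  obtain ⟨c, rfl⟩ := isConj_iff.mp h
  exact (ρ.char_conj σ c).symm

/-- Inverse permutations have equal cycle type, hence are conjugate. This removes the inverse from
the orthogonality relations. -/
theorem character_inv {n : ℕ} {W : Type*} [AddCommGroup W] [Module ℂ W]
    (ρ : Representation ℂ (Perm (Fin n)) W) (σ : Perm (Fin n)) :
    ρ.character σ⁻¹ = ρ.character σ :=
  character_eq_of_isConj ρ _ _
    (Perm.isConj_iff_cycleType_eq.mpr (Perm.cycleType_inv σ))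

end ClassFunction

section Operations

variable {G W W' : Type*} [Group G] [AddCommGroup W] [Module ℂ W] [AddCommGroup W'] [Module ℂ W']
  [FiniteDimensional ℂ W] [FiniteDimensional ℂ W']

theorem character_prod (ρ : Representation ℂ G W) (ρ' : Representation ℂ G W') :
    (ρ.prod ρ').character = ρ.character + ρ'.character :=
  funext fun g => LinearMap.trace_prodMap' (ρ g) (ρ' g)

theorem trace_lmap {ι : Type*} [Fintype ι] [DecidableEq ι] {V : ι → Type*}
    [∀ i, AddCommGroup (V i)] [∀ i, Module ℂ (V i)] [∀ i, FiniteDimensional ℂ (V i)]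
    (f : ∀ i, V i →ₗ[ℂ] V i) :
    LinearMap.trace ℂ (⨁ i, V i) (DirectSum.lmap f) = ∑ i, LinearMap.trace ℂ (V i) (f i) := by
  have : FiniteDimensional ℂ (⨁ i, V i) :=
    Module.Finite.equiv (DirectSum.linearEquivFunOnFintype ℂ ι V).symm
  have h : DirectSum.lmap f = ∑ i, (DirectSum.lof ℂ ι V i) ∘ₗ (f i ∘ₗ DirectSum.component ℂ ι V i) := by
    ext i x j
    simp only [LinearMap.coe_comp, Function.comp_apply, DirectSum.lmap_lof, LinearMap.coe_sum,
      Finset.sum_apply]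
    rw [Finset.sum_eq_single i]
    · simp
    · intro b _ hb
      rw [DirectSum.component.of, dif_neg (Ne.symm hb)]
      simp
    · simp
  rw [h, map_sum]
  refine Finset.sum_congr rfl fun i _ => ?_
  rw [LinearMap.trace_comp_comm', LinearMap.comp_assoc]
  congr 1
  ext x
  simp

theorem character_directSum {ι : Type*} [Fintype ι] [DecidableEq ι] {V : ι → Type*}
    [∀ i, AddCommGroup (V i)] [∀ i, Module ℂ (V i)] [∀ i, FiniteDimensional ℂ (V i)]
    (ρ : ∀ i, Representation ℂ G (V i)) :
    (Representation.directSum ρ).character = fun g => ∑ i, (ρ i).character g :=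
  funext fun g => trace_lmap fun i => ρ i g

theorem character_linearCharRep (χ : G →* ℂ) (g : G) :
    (linearCharRep χ).character g = χ g := by
  change LinearMap.trace ℂ ℂ (χ g • LinearMap.id) = _
  simp

/-- The trace of an endomorphism induced on coinvariants. -/
theorem trace_coinvariants_map [Fintype G] (ρ : Representation ℂ G W)
    (f : ρ.IntertwiningMap ρ) :
    LinearMap.trace ℂ ρ.Coinvariants (Representation.Coinvariants.map ρ ρ f) =
      (Fintype.card G : ℂ)⁻¹ * ∑ g, LinearMap.trace ℂ W (f.toLinearMap ∘ₗ ρ g) := by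
  have hG : (Fintype.card G : ℂ) ≠ 0 := by exact_mod_cast Fintype.card_ne_zero
  -- The averaging projector P factors through the coinvariants as s after `mk`, and s is a section
  -- of `mk`. By cyclicity the trace on coinvariants is the trace of f ∘ P on W.
  set P : W →ₗ[ℂ] W := (Fintype.card G : ℂ)⁻¹ • ∑ g, ρ g with hP
  have hPρ : ∀ g, P ∘ₗ ρ g = P := fun g => by
    rw [hP, LinearMap.smul_comp, ← Module.End.mul_eq_comp, Finset.sum_mul]
    congr 1
    exact Fintype.sum_equiv (Equiv.mulRight g) _ _ fun h => by simp
  let s := Representation.Coinvariants.lift ρ P hPρ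
  have hmkP : Representation.Coinvariants.mk ρ ∘ₗ P = Representation.Coinvariants.mk ρ := by
    ext x
    simp [hP, ← Nat.cast_smul_eq_nsmul ℂ, smul_smul, hG]
  have hs : Representation.Coinvariants.mk ρ ∘ₗ s = LinearMap.id := by
    apply Representation.Coinvariants.hom_ext
    rw [LinearMap.comp_assoc, Representation.Coinvariants.lift_comp_mk, hmkP, LinearMap.id_comp]
  have h1 : Representation.Coinvariants.map ρ ρ f =
      (Representation.Coinvariants.mk ρ) ∘ₗ (f.toLinearMap ∘ₗ s) := by
    conv_lhs => rw [← LinearMap.comp_id (Representation.Coinvariants.map ρ ρ f), ← hs]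
    rfl
  rw [h1, LinearMap.trace_comp_comm', LinearMap.comp_assoc, Representation.Coinvariants.lift_comp_mk,
    hP, LinearMap.comp_smul, ← Module.End.mul_eq_comp, Finset.mul_sum, map_smul, map_sum,
    smul_eq_mul]
  rfl

end Operations

/-! ### Characters of induced representations -/

section Induced

variable {G H W : Type*} [Group G] [Group H] [Fintype G] [DecidableEq G] [Fintype H]
  [AddCommGroup W] [Module ℂ W] [FiniteDimensional ℂ W]

theorem trace_mapDomainLinearMap {G : Type*} [Fintype G] [DecidableEq G] (f : G → G) :
    LinearMap.trace ℂ (MonoidAlgebra ℂ G) (MonoidAlgebra.mapDomainLinearMap ℂ ℂ f) =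
      ((Finset.univ.filter fun x => f x = x).card : ℂ) := by
  rw [LinearMap.trace_eq_matrix_trace ℂ (MonoidAlgebra.basis G ℂ), Matrix.trace]
  simp [LinearMap.toMatrix_apply, MonoidAlgebra.basis, Finsupp.single_apply,
    MonoidAlgebra.mapDomainLinearMap_single]

/-- The induced module is the space of H-coinvariants of ℂ[G] ⊗ W. Its trace is therefore an average
over H of a trace on W times the number of x fixed by x ↦ φ(h) x g⁻¹. -/
theorem character_ind (φ : H →* G) (ρ : Representation ℂ H W) (g : G) :
    (Representation.ind φ ρ).character g =
      (Fintype.card H : ℂ)⁻¹ * ∑ h, ((Finset.univ.filter fun x => x * g * x⁻¹ = φ h).card : ℂ) *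
        ρ.character h := by
  have : FiniteDimensional ℂ (MonoidAlgebra ℂ G) := (MonoidAlgebra.basis G ℂ).finiteDimensional_of_finite
  refine (trace_coinvariants_map _ _).trans ?_
  congr 1
  refine Finset.sum_congr rfl fun h _ => ?_
  have h1 : ((MonoidAlgebra.mapDomainLinearMap ℂ ℂ fun x => x * g⁻¹).rTensor W) ∘ₗ
      (Representation.tprod ((Representation.leftRegular ℂ G).comp φ) ρ) h =
      TensorProduct.map (MonoidAlgebra.mapDomainLinearMap ℂ ℂ fun x => φ h * x * g⁻¹) (ρ h) := by
    ext x w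
    simp
  change LinearMap.trace ℂ _ (((MonoidAlgebra.mapDomainLinearMap ℂ ℂ fun x => x * g⁻¹).rTensor W) ∘ₗ
      (Representation.tprod ((Representation.leftRegular ℂ G).comp φ) ρ) h) = _
  rw [h1, LinearMap.trace_tensorProduct', trace_mapDomainLinearMap]
  congr 3
  ext x
  simp only [Finset.mem_filter, Finset.mem_univ, true_and]
  rw [mul_inv_eq_iff_eq_mul, eq_comm, mul_inv_eq_iff_eq_mul]

/-- The Frobenius characteristic of an induced representation. -/
theorem frobeniusChar_ind {n : ℕ} (φ : H →* Equiv.Perm (Fin n)) (ρ : Representation ℂ H W) :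
    frobeniusChar (Representation.ind φ ρ) =
      (Fintype.card H : ℂ)⁻¹ • ∑ h, ρ.character h • cycleMonomial (φ h) := by
  classical
  have h0 : (n.factorial : ℂ) ≠ 0 := by exact_mod_cast n.factorial_ne_zero
  -- For each x exactly one σ satisfies xσx⁻¹ = τ, and it is conjugate to τ. So the sum is n! copies
  -- of the same monomial.
  have key : ∀ τ : Equiv.Perm (Fin n), ∑ σ : Equiv.Perm (Fin n),
      ((Finset.univ.filter fun x => x * σ * x⁻¹ = τ).card : ℂ) • cycleMonomial σ =
      (n.factorial : ℂ) • cycleMonomial τ := by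
    intro τ
    simp_rw [Finset.card_filter, Nat.cast_sum, Finset.sum_smul]
    rw [Finset.sum_comm]
    have : ∀ x : Equiv.Perm (Fin n), ∑ σ, (((if x * σ * x⁻¹ = τ then 1 else 0 : ℕ) : ℂ) •
        cycleMonomial σ) = cycleMonomial τ := by
      intro x
      rw [Finset.sum_eq_single (x⁻¹ * τ * x)]
      · rw [if_pos (by group), Nat.cast_one, one_smul]
        exact cycleMonomial_of_isConj (isConj_iff.mpr ⟨x, by group⟩)
      · intro σ _ hσ
        rw [if_neg (fun h => hσ (by rw [← h]; group)), Nat.cast_zero, zero_smul]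
      · simp
    rw [Finset.sum_congr rfl fun x _ => this x, Finset.sum_const, Finset.card_univ,
      Fintype.card_perm, Fintype.card_fin, Nat.cast_smul_eq_nsmul]
  rw [frobeniusChar_eq_charSum, charSum]
  simp_rw [character_ind, mul_smul, Finset.sum_smul, Finset.smul_sum (s := (Finset.univ : Finset H))]
  rw [Finset.sum_comm, Finset.smul_sum]
  refine Finset.sum_congr rfl fun h _ => ?_
  have : ∀ σ, (Fintype.card H : ℂ)⁻¹ • (((Finset.univ.filter fun x => x * σ * x⁻¹ = φ h).card : ℂ) *
      ρ.character h) • cycleMonomial σ = ((Fintype.card H : ℂ)⁻¹ * ρ.character h) •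
      (((Finset.univ.filter fun x => x * σ * x⁻¹ = φ h).card : ℂ) • cycleMonomial σ) := fun σ => by
    simp only [smul_smul]; congr 1; ring
  simp_rw [this, ← Finset.smul_sum, key, smul_smul]
  congr 1
  field_simp

end Induced

/-! ### Complex representations of a finite group are determined by their characters -/

section CharacterEquiv

open Representation

variable {G : Type*} [Group G]

theorem Subrepresentation.isCompl_toSubmodule {V : Type*} [AddCommGroup V] [Module ℂ V]
    {ρ : Representation ℂ G V} {U U' : Subrepresentation ρ} (h : IsCompl U U') :
    IsCompl U.toSubmodule U'.toSubmodule := by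
  refine IsCompl.of_eq ?_ ?_
  · rw [← Subrepresentation.toSubmodule_inf, h.inf_eq_bot]
    rfl
  · rw [← Subrepresentation.toSubmodule_sup, h.sup_eq_top]
    rfl

theorem nonempty_prod_equiv_of_isCompl {V : Type*} [AddCommGroup V] [Module ℂ V]
    {ρ : Representation ℂ G V} {U U' : Subrepresentation ρ} (h : IsCompl U U') :
    Nonempty ((U.toRepresentation.prod U'.toRepresentation).Equiv ρ) :=
  ⟨Representation.Equiv.mk
    (Submodule.prodEquivOfIsCompl _ _ (Subrepresentation.isCompl_toSubmodule h)) fun g => by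
      refine LinearMap.ext fun x => ?_
      simp [Subrepresentation.toRepresentation]⟩

/-- Finite dimension provides an atom in the lattice of subrepresentations, and Maschke's theorem
provides its complement. An atom is irreducible because a subrepresentation of it is also one of ρ.
-/
theorem exists_isIrreducible_isCompl [Finite G] {V : Type*} [AddCommGroup V] [Module ℂ V]
    [FiniteDimensional ℂ V] [Nontrivial V] (ρ : Representation ℂ G V) :
    ∃ U U' : Subrepresentation ρ, IsIrreducible U.toRepresentation ∧ IsCompl U U' := by
  have hmono : StrictMono (Subrepresentation.toSubmodule : Subrepresentation ρ → Submodule ℂ V) :=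
    fun a b h => h
  have : WellFoundedLT (Subrepresentation ρ) := hmono.wellFoundedLT
  have : IsAtomic (Subrepresentation ρ) := isAtomic_of_orderBot_wellFounded_lt this.wf
  have hne : (⊤ : Subrepresentation ρ) ≠ ⊥ := fun h =>
    top_ne_bot (α := Submodule ℂ V) (congrArg Subrepresentation.toSubmodule h)
  obtain ⟨U, hU, -⟩ := (IsAtomic.eq_bot_or_exists_atom_le (⊤ : Subrepresentation ρ)).resolve_left hne
  obtain ⟨U', hU'⟩ := exists_isCompl U
  refine ⟨U, U', ?_, hU'⟩
  have hUne : Nontrivial U.toSubmodule := by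
    rw [Submodule.nontrivial_iff_ne_bot]
    exact fun h => hU.1 (Subrepresentation.toSubmodule_injective h)
  refine { exists_pair_ne := ⟨⊥, ⊤, fun h => ?_⟩, eq_bot_or_eq_top := fun S => ?_ }
  · exact bot_ne_top (α := Submodule ℂ U.toSubmodule) (congrArg Subrepresentation.toSubmodule h)
  · let T : Subrepresentation ρ := ⟨S.toSubmodule.map U.toSubmodule.subtype, by
      rintro g _ ⟨x, hx, rfl⟩
      exact ⟨_, S.apply_mem_toSubmodule g hx, rfl⟩⟩
    have hT : T ≤ U := by
      rintro _ ⟨x, -, rfl⟩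
      exact x.2
    rcases hU.le_iff.mp hT with h | h
    · left
      apply Subrepresentation.toSubmodule_injective
      have h1 : S.toSubmodule.map U.toSubmodule.subtype = ⊥ :=
        congrArg Subrepresentation.toSubmodule h
      refine Submodule.map_injective_of_injective U.toSubmodule.injective_subtype ?_
      rw [h1]
      exact Submodule.map_bot _ |>.symm
    · right
      apply Subrepresentation.toSubmodule_injective
      have h1 : S.toSubmodule.map U.toSubmodule.subtype = U.toSubmodule :=
        congrArg Subrepresentation.toSubmodule h
      refine Submodule.map_injective_of_injective U.toSubmodule.injective_subtype ?_
      rw [h1]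
      exact (Submodule.map_subtype_top _).symm

theorem Representation.Equiv.prodCongr {V W V' W' : Type*} [AddCommGroup V] [Module ℂ V]
    [AddCommGroup W] [Module ℂ W] [AddCommGroup V'] [Module ℂ V'] [AddCommGroup W'] [Module ℂ W']
    {ρ : Representation ℂ G V} {σ : Representation ℂ G W} {ρ' : Representation ℂ G V'}
    {σ' : Representation ℂ G W'} (e : ρ.Equiv σ) (e' : ρ'.Equiv σ') :
    Nonempty ((ρ.prod ρ').Equiv (σ.prod σ')) :=
  ⟨Representation.Equiv.mk (e.toLinearEquiv.prodCongr e'.toLinearEquiv) fun g => by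
    refine LinearMap.ext fun x => Prod.ext ?_ ?_
    · exact e.toIntertwiningMap.isIntertwining _ _ g x.1
    · exact e'.toIntertwiningMap.isIntertwining _ _ g x.2⟩

/-- Induction on dimension. Split an irreducible U off ρ. The dimension of the space of intertwiners
out of U is computed from the characters, so there is a nonzero map from U to σ, injective by
irreducibility. The complements of the two copies of U again have equal characters. -/
theorem nonempty_equiv_of_character_eq [Fintype G] {V W : Type*} [AddCommGroup V] [Module ℂ V]
    [AddCommGroup W] [Module ℂ W] [FiniteDimensional ℂ V] [FiniteDimensional ℂ W]
    (ρ : Representation ℂ G V) (σ : Representation ℂ G W) (h : ρ.character = σ.character) :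
    Nonempty (ρ.Equiv σ) := by
  induction hn : Module.finrank ℂ V using Nat.strong_induction_on generalizing V W with
  | _ n ih =>
    have hrank : Module.finrank ℂ V = Module.finrank ℂ W := by
      have := congrFun h 1
      rw [char_one, char_one] at this
      exact_mod_cast this
    rcases subsingleton_or_nontrivial V with hV | hV
    · have : Subsingleton W := by
        rw [← Module.finrank_zero_iff (R := ℂ), ← hrank, Module.finrank_zero_iff]
        exact hV
      exact ⟨Representation.Equiv.mk 0 fun g => Subsingleton.elim _ _⟩
    · obtain ⟨U, U', hU, hUU'⟩ := exists_isIrreducible_isCompl ρ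
      have : Invertible (Nat.card G : ℂ) := invertibleOfNonzero (by
        exact_mod_cast Nat.card_pos.ne')
      have hdim : (Module.finrank ℂ (IntertwiningMap U.toRepresentation ρ) : ℂ) =
          Module.finrank ℂ (IntertwiningMap U.toRepresentation σ) := by
        rw [← card_inv_mul_sum_char_mul_char_eq_finrank,
          ← card_inv_mul_sum_char_mul_char_eq_finrank, h]
      have hUne : Nontrivial U.toSubmodule := by
        rw [Submodule.nontrivial_iff_ne_bot]
        intro h0
        obtain ⟨a, b, hab⟩ := hU.exists_pair_ne
        have : Subsingleton U.toSubmodule := by rw [h0]; infer_instance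
        exact hab (Subrepresentation.toSubmodule_injective (Subsingleton.elim _ _))
      let inc : IntertwiningMap U.toRepresentation ρ := ⟨U.toSubmodule.subtype, fun g => rfl⟩
      have hinc : inc ≠ 0 := fun h0 => by
        obtain ⟨x, hx⟩ := exists_ne (0 : U.toSubmodule)
        have : inc x = 0 := by rw [h0]; rfl
        exact hx (Subtype.ext this)
      have hf : ∃ f : IntertwiningMap U.toRepresentation σ, f ≠ 0 := by
        have : Nontrivial (IntertwiningMap U.toRepresentation ρ) := ⟨inc, 0, hinc⟩
        have h1 : 0 < Module.finrank ℂ (IntertwiningMap U.toRepresentation ρ) := by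
          have : Module.Finite ℂ (IntertwiningMap U.toRepresentation ρ) :=
            Module.Finite.equiv (invariantsEquivIntertwiningMap U.toRepresentation ρ)
          exact Module.finrank_pos
        rw [Nat.cast_inj.mp hdim] at h1
        have := Module.nontrivial_of_finrank_pos h1
        exact exists_ne 0
      obtain ⟨f, hf⟩ := hf
      have hfi := (IsIrreducible.injective_or_eq_zero f).resolve_right hf
      obtain ⟨R', hR'⟩ := exists_isCompl f.range
      have e1 : (U.toRepresentation).Equiv f.range.toRepresentation :=
        Representation.Equiv.mk (LinearEquiv.ofInjective f.toLinearMap hfi) fun g => by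
          refine LinearMap.ext fun x => Subtype.ext ?_
          exact f.isIntertwining _ _ g x
      obtain ⟨e2⟩ := nonempty_prod_equiv_of_isCompl hUU'
      obtain ⟨e3⟩ := nonempty_prod_equiv_of_isCompl hR'
      have hchar : U'.toRepresentation.character = R'.toRepresentation.character := by
        have h2 := (char_iso e2).trans (h.trans (char_iso e3).symm)
        rw [character_prod, character_prod, char_iso e1] at h2
        exact add_left_cancel h2
      have hlt : Module.finrank ℂ U'.toSubmodule < n := by
        have h3 := e2.toLinearEquiv.finrank_eq
        rw [Module.finrank_prod] at h3
        have h4 : 0 < Module.finrank ℂ U.toSubmodule := Module.finrank_pos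
        omega
      obtain ⟨e4⟩ := ih _ hlt U'.toRepresentation R'.toRepresentation hchar rfl
      obtain ⟨e5⟩ := Representation.Equiv.prodCongr e1 e4
      exact ⟨e2.symm.trans (e5.trans e3)⟩

theorem nonempty_equiv_of_frobeniusChar_eq {n : ℕ} {V W : Type*} [AddCommGroup V] [Module ℂ V]
    [AddCommGroup W] [Module ℂ W] [FiniteDimensional ℂ V] [FiniteDimensional ℂ W]
    (ρ : Representation ℂ (Equiv.Perm (Fin n)) V) (σ : Representation ℂ (Equiv.Perm (Fin n)) W)
    (h : frobeniusChar ρ = frobeniusChar σ) : Nonempty (ρ.Equiv σ) :=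
  nonempty_equiv_of_character_eq ρ σ
    (charSum_injective (character_eq_of_isConj ρ) (character_eq_of_isConj σ) h)

end CharacterEquiv

/-! ### The complete homogeneous symmetric functions -/

open Finset.HasAntidiagonal (antidiagonal)

section CompleteHomog

open Equiv

/-- The degree of a monomial in the power sums. -/
abbrev psDegree : (ℕ+ →₀ ℕ) →+ ℕ := Finsupp.weight fun k : ℕ+ => (k : ℕ)

/-- `z_ν = ∏ k^{m_k} m_k!`. -/
def zFactor (w : ℕ+ →₀ ℕ) : ℕ := w.prod fun k e => (k : ℕ) ^ e * e.factorial

theorem zFactor_pos (w : ℕ+ →₀ ℕ) : 0 < zFactor w :=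
  Finset.prod_pos fun k _ => Nat.mul_pos (pow_pos k.pos _) (Nat.factorial_pos _)

theorem zFactor_add_single (w : ℕ+ →₀ ℕ) (k : ℕ+) :
    zFactor (w + Finsupp.single k 1) = zFactor w * (k * (w k + 1)) := by
  have h : ∀ v : ℕ+ →₀ ℕ, v.support ⊆ insert k w.support →
      zFactor v = (k : ℕ) ^ v k * (v k).factorial *
        ∏ j ∈ (insert k w.support).erase k, (j : ℕ) ^ v j * (v j).factorial := by
    intro v hv
    rw [zFactor, Finsupp.prod_of_support_subset _ hv _ (fun i _ => by simp),
      ← Finset.mul_prod_erase _ (fun j : ℕ+ => (j : ℕ) ^ v j * (v j).factorial)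
        (Finset.mem_insert_self k w.support)]
  rw [h w (Finset.subset_insert _ _), h (w + Finsupp.single k 1)]
  · have : ∏ j ∈ (insert k w.support).erase k, (j : ℕ) ^ (w + Finsupp.single k 1 : ℕ+ →₀ ℕ) j *
        ((w + Finsupp.single k 1 : ℕ+ →₀ ℕ) j).factorial =
        ∏ j ∈ (insert k w.support).erase k, (j : ℕ) ^ w j * (w j).factorial := by
      refine Finset.prod_congr rfl fun j hj => ?_
      have hjk : j ≠ k := Finset.ne_of_mem_erase hj
      simp [hjk.symm]
    rw [this]
    simp only [Finsupp.add_apply, Finsupp.single_eq_same, Nat.factorial_succ, pow_succ]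
    ring
  · intro j hj
    rw [Finset.mem_insert]
    by_cases hjk : j = k
    · exact Or.inl hjk
    · right
      simpa [Finsupp.single_apply, Ne.symm hjk] using hj

theorem zFactor_partExp {n : ℕ} (ν : n.Partition) :
    zFactor (partExp ν) =
      ∏ k ∈ ν.parts.toFinset, k ^ ν.parts.count k * (ν.parts.count k).factorial := by
  rw [zFactor, Finsupp.prod]
  refine Finset.prod_nbij (fun k : ℕ+ => (k : ℕ)) ?_ PNat.coe_injective.injOn ?_ ?_
  · intro k hk
    rw [Finsupp.mem_support_iff, partExp_apply] at hk
    simpa [Multiset.count_eq_zero] using hk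
  · intro k hk
    rw [Finset.mem_coe, Multiset.mem_toFinset] at hk
    obtain ⟨k, rfl⟩ : ∃ j : ℕ+, (j : ℕ) = k := ⟨⟨k, ν.parts_pos hk⟩, rfl⟩
    refine ⟨k, ?_, rfl⟩
    rw [Finset.mem_coe, Finsupp.mem_support_iff, partExp_apply]
    simpa [Multiset.count_eq_zero] using hk
  · intro k _
    rw [partExp_apply]

/-- This is the class size n!/z_ν. Since `cycleType` omits fixed points, ν is split into its parts
at least 2 and its ones, the latter being recovered from the total n. -/
theorem card_partition_eq {n : ℕ} (ν : (Fintype.card (Fin n)).Partition) :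
    (Finset.univ.filter fun σ : Perm (Fin n) => σ.partition = ν).card * zFactor (partExp ν) =
      n.factorial := by
  set m := ν.parts.filter fun k => 2 ≤ k with hm
  have hparts : ν.parts = m + Multiset.replicate (ν.parts.count 1) 1 := by
    ext a
    rw [Multiset.count_add, hm, Multiset.count_filter, Multiset.count_replicate]
    rcases Nat.lt_or_ge a 2 with h | h
    · interval_cases a
      · simpa using fun h => (ν.parts_pos h).ne rfl
      · simp
    · rw [if_pos h, if_neg (by omega), add_zero]
  have hsum : m.sum + ν.parts.count 1 = Fintype.card (Fin n) := by
    conv_rhs => rw [← ν.parts_sum, hparts]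
    simp
  have hsub1 : Fintype.card (Fin n) - m.sum = ν.parts.count 1 := by omega
  have hset : (Finset.univ.filter fun σ : Perm (Fin n) => σ.partition = ν) =
      Finset.univ.filter fun σ : Perm (Fin n) => σ.cycleType = m := by
    ext σ
    simp only [Finset.mem_filter, Finset.mem_univ, true_and]
    constructor
    · rintro rfl
      exact Perm.filter_parts_partition_eq_cycleType.symm
    · intro h
      refine Nat.Partition.ext ?_
      rw [Perm.parts_partition, hparts, h, ← Perm.sum_cycleType, h, hsub1, ← hparts]
  have hz : (Fintype.card (Fin n) - m.sum).factorial * m.prod *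
      (∏ k ∈ m.toFinset, (m.count k).factorial) = zFactor (partExp ν) := by
    have h1 : 1 ∉ m.toFinset := by simp [hm]
    rw [hsub1, zFactor_partExp, Finset.prod_multiset_count, mul_assoc,
      ← Finset.prod_mul_distrib]
    have hsub : ν.parts.toFinset ⊆ insert 1 m.toFinset := by
      intro a ha
      rw [Multiset.mem_toFinset, hparts, Multiset.mem_add] at ha
      rw [Finset.mem_insert, Multiset.mem_toFinset]
      rcases ha with ha | ha
      · exact Or.inr ha
      · exact Or.inl (Multiset.eq_of_mem_replicate ha)
    rw [Finset.prod_subset hsub, Finset.prod_insert h1, one_pow, one_mul]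
    · congr 1
      refine Finset.prod_congr rfl fun k hk => ?_
      rw [hm, Multiset.mem_toFinset, Multiset.mem_filter] at hk
      rw [hm, Multiset.count_filter, if_pos hk.2]
    · intro a _ ha
      rw [Multiset.mem_toFinset] at ha
      rw [Multiset.count_eq_zero_of_notMem ha]
      simp
  rw [hset, ← hz, Perm.card_of_cycleType_mul_eq, if_pos, Fintype.card_fin]
  exact ⟨by omega, fun a ha => (Multiset.mem_filter.mp ha).2⟩

theorem completeHomog_eq_charSum (n : ℕ) : completeHomog n = charSum fun _ : Perm (Fin n) => 1 := by
  rw [completeHomog, frobeniusChar_eq_charSum]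
  congr 1
  ext σ
  simp [Representation.character]

theorem coeff_completeHomog (n : ℕ) (w : ℕ+ →₀ ℕ) :
    MvPolynomial.coeff w (completeHomog n) =
      if psDegree w = n then (zFactor w : ℂ)⁻¹ else 0 := by
  have h0 : (n.factorial : ℂ) ≠ 0 := by exact_mod_cast n.factorial_ne_zero
  rw [completeHomog_eq_charSum, charSum, MvPolynomial.coeff_smul, MvPolynomial.coeff_sum]
  simp_rw [one_smul, cycleMonomial, powerSumPart_eq_monomial, MvPolynomial.coeff_monomial]
  split_ifs with hw
  · rw [← Fintype.card_fin n] at hw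
    obtain ⟨ν, rfl⟩ := exists_partExp_eq hw
    simp_rw [partExp_injective.eq_iff]
    rw [Finset.sum_boole, smul_eq_mul, ← card_partition_eq ν]
    have : (zFactor (partExp ν) : ℂ) ≠ 0 := by exact_mod_cast (zFactor_pos _).ne'
    have h2 : (n.factorial : ℂ) ≠ 0 := h0
    rw [← card_partition_eq ν] at h2
    push_cast at h2 ⊢
    have h3 := left_ne_zero_of_mul h2
    field_simp
  · rw [Finset.sum_eq_zero, smul_zero]
    intro σ _
    rw [if_neg]
    rintro rfl
    exact hw ((weight_partExp σ.partition).trans (Fintype.card_fin n))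

theorem completeHomog_zero : completeHomog 0 = 1 := by
  ext w
  rw [coeff_completeHomog, MvPolynomial.coeff_one]
  by_cases hw : w = 0
  · subst hw; simp [zFactor]
  · rw [if_neg (Ne.symm hw), if_neg]
    intro h
    apply hw
    ext k
    by_contra hk
    have := Finsupp.le_weight (fun k : ℕ+ => (k : ℕ)) (s := k) k.pos.ne' w
    rw [h] at this
    exact hk (Nat.le_zero.mp this)

/-- The coefficient form of ∂/∂p_k exp(Σ p_j/j) = (1/k) exp(Σ p_j/j). -/
theorem pderiv_completeHomog_add (n : ℕ) (k : ℕ+) :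
    MvPolynomial.pderiv k (completeHomog (n + k)) = (k : ℂ)⁻¹ • completeHomog n := by
  ext w
  rw [MvPolynomial.coeff_pderiv, coeff_completeHomog, MvPolynomial.coeff_smul, coeff_completeHomog,
    map_add, psDegree, Finsupp.weight_single, smul_eq_mul, one_mul]
  simp only [Nat.add_right_cancel_iff]
  split_ifs
  · rw [zFactor_add_single]
    have h1 : (zFactor w : ℂ) ≠ 0 := by exact_mod_cast (zFactor_pos _).ne'
    have h2 : ((k : ℕ) : ℂ) ≠ 0 := by exact_mod_cast k.pos.ne'
    have h3 : ((w k : ℂ) + 1) ≠ 0 := by exact_mod_cast (w k).succ_ne_zero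
    push_cast
    rw [smul_eq_mul]
    field_simp
  · simp

/-- The Newton identity `n h_n = ∑ p_k h_{n-k}`. -/
theorem completeHomog_newton (n : ℕ) :
    ((n : ℂ) + 1) • completeHomog (n + 1) =
      ∑ p ∈ antidiagonal n,
        (MvPolynomial.X p.1.succPNat : SymmFun) * completeHomog p.2 := by
  ext w
  rw [MvPolynomial.coeff_smul, MvPolynomial.coeff_sum, coeff_completeHomog, smul_eq_mul]
  have h1 : (zFactor w : ℂ) ≠ 0 := by exact_mod_cast (zFactor_pos _).ne'
  -- Removing one factor p_k from w divides z_w by k·w_k. Each k thus contributes k·w_k/z_w, and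
  -- these add up to deg(w)/z_w.
  have key : ∀ p ∈ antidiagonal n, MvPolynomial.coeff w
      ((MvPolynomial.X p.1.succPNat : SymmFun) * completeHomog p.2) =
      if psDegree w = n + 1 then ((w p.1.succPNat * (p.1 + 1) : ℕ) : ℂ) * (zFactor w : ℂ)⁻¹ else 0 := by
    intro p hp
    rw [Finset.HasAntidiagonal.mem_antidiagonal] at hp
    rw [MvPolynomial.coeff_X_mul']
    by_cases hk : p.1.succPNat ∈ w.support
    · rw [if_pos hk, coeff_completeHomog]
      obtain ⟨v, rfl⟩ : ∃ v, w = v + Finsupp.single p.1.succPNat 1 := by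
        refine ⟨w - Finsupp.single p.1.succPNat 1, (tsub_add_cancel_of_le ?_).symm⟩
        rw [Finsupp.single_le_iff]
        exact Nat.one_le_iff_ne_zero.mpr (Finsupp.mem_support_iff.mp hk)
      rw [add_tsub_cancel_right, map_add, psDegree, Finsupp.weight_single]
      have hiff : Finsupp.weight (fun k : ℕ+ => (k : ℕ)) v + 1 • ((p.1.succPNat : ℕ+) : ℕ) = n + 1 ↔
          Finsupp.weight (fun k : ℕ+ => (k : ℕ)) v = p.2 := by
        rw [Nat.succPNat_coe, one_smul]; omega
      simp only [hiff]
      split_ifs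
      · rw [zFactor_add_single] at h1 ⊢
        push_cast at h1 ⊢
        simp only [Pi.add_apply, Finsupp.single_eq_same, Nat.succPNat_coe, Nat.succ_eq_add_one]
          at h1 ⊢
        push_cast at h1 ⊢
        have h2 := left_ne_zero_of_mul h1
        have h3 := right_ne_zero_of_mul h1
        have h4 := left_ne_zero_of_mul h3
        have h5 := right_ne_zero_of_mul h3
        field_simp
      · rfl
    · rw [if_neg hk]
      rw [Finsupp.notMem_support_iff] at hk
      simp [hk]
  rw [Finset.sum_congr rfl key]
  split_ifs with hw
  · rw [← Finset.sum_mul, ← Nat.cast_sum]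
    congr 1
    rw [Finset.Nat.sum_antidiagonal_eq_sum_range_succ_mk]
    have : ∑ i ∈ Finset.range n.succ, w i.succPNat * (i + 1) = psDegree w := by
      rw [psDegree, Finsupp.weight_apply, Finsupp.sum]
      symm
      refine Finset.sum_of_injOn (fun k : ℕ+ => k.natPred) ?_ ?_ ?_ ?_
      · exact PNat.natPred_injective.injOn
      · intro k hk
        have := Finsupp.le_weight (fun k : ℕ+ => (k : ℕ)) (s := k) k.pos.ne' w
        have h2 : (w k) * (k : ℕ) ≤ psDegree w := by
          rw [psDegree, Finsupp.weight_apply]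
          exact Finset.single_le_sum (f := fun k : ℕ+ => w k • (k : ℕ)) (fun _ _ => Nat.zero_le _) hk
        have h3 : 1 ≤ w k := Nat.one_le_iff_ne_zero.mpr (Finsupp.mem_support_iff.mp hk)
        have h4 : (k : ℕ) ≤ w k * k := Nat.le_mul_of_pos_left _ h3
        have h5 : k.natPred + 1 = k := PNat.natPred_add_one k
        rw [Finset.mem_coe, Finset.mem_range]
        change k.natPred < n + 1
        rw [hw] at h2
        omega
      · intro i _ hi
        have : w i.succPNat = 0 := by
          by_contra h
          exact hi ⟨i.succPNat, Finsupp.mem_support_iff.mpr h, Nat.natPred_succPNat i⟩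
        simp [this]
      · intro k _
        simp
    simp only [this, hw]
    push_cast
    rfl
  · simp

end CompleteHomog

/-! ### Sequences satisfying Newton's identities, and products of their generating functions -/

section Newton

variable {R : Type*} [CommRing R] [Algebra ℂ R]

/-- `z` satisfies the Newton identities with power sums `a`. -/
def IsNewtonSeq (a : ℕ+ → R) (z : ℕ → R) : Prop :=
  z 0 = 1 ∧ ∀ n : ℕ, ((n : ℂ) + 1) • z (n + 1) = ∑ p ∈ antidiagonal n, a p.1.succPNat * z p.2

theorem isNewtonSeq_aeval (a : ℕ+ → R) :
    IsNewtonSeq a fun n => MvPolynomial.aeval a (completeHomog n) := by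
  refine ⟨by simp [completeHomog_zero], fun n => ?_⟩
  have := congrArg (MvPolynomial.aeval a) (completeHomog_newton n)
  simpa using this

/-- The recursion determines each term from the earlier ones because n + 1 is invertible in ℂ. -/
theorem IsNewtonSeq.eq {a : ℕ+ → R} {z z' : ℕ → R} (h : IsNewtonSeq a z) (h' : IsNewtonSeq a z')
    (n : ℕ) : z n = z' n := by
  induction n using Nat.strong_induction_on with
  | _ n ih =>
    rcases n with _ | n
    · rw [h.1, h'.1]
    · have h0 : ((n : ℂ) + 1) ≠ 0 := by exact_mod_cast n.succ_ne_zero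
      have : ((n : ℂ) + 1) • z (n + 1) = ((n : ℂ) + 1) • z' (n + 1) := by
        rw [h.2, h'.2]
        refine Finset.sum_congr rfl fun p hp => ?_
        rw [ih p.2 (by have := Finset.HasAntidiagonal.mem_antidiagonal.mp hp; omega)]
      have h2 := congrArg (((n : ℂ) + 1)⁻¹ • ·) this
      simpa [smul_smul, h0] using h2

/-- Newton's identities say Z' = A·Z for the generating functions. In this form it is clear that
products of the Z correspond to sums of the power sums. -/
theorem isNewtonSeq_iff (a : ℕ+ → R) (z : ℕ → R) :
    IsNewtonSeq a z ↔ z 0 = 1 ∧ PowerSeries.derivative R (PowerSeries.mk z) =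
      PowerSeries.mk (fun n => a n.succPNat) * PowerSeries.mk z := by
  refine and_congr_right fun _ => ?_
  rw [PowerSeries.ext_iff]
  refine forall_congr' fun n => ?_
  rw [PowerSeries.coeff_mul]
  simp only [PowerSeries.coeff_mk, PowerSeries.coeff_derivative]
  rw [Algebra.smul_def, mul_comm]
  simp

theorem IsNewtonSeq.mul {a b : ℕ+ → R} {z y x : ℕ → R} (hz : IsNewtonSeq a z)
    (hy : IsNewtonSeq b y)
    (hx : PowerSeries.mk x = PowerSeries.mk z * PowerSeries.mk y) : IsNewtonSeq (a + b) x := by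
  rw [isNewtonSeq_iff] at *
  refine ⟨?_, ?_⟩
  · have := congrArg (PowerSeries.coeff 0) hx
    rw [PowerSeries.coeff_mul] at this
    simpa [hz.1, hy.1] using this
  · have : PowerSeries.mk (fun n => (a + b) n.succPNat) =
      PowerSeries.mk (fun n => a n.succPNat) + PowerSeries.mk (fun n => b n.succPNat) := by
      ext; simp
    rw [hx, Derivation.leibniz, hz.2, hy.2, this]
    simp only [smul_eq_mul]
    ring

theorem isNewtonSeq_prod {ι : Type*} (s : Finset ι) (a : ι → ℕ+ → R) (z : ι → ℕ → R)
    (h : ∀ i ∈ s, IsNewtonSeq (a i) (z i)) :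
    IsNewtonSeq (∑ i ∈ s, a i) fun n =>
      PowerSeries.coeff n (∏ i ∈ s, PowerSeries.mk (z i)) := by
  classical
  induction s using Finset.induction_on with
  | empty =>
    refine ⟨by simp, fun n => by simp [PowerSeries.coeff_one]⟩
  | insert i s hi ih =>
    rw [Finset.sum_insert hi]
    refine (h i (Finset.mem_insert_self _ _)).mul
      (ih fun j hj => h j (Finset.mem_insert_of_mem hj)) ?_
    rw [Finset.prod_insert hi]
    ext n
    simp only [PowerSeries.coeff_mk, PowerSeries.coeff_mul]

/-- A product of generating functions of complete homogeneous functions. -/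
theorem aeval_completeHomog_sum {ι : Type*} (s : Finset ι) (a : ι → ℕ+ → R) (z : ι → ℕ → R)
    (h : ∀ i ∈ s, IsNewtonSeq (a i) (z i)) (n : ℕ) :
    MvPolynomial.aeval (∑ i ∈ s, a i) (completeHomog n) =
      PowerSeries.coeff n (∏ i ∈ s, PowerSeries.mk (z i)) :=
  (isNewtonSeq_aeval _).eq (isNewtonSeq_prod s a z h) n

theorem isNewtonSeq_mul_pow (p : ℕ+ → R) (z : ℕ → R) (h : IsNewtonSeq p z) (y : R) :
    IsNewtonSeq (fun k => p k * y ^ (k : ℕ)) fun n => z n * y ^ n := by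
  refine ⟨by simp [h.1], fun n => ?_⟩
  rw [← smul_mul_assoc, h.2, Finset.sum_mul]
  refine Finset.sum_congr rfl fun p hp => ?_
  simp only [← Finset.HasAntidiagonal.mem_antidiagonal.mp hp, Nat.succPNat_coe, Nat.succ_eq_add_one]
  ring

theorem isNewtonSeq_one : IsNewtonSeq (fun _ => (1 : R)) fun _ => 1 := by
  refine ⟨rfl, fun n => ?_⟩
  simp [Algebra.smul_def]

end Newton

/-! ### The characteristic of `Lie_n^{(2)}` -/

section LieTwo

open Equiv

/-- The hypothesis says that every orbit has exactly d elements, so all cycles have length d. The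
case d = 1 is separate because fixed points are absent from `cycleType`. -/
theorem cycleMonomial_of_forall_pow_apply_eq_iff {ι : Type*} [Fintype ι] [DecidableEq ι]
    (σ : Perm ι) (d : ℕ+) (h : ∀ (x : ι) (k : ℕ), (σ ^ k) x = x ↔ (d : ℕ) ∣ k) :
    cycleMonomial σ = MvPolynomial.X d ^ (Fintype.card ι / d) := by
  rw [cycleMonomial_eq]
  rcases eq_or_ne d 1 with rfl | hd
  · have : σ = 1 := by
      ext x
      have := (h x 1).mpr (by simp)
      simpa using this
    subst this
    simp
  · have hd2 : 2 ≤ (d : ℕ) := by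
      have : (d : ℕ) ≠ 1 := fun h => hd (PNat.coe_injective h)
      have := d.pos
      omega
    have hmem : ∀ c ∈ σ.cycleType, c = d := by
      intro c hc
      obtain ⟨f, τ, rfl, hdis, hcyc, rfl⟩ := Perm.mem_cycleType_iff.mp hc
      obtain ⟨x, hx⟩ := hcyc.nonempty_support
      have hx' := Perm.mem_support.mp hx
      have key : ∀ k : ℕ, f ^ k = 1 ↔ (d : ℕ) ∣ k := by
        intro k
        rw [← h x k, hdis.commute.mul_pow, hcyc.pow_eq_one_iff' hx', Perm.mul_apply]
        have hτ : (τ ^ k) x = x := Perm.pow_apply_eq_self_of_apply_eq_self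
          ((hdis x).resolve_left hx') k
        rw [hτ]
      rw [← hcyc.orderOf]
      exact Nat.dvd_antisymm (orderOf_dvd_of_pow_eq_one ((key _).mpr dvd_rfl))
        ((key _).mp (pow_orderOf_eq_one f))
    have hrep := Multiset.eq_replicate_card.mpr hmem
    have hsum : σ.cycleType.sum = Fintype.card ι := by
      rw [Perm.sum_cycleType, ← Finset.card_univ]
      congr 1
      ext x
      simp only [Perm.mem_support, Finset.mem_univ, iff_true]
      intro hx
      have := Nat.le_of_dvd one_pos ((h x 1).mp (by simpa using hx))
      omega
    have hcard : Multiset.card σ.cycleType = Fintype.card ι / d := by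
      rw [← hsum, hrep, Multiset.sum_replicate, smul_eq_mul, Multiset.card_replicate,
        Nat.mul_div_cancel _ d.pos]
    rw [hsum, Nat.sub_self, pow_zero, mul_one, hrep, Multiset.map_replicate,
      Multiset.prod_replicate, hcard]
    simp

theorem cyclicToPerm_ofAdd (n : ℕ) [NeZero n] (j : ZMod n) :
    cyclicToPerm n (Multiplicative.ofAdd j) = finRotate n ^ j.val := by
  obtain ⟨k, rfl⟩ : ∃ k : ℕ, (k : ZMod n) = j := ⟨j.val, by simp⟩
  have h : cyclicToPerm n (Multiplicative.ofAdd (k : ZMod n)) = finRotate n ^ k := by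
    have := ZMod.lift_coe n ⟨zmultiplesHom (Additive (Perm (Fin n)))
      (Additive.ofMul (finRotate n)), by simp [← ofMul_pow, finRotate_pow_self]⟩ (k : ℤ)
    simp only [Int.cast_natCast] at this
    refine (congrArg Additive.toMul this).trans ?_
    simp [← ofMul_pow]
  rw [h, ZMod.val_natCast]
  conv_lhs => rw [← Nat.mod_add_div k n, pow_add, pow_mul, finRotate_pow_self, one_pow, mul_one]

theorem finRotate_pow_apply_eq_self_iff (n : ℕ) (x : Fin n) (k : ℕ) :
    (finRotate n ^ k) x = x ↔ n ∣ k := by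
  rcases n with _ | n
  · exact x.elim0
  · have h : ∀ k : ℕ, (finRotate (n + 1) ^ k) x = x + Fin.ofNat (n + 1) k := by
      intro k
      induction k with
      | zero => simp
      | succ k ih =>
        rw [pow_succ', Perm.mul_apply, ih, finRotate_apply, add_assoc]
        congr 1
        ext
        simp [Fin.val_add, Fin.ofNat]
    rw [h, add_eq_left, Fin.ext_iff]
    simp [Fin.ofNat, Nat.dvd_iff_mod_eq_zero]

theorem cycleMonomial_cyclicToPerm (n : ℕ) [NeZero n] (j : ZMod n) (d : ℕ+)
    (hd : addOrderOf j = d) :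
    cycleMonomial (cyclicToPerm n (Multiplicative.ofAdd j)) = MvPolynomial.X d ^ (n / d) := by
  rw [cycleMonomial_of_forall_pow_apply_eq_iff _ d, Fintype.card_fin]
  intro x k
  rw [cyclicToPerm_ofAdd, ← pow_mul, finRotate_pow_apply_eq_self_iff, ← hd,
    addOrderOf_dvd_iff_nsmul_eq_zero, mul_comm, ← ZMod.natCast_eq_zero_iff]
  simp

/-- `∑ χ(j)` over the elements of order `d` of `C_n`, for the character `χ` of `Lie_n^{(2)}`. -/
def orderSum (n : ℕ) [NeZero n] (d : ℕ) : ℂ :=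
  ∑ j : ZMod n with addOrderOf j = d, lieTwoCharacter n (Multiplicative.ofAdd j)

/-- The function `m ↦ m` on powers of two, extended by zero. -/
def powTwoWeight (m : ℕ) : ℂ := open Classical in if ∃ a : ℕ, m = 2 ^ a then m else 0

theorem sum_filter_nsmul_eq_zero (n : ℕ) [NeZero n] {m : ℕ} (hm : m ≠ 0) (F : ZMod n → ℂ) :
    ∑ j : ZMod n with m • j = 0, F j =
      ∑ d ∈ m.divisors, ∑ j : ZMod n with addOrderOf j = d, F j := by
  rw [← Finset.sum_fiberwise_of_maps_to (s := Finset.univ.filter fun j : ZMod n => m • j = 0)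
    (t := m.divisors) (g := addOrderOf)]
  · refine Finset.sum_congr rfl fun d hd => Finset.sum_congr ?_ fun _ _ => rfl
    ext j
    simp only [Finset.mem_filter, Finset.mem_univ, true_and, and_iff_right_iff_imp]
    rintro rfl
    exact addOrderOf_dvd_iff_nsmul_eq_zero.mp (Nat.dvd_of_mem_divisors hd)
  · intro j hj
    rw [Nat.mem_divisors]
    exact ⟨addOrderOf_dvd_iff_nsmul_eq_zero.mpr (Finset.mem_filter.mp hj).2, hm⟩

theorem lieTwoCharacter_apply (n : ℕ) [NeZero n] (j : ZMod n) :
    lieTwoCharacter n (Multiplicative.ofAdd j) =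
      ZMod.stdAddChar (((2 ^ padicValNat 2 n : ℕ) : ZMod n) * j) := rfl

/-- The j with m·j = 0 form the subgroup of order m. As m divides n, the character is trivial there
exactly when m divides 2^(k_n), that is, when m is a power of 2. The sum is m in that case and 0
otherwise. -/
theorem sum_divisors_orderSum (n : ℕ) [NeZero n] {m : ℕ} (hmn : m ∣ n) :
    ∑ d ∈ m.divisors, orderSum n d = powTwoWeight m := by
  have hn : n ≠ 0 := NeZero.ne n
  have hm : m ≠ 0 := fun h => hn (Nat.eq_zero_of_zero_dvd (h ▸ hmn))
  simp only [orderSum]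
  rw [← sum_filter_nsmul_eq_zero n hm]
  have hdvd : ∀ a : ℕ, m = 2 ^ a → m ∣ 2 ^ padicValNat 2 n := by
    rintro a rfl
    exact pow_dvd_pow 2 ((padicValNat_dvd_iff_le hn).mp hmn)
  by_cases h : ∃ a : ℕ, m = 2 ^ a
  · rw [powTwoWeight, if_pos h]
    obtain ⟨a, ha⟩ := h
    obtain ⟨b, hb⟩ := hdvd a ha
    have h1 : ∀ j ∈ (Finset.univ.filter fun j : ZMod n => m • j = 0),
        lieTwoCharacter n (Multiplicative.ofAdd j) = 1 := by
      intro j hj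
      have hj' := (Finset.mem_filter.mp hj).2
      rw [lieTwoCharacter_apply, hb, mul_comm m b, Nat.cast_mul, mul_assoc, ← nsmul_eq_mul m j, hj',
        mul_zero]
      simp
    rw [Finset.sum_congr rfl h1, sum_filter_nsmul_eq_zero n hm]
    have h2 : ∀ d ∈ m.divisors, ∑ j : ZMod n with addOrderOf j = d, (1 : ℂ) = (d.totient : ℂ) := by
      intro d hd
      rw [Finset.sum_const, nsmul_eq_mul, mul_one, IsAddCyclic.card_addOrderOf_eq_totient]
      rw [ZMod.card]
      exact (Nat.dvd_of_mem_divisors hd).trans hmn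
    rw [Finset.sum_congr rfl h2, ← Nat.cast_sum, Nat.sum_totient]
  · rw [powTwoWeight, if_neg h]
    -- The element c = n/m lies in the subgroup and has nontrivial character value. Translation by c
    -- multiplies the sum T by that value and also leaves T unchanged, so T = 0.
    obtain ⟨c, hc⟩ := hmn
    have hc0 : m • (c : ZMod n) = 0 := by
      rw [nsmul_eq_mul, ← Nat.cast_mul, ← hc]
      simp
    have hne : lieTwoCharacter n (Multiplicative.ofAdd (c : ZMod n)) ≠ 1 := by
      rw [lieTwoCharacter_apply, ← Nat.cast_mul]
      intro h1
      have h2 : (((2 ^ padicValNat 2 n * c : ℕ) : ZMod n)) = 0 :=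
        ZMod.injective_stdAddChar (h1.trans (by simp))
      rw [ZMod.natCast_eq_zero_iff] at h2
      have h3 : m ∣ 2 ^ padicValNat 2 n := by
        have hc' : 0 < c := Nat.pos_of_ne_zero fun h => hn (by rw [hc, h, mul_zero])
        refine Nat.dvd_of_mul_dvd_mul_right hc' ?_
        rw [← hc]; exact h2
      obtain ⟨a, -, ha⟩ := (Nat.dvd_prime_pow Nat.prime_two).mp h3
      exact h ⟨a, ha⟩
    set T := ∑ j : ZMod n with m • j = 0, lieTwoCharacter n (Multiplicative.ofAdd j) with hT
    have hshift : lieTwoCharacter n (Multiplicative.ofAdd (c : ZMod n)) * T = T := by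
      rw [hT, Finset.mul_sum]
      refine Finset.sum_equiv (Equiv.addLeft (c : ZMod n)) ?_ ?_
      · intro j
        simp only [Finset.mem_filter, Finset.mem_univ, true_and, Equiv.coe_addLeft, smul_add, hc0,
          zero_add]
      · intro j _
        rw [← map_mul]
        rfl
    have : (lieTwoCharacter n (Multiplicative.ofAdd (c : ZMod n)) - 1) * T = 0 := by
      rw [sub_mul, hshift, one_mul, sub_self]
    exact (mul_eq_zero.mp this).resolve_left (sub_ne_zero.mpr hne)

/-- The Dirichlet inverse transform of `powTwoWeight`. -/
def lieCoeff (d : ℕ+) : ℂ := orderSum d d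

/-- The divisor sums of `orderSum n` do not involve n, and divisor sums determine the summands by
strong induction on d. -/
theorem orderSum_eq (n : ℕ) [NeZero n] (d : ℕ+) (h : (d : ℕ) ∣ n) :
    orderSum n d = lieCoeff d := by
  induction d using PNat.strongInductionOn generalizing n with
  | _ d ih =>
    have h1 := sum_divisors_orderSum n h
    have h2 := sum_divisors_orderSum (d : ℕ) (dvd_refl (d : ℕ))
    rw [← Nat.insert_self_properDivisors d.pos.ne',
      Finset.sum_insert Nat.self_notMem_properDivisors] at h1 h2
    have h3 : ∑ i ∈ (d : ℕ).properDivisors, orderSum n i =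
        ∑ i ∈ (d : ℕ).properDivisors, orderSum d i := by
      refine Finset.sum_congr rfl fun i hi => ?_
      rw [Nat.mem_properDivisors] at hi
      have hi0 : 0 < i := Nat.pos_of_dvd_of_pos hi.1 d.pos
      obtain ⟨i, rfl⟩ : ∃ j : ℕ+, (j : ℕ) = i := ⟨⟨i, hi0⟩, rfl⟩
      rw [ih i hi.2 n (hi.1.trans h), ih i hi.2 d hi.1]
    rw [h3] at h1
    exact add_right_cancel (h1.trans h2.symm)

theorem sum_divisors_lieCoeff (m : ℕ+) :
    ∑ d ∈ (m : ℕ).divisors, lieCoeff d.toPNat' = powTwoWeight m := by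
  rw [← sum_divisors_orderSum (m : ℕ) dvd_rfl]
  refine Finset.sum_congr rfl fun d hd => ?_
  have hd0 := Nat.pos_of_mem_divisors hd
  obtain ⟨d, rfl⟩ : ∃ j : ℕ+, (j : ℕ) = d := ⟨⟨d, hd0⟩, rfl⟩
  rw [orderSum_eq _ _ (Nat.dvd_of_mem_divisors hd), PNat.coe_toPNat']

theorem frobeniusChar_lieTwoRep (n : ℕ) [NeZero n] :
    frobeniusChar (lieTwoRep n) = (n : ℂ)⁻¹ • ∑ j : ZMod n,
      lieTwoCharacter n (Multiplicative.ofAdd j) •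
        cycleMonomial (cyclicToPerm n (Multiplicative.ofAdd j)) := by
  rw [lieTwoRep, frobeniusChar_ind]
  simp_rw [character_linearCharRep]
  rw [Fintype.card_multiplicative, ZMod.card]
  congr 1
  exact Fintype.sum_equiv Multiplicative.toAdd _ _ fun _ => rfl

/-- The factor n clears the denominator 1/n of the induced characteristic; it is what the Euler
derivation supplies in degree n. -/
theorem coeff_frobeniusChar_lieTwoRep (n : ℕ) [NeZero n] (w : ℕ+ →₀ ℕ) :
    (n : ℂ) * MvPolynomial.coeff w (frobeniusChar (lieTwoRep n)) =
      ∑ j : ZMod n, open Classical in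
        if w = Finsupp.single (addOrderOf j).toPNat' (n / addOrderOf j) then
          lieTwoCharacter n (Multiplicative.ofAdd j) else 0 := by
  have hn : (n : ℂ) ≠ 0 := by exact_mod_cast NeZero.ne n
  rw [frobeniusChar_lieTwoRep, MvPolynomial.coeff_smul, MvPolynomial.coeff_sum, smul_eq_mul,
    mul_inv_cancel_left₀ hn]
  refine Finset.sum_congr rfl fun j _ => ?_
  have hpos : 0 < addOrderOf j := addOrderOf_pos j
  have h : addOrderOf j = ((addOrderOf j).toPNat' : ℕ) := by
    rw [Nat.toPNat'_coe, if_pos hpos]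
  rw [cycleMonomial_cyclicToPerm n j _ h, MvPolynomial.coeff_smul, MvPolynomial.coeff_X_pow,
    ← h, smul_eq_mul, mul_ite, mul_one, mul_zero]
  simp only [eq_comm]

end LieTwo

/-! ### The plethysm `h_m[Lie^{(2)}]` -/

section Filtration

/-- The Euler derivation, multiplying a monomial by its degree. -/
def eulerDeriv : Derivation ℂ SymmSeries SymmSeries :=
  Derivation.mk'
    { toFun := fun g m => (psDegree m : ℂ) * MvPowerSeries.coeff m g
      map_add' := fun f g => by
        funext m
        exact (congrArg _ (map_add _ _ _)).trans (mul_add _ _ _)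
      map_smul' := fun c g => by
        funext m
        change (psDegree m : ℂ) * MvPowerSeries.coeff m (c • g) =
          c * ((psDegree m : ℂ) * MvPowerSeries.coeff m g)
        rw [MvPowerSeries.coeff_smul]
        ring }
    fun f g => by
      classical
      ext m
      change (psDegree m : ℂ) * MvPowerSeries.coeff m (f * g) = _
      rw [map_add, smul_eq_mul, smul_eq_mul, mul_comm g, MvPowerSeries.coeff_mul,
        MvPowerSeries.coeff_mul, MvPowerSeries.coeff_mul, Finset.mul_sum,
        ← Finset.sum_add_distrib]
      refine Finset.sum_congr rfl fun p hp => ?_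
      rw [← Finset.HasAntidiagonal.mem_antidiagonal.mp hp, map_add]
      change _ = MvPowerSeries.coeff p.1 f * ((psDegree p.2 : ℂ) * MvPowerSeries.coeff p.2 g) +
        (psDegree p.1 : ℂ) * MvPowerSeries.coeff p.1 f * MvPowerSeries.coeff p.2 g
      push_cast
      ring

theorem coeff_eulerDeriv (g : SymmSeries) (m : ℕ+ →₀ ℕ) :
    MvPowerSeries.coeff m (eulerDeriv g) = (psDegree m : ℂ) * MvPowerSeries.coeff m g := rfl

/-- The ideal of series all of whose terms have degree at least `k`. -/
def degreeIdeal (k : ℕ) : Ideal SymmSeries where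
  carrier := {g | ∀ m, psDegree m < k → MvPowerSeries.coeff m g = 0}
  add_mem' hf hg m hm := by rw [map_add, hf m hm, hg m hm, add_zero]
  zero_mem' m _ := map_zero _
  smul_mem' f g hg m hm := by
    classical
    rw [smul_eq_mul, MvPowerSeries.coeff_mul]
    refine Finset.sum_eq_zero fun p hp => ?_
    rw [hg p.2, mul_zero]
    have := congrArg psDegree (Finset.HasAntidiagonal.mem_antidiagonal.mp hp)
    rw [map_add] at this
    omega

theorem mul_mem_degreeIdeal {i j : ℕ} {f g : SymmSeries} (hf : f ∈ degreeIdeal i)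
    (hg : g ∈ degreeIdeal j) : f * g ∈ degreeIdeal (i + j) := by
  classical
  intro m hm
  rw [MvPowerSeries.coeff_mul]
  refine Finset.sum_eq_zero fun p hp => ?_
  have := congrArg psDegree (Finset.HasAntidiagonal.mem_antidiagonal.mp hp)
  rw [map_add] at this
  rcases Nat.lt_or_ge (psDegree p.1) i with h | h
  · rw [hf p.1 h, zero_mul]
  · rw [hg p.2 (by omega), mul_zero]

theorem degreeIdeal_mono {i j : ℕ} (h : i ≤ j) {g : SymmSeries} (hg : g ∈ degreeIdeal j) :
    g ∈ degreeIdeal i := fun m hm => hg m (hm.trans_le h)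

theorem eulerDeriv_mem {k : ℕ} {g : SymmSeries} (hg : g ∈ degreeIdeal k) :
    eulerDeriv g ∈ degreeIdeal k := fun m hm => by rw [coeff_eulerDeriv, hg m hm, mul_zero]

/-- The Euler derivation can be inverted in every degree except 0, so the constant term needs a
hypothesis of its own. -/
theorem mem_degreeIdeal_of_eulerDeriv {k : ℕ} {g : SymmSeries} (hg : eulerDeriv g ∈ degreeIdeal k)
    (h1 : g ∈ degreeIdeal 1) : g ∈ degreeIdeal k := fun m hm => by
  rcases Nat.eq_zero_or_pos (psDegree m) with h0 | h0
  · exact h1 m (by omega)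
  · have := hg m hm
    rw [coeff_eulerDeriv] at this
    exact (mul_eq_zero.mp this).resolve_left (by exact_mod_cast h0.ne')

theorem psDegree_eq_zero {m : ℕ+ →₀ ℕ} (h : psDegree m = 0) : m = 0 := by
  ext k
  by_contra hk
  have := Finsupp.le_weight (fun k : ℕ+ => (k : ℕ)) (s := k) k.pos.ne' m
  exact hk (Nat.le_zero.mp (h ▸ this))

theorem mem_degreeIdeal_one {g : SymmSeries} :
    g ∈ degreeIdeal 1 ↔ MvPowerSeries.constantCoeff g = 0 := by
  refine ⟨fun h => h 0 (by simp), fun h m hm => ?_⟩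
  rw [psDegree_eq_zero (Nat.lt_one_iff.mp hm)]
  exact h

/-- Two solutions of `D X = S X` with the same constant term agree. -/
theorem sub_mem_degreeIdeal_of_eulerDeriv {N : ℕ} {S X Y : SymmSeries} (hS : S ∈ degreeIdeal 1)
    (hX : eulerDeriv X - S * X ∈ degreeIdeal (N + 1))
    (hY : eulerDeriv Y - S * Y ∈ degreeIdeal (N + 1)) (h1 : X - Y ∈ degreeIdeal 1) :
    X - Y ∈ degreeIdeal (N + 1) := by
  have hZ : eulerDeriv (X - Y) - S * (X - Y) ∈ degreeIdeal (N + 1) := by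
    have := Ideal.sub_mem _ hX hY
    rw [map_sub]
    convert this using 1
    ring
  -- Since S has no constant term, S·(X - Y) vanishes to one degree more than X - Y. The equation
  -- D(X - Y) = S·(X - Y) then passes this gain on to X - Y.
  suffices ∀ k ≤ N, X - Y ∈ degreeIdeal (k + 1) from this N le_rfl
  intro k
  induction k with
  | zero => exact fun _ => h1
  | succ k ih =>
    intro hk
    refine mem_degreeIdeal_of_eulerDeriv ?_ h1
    have h2 : S * (X - Y) ∈ degreeIdeal (k + 1 + 1) := by
      have := mul_mem_degreeIdeal hS (ih (by omega))
      rwa [add_comm 1] at this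
    have := Ideal.add_mem _ (degreeIdeal_mono (by omega) hZ) h2
    simpa using this

end Filtration

/-! ### The substitutions p_i ↦ p_{ki}, their coefficients and their effect on degrees -/

section Adams

/-- The map `p_i ↦ p_{ki}` on indices. -/
def mulEmb (k : ℕ+) : ℕ+ ↪ ℕ+ := ⟨fun i => k * i, fun _ _ h => mul_left_cancel h⟩

theorem psDegree_embDomain (k : ℕ+) (m : ℕ+ →₀ ℕ) :
    psDegree (Finsupp.embDomain (mulEmb k) m) = k * psDegree m := by
  rw [psDegree, Finsupp.weight_apply, Finsupp.sum_embDomain, Finsupp.weight_apply, Finsupp.mul_sum]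
  refine Finset.sum_congr rfl fun i _ => ?_
  change m i * ((k * i : ℕ+) : ℕ) = k * (m i * i)
  rw [PNat.mul_coe]
  ring

theorem coeff_adams (k : ℕ+) (g : SymmSeries) (m : ℕ+ →₀ ℕ) :
    MvPowerSeries.coeff (Finsupp.embDomain (mulEmb k) m) (adams k g) = MvPowerSeries.coeff m g :=
  MvPowerSeries.coeff_embDomain_rename (mulEmb k) g m

theorem coeff_adams_eq_zero (k : ℕ+) (g : SymmSeries) (m : ℕ+ →₀ ℕ)
    (h : ∀ v, Finsupp.embDomain (mulEmb k) v ≠ m) : MvPowerSeries.coeff m (adams k g) = 0 := by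
  refine MvPowerSeries.coeff_rename_eq_zero _ g ?_
  rintro ⟨v, hv⟩
  apply h v
  rw [Finsupp.embDomain_eq_mapDomain]
  exact hv

theorem adams_mem {i : ℕ} (k : ℕ+) {g : SymmSeries} (hg : g ∈ degreeIdeal i) :
    adams k g ∈ degreeIdeal (k * i) := by
  intro m hm
  by_cases h : ∃ v, Finsupp.embDomain (mulEmb k) v = m
  · obtain ⟨v, rfl⟩ := h
    rw [psDegree_embDomain] at hm
    rw [coeff_adams]
    exact hg v (lt_of_mul_lt_mul_left hm (Nat.zero_le _))
  · exact coeff_adams_eq_zero k g m fun v hv => h ⟨v, hv⟩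

theorem eulerDeriv_adams (k : ℕ+) (g : SymmSeries) :
    eulerDeriv (adams k g) = (k : ℂ) • adams k (eulerDeriv g) := by
  ext m
  rw [coeff_eulerDeriv, MvPowerSeries.coeff_smul]
  by_cases h : ∃ v, Finsupp.embDomain (mulEmb k) v = m
  · obtain ⟨v, rfl⟩ := h
    rw [psDegree_embDomain, coeff_adams, coeff_adams, coeff_eulerDeriv]
    push_cast
    ring
  · have h' : ∀ v, Finsupp.embDomain (mulEmb k) v ≠ m := fun v hv => h ⟨v, hv⟩
    rw [coeff_adams_eq_zero k g m h', coeff_adams_eq_zero k _ m h', mul_zero, mul_zero]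

end Adams

/-! ### The differential equation for the generating series of the plethysms h_m[g] -/

section ChainRule

/-- The chain rule below is a sum over a finite set of variables, and h_n involves only p_1, …, p_n.
-/
theorem completeHomog_mem_supported (n : ℕ) :
    completeHomog n ∈ MvPolynomial.supported ℂ
      (((Finset.range n).image Nat.succPNat : Finset ℕ+) : Set ℕ+) := by
  rw [completeHomog_eq_charSum, charSum]
  refine Subalgebra.smul_mem _ (Subalgebra.sum_mem _ fun σ _ => Subalgebra.smul_mem _ ?_ _) _
  rw [cycleMonomial, powerSumPart]
  refine Subalgebra.multiset_prod_mem _ fun x hx => ?_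
  obtain ⟨k, hk, rfl⟩ := Multiset.mem_map.mp hx
  have h0 := σ.partition.parts_pos hk
  have hkn : k ≤ n := by
    have := Multiset.le_sum_of_mem hk
    rwa [σ.partition.parts_sum, Fintype.card_fin] at this
  refine Algebra.subset_adjoin ⟨k.toPNat', ?_, rfl⟩
  rw [Finset.mem_coe, Finset.mem_image]
  refine ⟨k - 1, Finset.mem_range.mpr (by omega), ?_⟩
  apply PNat.coe_injective
  rw [Nat.succPNat_coe, Nat.toPNat'_coe, if_pos h0]
  omega

theorem derivation_aeval {R : Type*} [CommRing R] [Algebra ℂ R] (D : Derivation ℂ R R)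
    (a : ℕ+ → R) (s : Finset ℕ+) {f : SymmFun} (hf : f ∈ MvPolynomial.supported ℂ (s : Set ℕ+)) :
    D (MvPolynomial.aeval a f) =
      ∑ k ∈ s, MvPolynomial.aeval a (MvPolynomial.pderiv k f) * D (a k) := by
  induction hf using Algebra.adjoin_induction with
  | mem x hx =>
    obtain ⟨j, hj, rfl⟩ := hx
    rw [MvPolynomial.aeval_X, Finset.sum_eq_single j]
    · simp
    · intro k _ hk
      rw [MvPolynomial.pderiv_X_of_ne hk.symm]
      simp
    · exact fun h => absurd hj h
  | algebraMap r => simp [MvPolynomial.algebraMap_eq]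
  | add x y _ _ hx hy =>
    simp only [map_add, hx, hy, add_mul, Finset.sum_add_distrib]
  | mul x y _ _ hx hy =>
    rw [map_mul, D.leibniz, hx, hy, smul_eq_mul, smul_eq_mul, Finset.mul_sum, Finset.mul_sum,
      ← Finset.sum_add_distrib]
    refine Finset.sum_congr rfl fun k _ => ?_
    rw [MvPolynomial.pderiv_mul]
    simp only [map_add, map_mul]
    ring

theorem plethysm_completeHomog_zero (g : SymmSeries) : plethysm (completeHomog 0) g = 1 := by
  simp [plethysm, completeHomog_zero]

/-- Chain rule: ∂h_{n+1}/∂p_k = h_{n+1-k}/k and D(p_k[g]) = k·p_k[D g], so the factors k cancel. -/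
theorem eulerDeriv_plethysm (n : ℕ) (g : SymmSeries) :
    eulerDeriv (plethysm (completeHomog (n + 1)) g) =
      ∑ p ∈ antidiagonal n, adams p.1.succPNat (eulerDeriv g) * plethysm (completeHomog p.2) g := by
  rw [plethysm, derivation_aeval _ _ _ (completeHomog_mem_supported (n + 1)),
    Finset.sum_image fun x _ y _ h => Nat.succPNat_injective h,
    Finset.Nat.sum_antidiagonal_eq_sum_range_succ_mk]
  refine Finset.sum_congr rfl fun i hi => ?_
  have hi' : n + 1 = (n - i) + (i.succPNat : ℕ) := by
    have := Finset.mem_range.mp hi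
    rw [Nat.succPNat_coe]
    omega
  have h0 : ((i.succPNat : ℕ) : ℂ) ≠ 0 := by exact_mod_cast i.succPNat.pos.ne'
  conv_lhs => rw [hi']
  rw [pderiv_completeHomog_add, eulerDeriv_adams, map_smul, smul_mul_smul_comm, inv_mul_cancel₀ h0,
    one_smul, mul_comm]
  rfl

theorem constantCoeff_plethysm {g : SymmSeries} (hg : g ∈ degreeIdeal 1) (n : ℕ) :
    MvPowerSeries.constantCoeff (plethysm (completeHomog (n + 1)) g) = 0 := by
  have h : ∀ k, MvPowerSeries.constantCoeff (adams k g) = 0 := fun k =>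
    mem_degreeIdeal_one.mp (degreeIdeal_mono (by have := k.pos; omega) (adams_mem k hg))
  rw [plethysm, MvPolynomial.map_aeval]
  simp only [h]
  rw [MvPolynomial.eval₂Hom_zero'_apply, MvPolynomial.constantCoeff_eq, coeff_completeHomog,
    if_neg (by simp), map_zero]

/-- This justifies the truncations: in degrees at most N only h_0[g], …, h_N[g] are visible. -/
theorem plethysm_mem {g : SymmSeries} (hg : g ∈ degreeIdeal 1) (n : ℕ) :
    plethysm (completeHomog n) g ∈ degreeIdeal n := by
  induction n using Nat.strong_induction_on with
  | _ n ih =>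
    rcases n with _ | n
    · intro m hm
      omega
    · refine mem_degreeIdeal_of_eulerDeriv ?_ (mem_degreeIdeal_one.mpr (constantCoeff_plethysm hg n))
      rw [eulerDeriv_plethysm]
      refine Ideal.sum_mem _ fun p hp => ?_
      have hp' := Finset.HasAntidiagonal.mem_antidiagonal.mp hp
      refine degreeIdeal_mono ?_ (mul_mem_degreeIdeal (adams_mem p.1.succPNat (eulerDeriv_mem hg))
        (ih p.2 (by omega)))
      rw [Nat.succPNat_coe]
      omega

/-- Truncations of `∑_m ε^m h_m[g]` and of `∑_k ε^k p_k[D g]`. -/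
def homogSum (ε : ℂ) (g : SymmSeries) (N : ℕ) : SymmSeries :=
  ∑ m ∈ Finset.range (N + 1), ε ^ m • plethysm (completeHomog m) g

def adamsSum (ε : ℂ) (g : SymmSeries) (N : ℕ) : SymmSeries :=
  ∑ i ∈ Finset.range N, ε ^ (i + 1) • adams i.succPNat (eulerDeriv g)

/-- D applied to the truncated sum gives the products p_k[D g]·h_j[g] with k + j ≤ N. The other
products of the two truncations have k + j > N and so start in degree N + 1 or higher. -/
theorem eulerDeriv_homogSum (ε : ℂ) {g : SymmSeries} (hg : g ∈ degreeIdeal 1) (N : ℕ) :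
    eulerDeriv (homogSum ε g N) - adamsSum ε g N * homogSum ε g N ∈ degreeIdeal (N + 1) := by
  have h1 : eulerDeriv (homogSum ε g N) = ∑ m ∈ Finset.range N, ∑ p ∈ antidiagonal m,
      (ε ^ (p.1 + 1) • adams p.1.succPNat (eulerDeriv g)) *
        (ε ^ p.2 • plethysm (completeHomog p.2) g) := by
    rw [homogSum, Finset.sum_range_succ', map_add, map_sum, plethysm_completeHomog_zero]
    simp only [Derivation.map_smul, eulerDeriv_plethysm, Derivation.map_one_eq_zero, smul_zero,
      add_zero, Finset.smul_sum]
    refine Finset.sum_congr rfl fun m _ => Finset.sum_congr rfl fun p hp => ?_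
    rw [smul_mul_smul_comm, ← Finset.HasAntidiagonal.mem_antidiagonal.mp hp]
    congr 1
    ring
  have h2 : ∀ i j : ℕ, (ε ^ (i + 1) • adams i.succPNat (eulerDeriv g)) *
        (ε ^ j • plethysm (completeHomog j) g) ∈ degreeIdeal (i + 1 + j) := by
    intro i j
    refine mul_mem_degreeIdeal ?_ ?_
    · refine Submodule.smul_of_tower_mem _ _ ?_
      have := adams_mem i.succPNat (eulerDeriv_mem hg)
      rwa [mul_one, Nat.succPNat_coe] at this
    · exact Submodule.smul_of_tower_mem _ _ (plethysm_mem hg j)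
  have h3 : ∑ m ∈ Finset.range N, ∑ p ∈ antidiagonal m,
      (ε ^ (p.1 + 1) • adams p.1.succPNat (eulerDeriv g)) *
        (ε ^ p.2 • plethysm (completeHomog p.2) g) =
      ∑ p ∈ (Finset.range N ×ˢ Finset.range (N + 1)).filter (fun p => p.1 + p.2 < N),
        (ε ^ (p.1 + 1) • adams p.1.succPNat (eulerDeriv g)) *
          (ε ^ p.2 • plethysm (completeHomog p.2) g) := by
    rw [← Finset.sum_fiberwise_of_maps_to (t := Finset.range N) (g := fun p : ℕ × ℕ => p.1 + p.2)]
    · refine Finset.sum_congr rfl fun m hm => Finset.sum_congr ?_ fun _ _ => rfl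
      ext p
      have := Finset.mem_range.mp hm
      simp only [Finset.HasAntidiagonal.mem_antidiagonal, Finset.mem_filter, Finset.mem_product,
        Finset.mem_range]
      omega
    · intro p hp
      exact Finset.mem_range.mpr (Finset.mem_filter.mp hp).2
  rw [h1, h3, adamsSum, homogSum, Finset.sum_mul_sum, ← Finset.sum_product',
    ← Finset.sum_filter_add_sum_filter_not (Finset.range N ×ˢ Finset.range (N + 1))
      (fun p => p.1 + p.2 < N) , sub_add_cancel_left]
  refine Ideal.neg_mem_iff _ |>.mpr (Ideal.sum_mem _ fun p hp => ?_)
  have := (Finset.mem_filter.mp hp).2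
  exact degreeIdeal_mono (by omega) (h2 p.1 p.2)

end ChainRule

/-! ### Evaluation of `∑_m (± 1)^m h_m[Lie^{(2)}]` -/

section Evaluation

theorem coeff_frobeniusChar_eq_zero {n : ℕ} {W : Type*} [AddCommGroup W] [Module ℂ W]
    (ρ : Representation ℂ (Equiv.Perm (Fin n)) W) {w : ℕ+ →₀ ℕ} (h : psDegree w ≠ n) :
    MvPolynomial.coeff w (frobeniusChar ρ) = 0 := by
  rw [frobeniusChar_eq_charSum, charSum, MvPolynomial.coeff_smul, MvPolynomial.coeff_sum,
    Finset.sum_eq_zero, smul_zero]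
  intro σ _
  rw [cycleMonomial, powerSumPart_eq_monomial, MvPolynomial.coeff_smul, MvPolynomial.coeff_monomial,
    if_neg, smul_zero]
  rintro rfl
  exact h ((weight_partExp σ.partition).trans (Fintype.card_fin n))

theorem coeff_lieTwoSeries (n : ℕ+) {w : ℕ+ →₀ ℕ} (h : psDegree w = n) :
    MvPowerSeries.coeff w lieTwoSeries =
      MvPolynomial.coeff w (frobeniusChar (lieTwoRep (n : ℕ))) := by
  change ∑ᶠ n : ℕ+, MvPolynomial.coeff w (frobeniusChar (lieTwoRep (n : ℕ))) = _
  refine finsum_eq_single _ n fun m hm => ?_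
  refine coeff_frobeniusChar_eq_zero _ fun h' => hm (PNat.coe_injective ?_)
  rw [← h', h]

theorem lieTwoSeries_mem : lieTwoSeries ∈ degreeIdeal 1 := by
  intro w hw
  change ∑ᶠ n : ℕ+, MvPolynomial.coeff w (frobeniusChar (lieTwoRep (n : ℕ))) = 0
  rw [finsum_congr fun n : ℕ+ => coeff_frobeniusChar_eq_zero (lieTwoRep (n : ℕ)) (w := w)
    (by have := n.pos; omega)]
  exact finsum_zero

theorem psDegree_single (d : ℕ+) (e : ℕ) : psDegree (Finsupp.single d e) = e * d := by
  rw [psDegree, Finsupp.weight_single, smul_eq_mul]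

/-- In closed form, D L = Σ_{d,e≥1} c_d p_d^e. The sum over the support has at most one nonzero
term, which occurs when w is a power of a single variable. -/
theorem coeff_eulerDeriv_lieTwoSeries (w : ℕ+ →₀ ℕ) :
    MvPowerSeries.coeff w (eulerDeriv lieTwoSeries) =
      open Classical in ∑ j ∈ w.support,
        if w = Finsupp.single j (w j) then lieCoeff j else 0 := by
  classical
  rcases Nat.eq_zero_or_pos (psDegree w) with h0 | h0
  · rw [psDegree_eq_zero h0, coeff_eulerDeriv]
    simp
  · obtain ⟨n, hn⟩ : ∃ n : ℕ+, psDegree w = n := ⟨⟨_, h0⟩, rfl⟩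
    rw [coeff_eulerDeriv, coeff_lieTwoSeries n hn, hn, coeff_frobeniusChar_lieTwoRep]
    by_cases hw : ∃ d, w = Finsupp.single d (w d)
    · obtain ⟨d, hd⟩ := hw
      have hd0 : w d ≠ 0 := fun h => by
        rw [h, Finsupp.single_zero] at hd
        rw [hd] at h0
        simp at h0
      generalize hew : w d = e at *
      subst hd
      rw [Finsupp.support_single _ hd0, Finset.sum_singleton, Finsupp.single_eq_same,
        if_pos rfl, ← orderSum_eq (n : ℕ) d, orderSum, Finset.sum_filter]
      · rw [psDegree_single] at hn
        refine Finset.sum_congr rfl fun j _ => ?_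
        have hpos : 0 < addOrderOf j := addOrderOf_pos j
        have hiff : Finsupp.single d e = Finsupp.single (addOrderOf j).toPNat' (n / addOrderOf j) ↔
            addOrderOf j = d := by
          constructor
          · intro h
            rw [Finsupp.single_eq_single_iff] at h
            rcases h with ⟨h, -⟩ | ⟨h, -⟩
            · rw [h, Nat.toPNat'_coe, if_pos hpos]
            · exact absurd h hd0
          · intro h
            rw [h, PNat.coe_toPNat', ← hn, Nat.mul_div_cancel _ d.pos]
        simp only [hiff]
      · rw [psDegree_single] at hn
        exact ⟨e, by rw [← hn, mul_comm]⟩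
    · rw [Finset.sum_eq_zero, Finset.sum_eq_zero]
      · intro d _
        exact if_neg fun h => hw ⟨d, h⟩
      · intro j _
        refine if_neg fun h => hw ⟨(addOrderOf j).toPNat', ?_⟩
        conv_rhs => rw [h, Finsupp.single_eq_same]
        exact h

/-- `∑_{k ∣ m} ε^k c_{m/k}`. -/
def twistedWeight (ε : ℂ) (m : ℕ+) : ℂ :=
  ∑ k ∈ (m : ℕ).divisors, ε ^ k * lieCoeff ((m : ℕ) / k).toPNat'

/-- The k-th substitution sends p_d^e to p_{kd}^e, so p_m^e collects c_{m/k} for every k dividing m.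
The bound on e·m ensures that the truncation contains all divisors of m. -/
theorem coeff_adamsSum_single (ε : ℂ) {N : ℕ} (m : ℕ+) {e : ℕ} (he : e ≠ 0) (hN : e * m ≤ N) :
    MvPowerSeries.coeff (Finsupp.single m e) (adamsSum ε lieTwoSeries N) = twistedWeight ε m := by
  classical
  have hmN : (m : ℕ) ≤ N := (Nat.le_mul_of_pos_left _ (Nat.pos_of_ne_zero he)).trans hN
  have key : ∀ i : ℕ, MvPowerSeries.coeff (Finsupp.single m e)
      (adams i.succPNat (eulerDeriv lieTwoSeries)) =
      if (i + 1) ∣ (m : ℕ) then lieCoeff ((m : ℕ) / (i + 1)).toPNat' else 0 := by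
    intro i
    split_ifs with h
    · obtain ⟨c, hc⟩ := h
      have hc0 : 0 < c := Nat.pos_of_ne_zero fun h => m.pos.ne' (by rw [hc, h, mul_zero])
      obtain ⟨c, rfl⟩ : ∃ j : ℕ+, (j : ℕ) = c := ⟨⟨c, hc0⟩, rfl⟩
      have hm : m = i.succPNat * c := PNat.coe_injective (by rw [hc, PNat.mul_coe]; rfl)
      have h1 : Finsupp.single m e = Finsupp.embDomain (mulEmb i.succPNat) (Finsupp.single c e) := by
        rw [Finsupp.embDomain_single, hm]
        rfl
      rw [h1, coeff_adams, coeff_eulerDeriv_lieTwoSeries, Finsupp.support_single _ he,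
        Finset.sum_singleton, Finsupp.single_eq_same, if_pos rfl, hc, Nat.mul_div_cancel_left _
        i.succ_pos, PNat.coe_toPNat']
    · refine coeff_adams_eq_zero _ _ _ fun v hv => h ?_
      have hsupp : m ∈ (Finsupp.embDomain (mulEmb i.succPNat) v).support := by
        rw [hv, Finsupp.support_single _ he, Finset.mem_singleton]
      rw [Finsupp.support_embDomain, Finset.mem_map] at hsupp
      obtain ⟨c, -, hc⟩ := hsupp
      exact ⟨c, by rw [← hc]; rfl⟩
  rw [adamsSum, map_sum, twistedWeight]
  simp_rw [MvPowerSeries.coeff_smul, key, mul_ite, mul_zero]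
  rw [← Finset.sum_filter]
  refine Finset.sum_bij (fun i _ => i + 1) ?_ ?_ ?_ ?_
  · intro i hi
    exact Nat.mem_divisors.mpr ⟨(Finset.mem_filter.mp hi).2, m.pos.ne'⟩
  · intro i _ j _ h
    exact Nat.succ_injective h
  · intro k hk
    have h1 := Nat.dvd_of_mem_divisors hk
    have h2 := Nat.pos_of_mem_divisors hk
    have h3 := Nat.le_of_dvd m.pos h1
    refine ⟨k - 1, ?_, by omega⟩
    rw [Finset.mem_filter, Finset.mem_range, Nat.sub_add_cancel h2]
    exact ⟨by omega, h1⟩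
  · intro i _
    rfl

theorem coeff_adamsSum_eq_zero (ε : ℂ) (N : ℕ) {w : ℕ+ →₀ ℕ}
    (hw : ∀ m e, e ≠ 0 → w ≠ Finsupp.single m e) :
    MvPowerSeries.coeff w (adamsSum ε lieTwoSeries N) = 0 := by
  classical
  rw [adamsSum, map_sum]
  refine Finset.sum_eq_zero fun i _ => ?_
  rw [MvPowerSeries.coeff_smul]
  by_cases h : ∃ v, Finsupp.embDomain (mulEmb i.succPNat) v = w
  · obtain ⟨v, rfl⟩ := h
    rw [coeff_adams, coeff_eulerDeriv_lieTwoSeries, Finset.sum_eq_zero, mul_zero]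
    intro j hj
    refine if_neg fun h => ?_
    refine hw (mulEmb i.succPNat j) (v j) (Finsupp.mem_support_iff.mp hj) ?_
    conv_lhs => rw [h, Finsupp.embDomain_single]
  · rw [coeff_adams_eq_zero _ _ _ fun v hv => h ⟨v, hv⟩, mul_zero]

theorem adamsSum_mem (ε : ℂ) (N : ℕ) : adamsSum ε lieTwoSeries N ∈ degreeIdeal 1 := by
  intro w hw
  rw [psDegree_eq_zero (Nat.lt_one_iff.mp hw)]
  refine coeff_adamsSum_eq_zero ε N fun m e he h => he ?_
  have := DFunLike.congr_fun h m
  rw [Finsupp.single_eq_same] at this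
  exact this.symm

theorem powTwoWeight_two_mul (m : ℕ) : powTwoWeight (2 * m) = 2 * powTwoWeight m := by
  have : (∃ a : ℕ, 2 * m = 2 ^ a) ∨ m = 0 ↔ (∃ a : ℕ, m = 2 ^ a) ∨ m = 0 := by
    refine or_congr_left' fun hm => ⟨?_, ?_⟩
    · rintro ⟨a, ha⟩
      rcases a with _ | a
      · omega
      · exact ⟨a, by rw [pow_succ] at ha; omega⟩
    · rintro ⟨a, rfl⟩
      exact ⟨a + 1, by ring⟩
  rcases eq_or_ne m 0 with rfl | hm
  · simp [powTwoWeight]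
  · simp only [hm, or_false] at this
    by_cases h : ∃ a : ℕ, m = 2 ^ a
    · rw [powTwoWeight, powTwoWeight, if_pos (this.mpr h), if_pos h, Nat.cast_mul, Nat.cast_two]
    · rw [powTwoWeight, powTwoWeight, if_neg fun h' => h (this.mp h'), if_neg h, mul_zero]

theorem twistedWeight_one (m : ℕ+) : twistedWeight 1 m = powTwoWeight m := by
  rw [← sum_divisors_lieCoeff, twistedWeight]
  simp only [one_pow, one_mul]
  exact Nat.sum_div_divisors (m : ℕ) fun d => lieCoeff d.toPNat'

/-- For m = 2c, adding the untwisted sum cancels odd k and doubles even k = 2k'. What remains is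
2·`powTwoWeight c` = `powTwoWeight m`, so the twisted sum is 0. For odd m all signs are -1, and 1 is
the only odd power of 2. -/
theorem twistedWeight_neg_one (m : ℕ+) : twistedWeight (-1) m = if m = 1 then -1 else 0 := by
  have hsum := twistedWeight_one m
  rw [twistedWeight] at hsum
  simp only [one_pow, one_mul] at hsum
  rcases Nat.even_or_odd (m : ℕ) with hm | hm
  · obtain ⟨c, hc⟩ := hm.two_dvd
    have hc0 : 0 < c := Nat.pos_of_ne_zero fun h => m.pos.ne' (by rw [hc, h, mul_zero])
    obtain ⟨c, rfl⟩ : ∃ j : ℕ+, (j : ℕ) = c := ⟨⟨c, hc0⟩, rfl⟩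
    have h1 : twistedWeight (-1) m + powTwoWeight m =
        ∑ k ∈ (m : ℕ).divisors, if Even k then 2 * lieCoeff ((m : ℕ) / k).toPNat' else 0 := by
      rw [twistedWeight, ← hsum, ← Finset.sum_add_distrib]
      refine Finset.sum_congr rfl fun k _ => ?_
      split_ifs with hk
      · rw [hk.neg_one_pow]; ring
      · rw [(Nat.not_even_iff_odd.mp hk).neg_one_pow]; ring
    have h2 : ∑ k ∈ (m : ℕ).divisors, (if Even k then 2 * lieCoeff ((m : ℕ) / k).toPNat' else 0) =
        2 * powTwoWeight c := by
      rw [← twistedWeight_one c, twistedWeight, ← Finset.sum_filter, Finset.mul_sum]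
      symm
      refine Finset.sum_bij (fun k _ => 2 * k) ?_ ?_ ?_ ?_
      · intro k hk
        rw [Finset.mem_filter, Nat.mem_divisors, hc]
        exact ⟨⟨mul_dvd_mul_left 2 (Nat.dvd_of_mem_divisors hk), by have := c.pos; omega⟩,
          even_two_mul k⟩
      · intro i _ j _ h
        exact Nat.eq_of_mul_eq_mul_left two_pos h
      · intro k hk
        rw [Finset.mem_filter, Nat.mem_divisors, hc] at hk
        obtain ⟨k, rfl⟩ := hk.2.two_dvd
        exact ⟨k, Nat.mem_divisors.mpr ⟨Nat.dvd_of_mul_dvd_mul_left two_pos hk.1.1, c.pos.ne'⟩, rfl⟩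
      · intro k hk
        rw [one_pow, one_mul, hc, Nat.mul_div_mul_left _ _ two_pos]
    rw [h2, hc, powTwoWeight_two_mul, add_eq_right] at h1
    rw [h1, if_neg]
    rintro rfl
    rw [PNat.one_coe] at hc
    omega
  · have h1 : twistedWeight (-1) m = - powTwoWeight m := by
      rw [twistedWeight, ← hsum, ← Finset.sum_neg_distrib]
      refine Finset.sum_congr rfl fun k hk => ?_
      rw [(hm.of_dvd_nat (Nat.dvd_of_mem_divisors hk)).neg_one_pow, neg_one_mul]
    rw [h1, powTwoWeight]
    by_cases h : m = 1
    · subst h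
      rw [if_pos rfl, if_pos ⟨0, by simp⟩]
      simp
    · rw [if_neg h, if_neg, neg_zero]
      rintro ⟨a, ha⟩
      rcases a with _ | a
      · exact h (PNat.coe_injective (by simpa using ha))
      · rw [ha, pow_succ'] at hm
        exact (Nat.not_even_iff_odd.mpr hm) (even_two_mul _)

/-- The sum of all monomials in the `p_{2^a}`. -/
def powTwoSeries : SymmSeries :=
  fun w => open Classical in if ∀ k ∈ w.support, ∃ a : ℕ, (k : ℕ) = 2 ^ a then 1 else 0

theorem coeff_powTwoSeries (w : ℕ+ →₀ ℕ) : MvPowerSeries.coeff w powTwoSeries =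
    open Classical in if ∀ k ∈ w.support, ∃ a : ℕ, (k : ℕ) = 2 ^ a then 1 else 0 := rfl

/-- The series is ∏_a 1/(1 - p_{2^a}), with logarithmic derivative Σ 2^a p_{2^a}^e. On coefficients:
each way of removing p_m^e from w with 1 ≤ e ≤ w_m contributes m, for a total of Σ m·w_m = deg w. -/
theorem eulerDeriv_powTwoSeries (N : ℕ) :
    eulerDeriv powTwoSeries - adamsSum 1 lieTwoSeries N * powTwoSeries ∈ degreeIdeal (N + 1) := by
  classical
  intro w hw
  rw [map_sub, sub_eq_zero, coeff_eulerDeriv, MvPowerSeries.coeff_mul]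
  have hsum : ∑ p ∈ antidiagonal w, MvPowerSeries.coeff p.1 (adamsSum 1 lieTwoSeries N) *
      MvPowerSeries.coeff p.2 powTwoSeries = ∑ m ∈ w.support, ∑ e ∈ Finset.Icc 1 (w m),
        powTwoWeight m * MvPowerSeries.coeff (w - Finsupp.single m e) powTwoSeries := by
    rw [Finset.sum_sigma']
    symm
    have hle : ∀ x ∈ w.support.sigma fun m => Finset.Icc 1 (w m), x.2 ≠ 0 ∧
        Finsupp.single x.1 x.2 ≤ w := by
      intro x hx
      rw [Finset.mem_sigma, Finset.mem_Icc] at hx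
      exact ⟨by omega, Finsupp.single_le_iff.mpr hx.2.2⟩
    refine Finset.sum_of_injOn
      (fun x => (Finsupp.single x.1 x.2, w - Finsupp.single x.1 x.2)) ?_ ?_ ?_ ?_
    · rintro ⟨m, e⟩ hx ⟨m', e'⟩ hx' h
      have h1 := congrArg Prod.fst h
      have h2 := (hle _ (Finset.mem_coe.mp hx)).1
      rw [Finsupp.single_eq_single_iff] at h1
      rcases h1 with ⟨h1, h1'⟩ | ⟨h1, -⟩
      · dsimp only at h1 h1'
        subst h1 h1'
        rfl
      · exact absurd h1 h2
    · intro x hx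
      rw [Finset.mem_coe, Finset.HasAntidiagonal.mem_antidiagonal]
      exact add_tsub_cancel_of_le (hle x (Finset.mem_coe.mp hx)).2
    · intro p hp hnot
      rw [coeff_adamsSum_eq_zero, zero_mul]
      intro m e he hpe
      have hp' := Finset.HasAntidiagonal.mem_antidiagonal.mp hp
      have hem : e ≤ w m := by
        have := DFunLike.congr_fun hp' m
        rw [Finsupp.add_apply, hpe, Finsupp.single_eq_same] at this
        omega
      refine hnot ⟨⟨m, e⟩, ?_, ?_⟩
      · rw [Finset.mem_coe, Finset.mem_sigma, Finset.mem_Icc, Finsupp.mem_support_iff]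
        dsimp only
        omega
      · refine Prod.ext hpe.symm ?_
        dsimp only
        rw [← hp', hpe, add_tsub_cancel_left]
    · rintro ⟨m, e⟩ hx
      have h2 := hle _ hx
      have h3 := (Finsupp.single_le_iff.mp h2.2)
      have h4 : e * (m : ℕ) ≤ psDegree w := by
        rw [← psDegree_single]
        obtain ⟨v, hv⟩ := exists_add_of_le h2.2
        rw [hv, map_add]
        exact Nat.le_add_right _ _
      have h5 : e * (m : ℕ) ≤ N := by omega
      dsimp only
      rw [coeff_adamsSum_single 1 m h2.1 h5, twistedWeight_one]
  rw [hsum]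
  by_cases hq : ∀ k ∈ w.support, ∃ a : ℕ, (k : ℕ) = 2 ^ a
  · rw [coeff_powTwoSeries, if_pos hq, mul_one, psDegree, Finsupp.weight_apply, Finsupp.sum,
      Nat.cast_sum]
    refine Finset.sum_congr rfl fun m hm => ?_
    have : ∀ e ∈ Finset.Icc 1 (w m),
        powTwoWeight m * MvPowerSeries.coeff (w - Finsupp.single m e) powTwoSeries = (m : ℕ) := by
      intro e _
      rw [coeff_powTwoSeries, if_pos, powTwoWeight, if_pos (hq m hm), mul_one]
      intro k hk
      exact hq k (Finsupp.support_tsub hk)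
    rw [Finset.sum_congr rfl this, Finset.sum_const, Nat.card_Icc]
    simp
  · rw [coeff_powTwoSeries, if_neg hq, mul_zero, Finset.sum_eq_zero]
    intro m hm
    refine Finset.sum_eq_zero fun e _ => ?_
    by_cases hm2 : ∃ a : ℕ, (m : ℕ) = 2 ^ a
    · rw [coeff_powTwoSeries, if_neg, mul_zero]
      intro h
      apply hq
      intro k hk
      rcases eq_or_ne k m with rfl | hkm
      · exact hm2
      · refine h k ?_
        rw [Finsupp.mem_support_iff, Finsupp.tsub_apply, Finsupp.single_eq_of_ne hkm]
        simpa using hk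
    · rw [powTwoWeight, if_neg hm2, zero_mul]

/-- For ε = -1 the multiplier is -(p_1 + p_1² + ⋯) up to degree N. Multiplied by 1 - p_1 it
telescopes to -p_1 = D(1 - p_1). -/
theorem eulerDeriv_one_sub_X (N : ℕ) :
    eulerDeriv (1 - MvPowerSeries.X 1) - adamsSum (-1) lieTwoSeries N * (1 - MvPowerSeries.X 1) ∈
      degreeIdeal (N + 1) := by
  classical
  intro w hw
  have hS : ∀ v : ℕ+ →₀ ℕ, psDegree v ≤ N →
      MvPowerSeries.coeff v (adamsSum (-1) lieTwoSeries N) =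
        if v ≠ 0 ∧ v = Finsupp.single 1 (v 1) then -1 else 0 := by
    intro v hv
    by_cases h : ∃ m e, e ≠ 0 ∧ v = Finsupp.single m e
    · obtain ⟨m, e, he, rfl⟩ := h
      rw [psDegree_single] at hv
      rw [coeff_adamsSum_single _ _ he hv, twistedWeight_neg_one]
      by_cases hm : m = 1
      · subst hm
        simp [he]
      · rw [if_neg hm, if_neg]
        rintro ⟨h1, h2⟩
        rw [Finsupp.single_eq_single_iff] at h2
        rcases h2 with ⟨h2, -⟩ | ⟨h2, -⟩
        · exact hm h2
        · exact he h2
    · rw [coeff_adamsSum_eq_zero, if_neg]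
      · rintro ⟨h1, h2⟩
        refine h ⟨1, v 1, fun h0 => h1 ?_, h2⟩
        rw [h2, h0, Finsupp.single_zero]
      · intro m e he hv
        exact h ⟨m, e, he, hv⟩
  have hXc : MvPowerSeries.coeff w (adamsSum (-1) lieTwoSeries N * MvPowerSeries.X 1) =
      if Finsupp.single 1 1 ≤ w then
        MvPowerSeries.coeff (w - Finsupp.single 1 1) (adamsSum (-1) lieTwoSeries N) else 0 := by
    rw [MvPowerSeries.X, MvPowerSeries.coeff_mul_monomial]
    simp
  rw [mul_sub, mul_one, map_sub (MvPowerSeries.coeff w), coeff_eulerDeriv,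
    map_sub (MvPowerSeries.coeff w), map_sub (MvPowerSeries.coeff w), hXc, MvPowerSeries.coeff_one,
    MvPowerSeries.coeff_X, hS w (by omega)]
  by_cases hw1 : w = Finsupp.single 1 (w 1)
  · generalize w 1 = e at hw1
    subst hw1
    rcases e with _ | _ | e
    · simp
    · have h0 : MvPowerSeries.coeff 0 (adamsSum (-1) lieTwoSeries N) = 0 :=
        adamsSum_mem (-1) N 0 (by simp)
      simp [psDegree_single, h0]
    · have h1 : (Finsupp.single 1 (e + 1 + 1) - Finsupp.single 1 1 : ℕ+ →₀ ℕ) =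
          Finsupp.single 1 (e + 1) := by
        rw [← Finsupp.single_tsub]; rfl
      rw [psDegree_single] at hw
      rw [h1, hS _ (by rw [psDegree_single]; push_cast at hw ⊢; omega)]
      simp
  · have h2 : ¬ (Finsupp.single 1 1 ≤ w ∧ (w - Finsupp.single 1 1 ≠ 0 ∧ w - Finsupp.single 1 1 =
        Finsupp.single 1 ((w - Finsupp.single 1 1 : ℕ+ →₀ ℕ) 1))) := by
      rintro ⟨h3, -, h4⟩
      apply hw1
      have := tsub_add_cancel_of_le h3
      rw [h4, ← Finsupp.single_add] at this
      rw [← this, Finsupp.single_eq_same]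
    have h5 : (if Finsupp.single 1 1 ≤ w then
        MvPowerSeries.coeff (w - Finsupp.single 1 1) (adamsSum (-1) lieTwoSeries N) else 0) = 0 := by
      split_ifs with h3
      · rw [hS, if_neg fun h => h2 ⟨h3, h⟩]
        have : psDegree w = psDegree (w - Finsupp.single 1 1) + psDegree (Finsupp.single 1 1) := by
          rw [← map_add, tsub_add_cancel_of_le h3]
        omega
      · rfl
    rw [h5, if_neg, if_neg, if_neg fun h => hw1 h.2]
    · simp
    · rintro rfl
      simp at hw1
    · rintro rfl
      simp at hw1

theorem homogSum_sub_mem (ε : ℂ) (N : ℕ) {Q : SymmSeries}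
    (hQ : eulerDeriv Q - adamsSum ε lieTwoSeries N * Q ∈ degreeIdeal (N + 1))
    (h0 : MvPowerSeries.constantCoeff Q = 1) :
    homogSum ε lieTwoSeries N - Q ∈ degreeIdeal (N + 1) := by
  refine sub_mem_degreeIdeal_of_eulerDeriv (adamsSum_mem ε N)
    (eulerDeriv_homogSum ε lieTwoSeries_mem N) hQ ?_
  rw [mem_degreeIdeal_one, map_sub, h0, homogSum, Finset.sum_range_succ', map_add, map_sum,
    plethysm_completeHomog_zero, Finset.sum_eq_zero]
  · simp
  · intro m _
    rw [MvPowerSeries.constantCoeff_smul, constantCoeff_plethysm lieTwoSeries_mem, smul_zero]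

end Evaluation

/-! ### Characteristics and isomorphisms of the modules `Vh` -/

section Characteristics

theorem card_parts_eq_degree {n : ℕ} (ν : n.Partition) : ν.parts.card = (partExp ν).degree := by
  classical
  have h : ∀ s : Multiset ℕ+, (Multiset.toFinsupp s).degree = s.card := by
    intro s
    induction s using Multiset.induction_on with
    | empty => simp
    | cons a s ih =>
      rw [← Multiset.singleton_add, map_add, map_add, ih, Multiset.toFinsupp_singleton,
        Finsupp.degree_single, Multiset.card_add, Multiset.card_singleton]
  rw [partExp, h, Multiset.card_map]

theorem coeff_sum_powerSumPart {n : ℕ} (S : Finset n.Partition) (w : ℕ+ →₀ ℕ) :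
    MvPolynomial.coeff w (∑ ν ∈ S, powerSumPart ν) =
      open Classical in if ∃ ν ∈ S, partExp ν = w then 1 else 0 := by
  classical
  simp_rw [MvPolynomial.coeff_sum, powerSumPart_eq_monomial, MvPolynomial.coeff_monomial]
  split_ifs with h
  · obtain ⟨ν, hν, rfl⟩ := h
    rw [Finset.sum_eq_single_of_mem ν hν, if_pos rfl]
    exact fun μ _ h => if_neg fun h' => h (partExp_injective h')
  · exact Finset.sum_eq_zero fun ν hν => if_neg fun h' => h ⟨ν, hν, h'⟩

theorem partsPowTwo_iff {n : ℕ} (ν : n.Partition) :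
    PartsPowTwo ν ↔ ∀ k ∈ (partExp ν).support, ∃ a : ℕ, (k : ℕ) = 2 ^ a := by
  constructor
  · intro h k hk
    rw [Finsupp.mem_support_iff, partExp_apply, Multiset.count_ne_zero] at hk
    exact h _ hk
  · intro h i hi
    obtain ⟨k, rfl⟩ : ∃ k : ℕ+, (k : ℕ) = i := ⟨⟨i, ν.parts_pos hi⟩, rfl⟩
    refine h k ?_
    rw [Finsupp.mem_support_iff, partExp_apply]
    exact Multiset.count_ne_zero.mpr hi

theorem coeff_sumPowTwo (n : ℕ) (w : ℕ+ →₀ ℕ) : MvPolynomial.coeff w (sumPowTwo n) =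
    if psDegree w = n then MvPowerSeries.coeff w powTwoSeries else 0 := by
  classical
  rw [sumPowTwo, coeff_sum_powerSumPart, coeff_powTwoSeries, ← ite_and]
  refine if_congr ⟨?_, ?_⟩ rfl rfl
  · rintro ⟨ν, hν, rfl⟩
    exact ⟨weight_partExp ν, (partsPowTwo_iff ν).mp (Finset.mem_filter.mp hν).2⟩
  · rintro ⟨h1, h2⟩
    obtain ⟨ν, rfl⟩ := exists_partExp_eq h1
    exact ⟨ν, Finset.mem_filter.mpr ⟨Finset.mem_univ _, (partsPowTwo_iff ν).mpr h2⟩, rfl⟩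

/-- The parity of n - ℓ is expressed through n + ℓ, which avoids truncated subtraction and matches
the exponent of the sign character. -/
theorem coeff_sumPowTwoEven (n : ℕ) (w : ℕ+ →₀ ℕ) : MvPolynomial.coeff w (sumPowTwoEven n) =
    if Even (n + w.degree) then MvPolynomial.coeff w (sumPowTwo n) else 0 := by
  classical
  rw [coeff_sumPowTwo, sumPowTwoEven, coeff_sum_powerSumPart, coeff_powTwoSeries, ← ite_and,
    ← ite_and]
  have hle : ∀ ν : n.Partition, ν.parts.card ≤ n := fun ν => by
    conv_rhs => rw [← ν.parts_sum]
    simpa using Multiset.card_nsmul_le_sum (s := ν.parts) (a := 1) fun i hi => ν.parts_pos hi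
  have hev : ∀ ν : n.Partition, Even (n - ν.parts.card) ↔ Even (n + (partExp ν).degree) := fun ν => by
    rw [← card_parts_eq_degree, Nat.even_sub (hle ν), Nat.even_add]
  refine if_congr ⟨?_, ?_⟩ rfl rfl
  · rintro ⟨ν, hν, rfl⟩
    have h := (Finset.mem_filter.mp hν).2
    exact ⟨⟨(hev ν).mp h.2, weight_partExp ν⟩, (partsPowTwo_iff ν).mp h.1⟩
  · rintro ⟨⟨h0, h1⟩, h2⟩
    obtain ⟨ν, rfl⟩ := exists_partExp_eq h1
    exact ⟨ν, Finset.mem_filter.mpr ⟨Finset.mem_univ _, (partsPowTwo_iff ν).mpr h2, (hev ν).mpr h0⟩,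
      rfl⟩

theorem cycleMonomial_permSucc (m : ℕ) (σ : Equiv.Perm (Fin m)) :
    cycleMonomial (permSucc m σ) = MvPolynomial.X 1 * cycleMonomial σ := by
  have h : (permSucc m σ).cycleType = σ.cycleType :=
    @Equiv.Perm.cycleType_extendDomain _ _ _ _ _ _ _ (fun _ => Classical.propDecidable _) _ _
  have hle := Equiv.Perm.sum_cycleType_le σ
  rw [Fintype.card_fin] at hle
  rw [cycleMonomial_eq, cycleMonomial_eq, h, Fintype.card_fin, Fintype.card_fin,
    Nat.succ_sub hle, pow_succ]
  ring

theorem frobeniusChar_ind_permSucc (m : ℕ) {W : Type*} [AddCommGroup W] [Module ℂ W]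
    [FiniteDimensional ℂ W] (ρ : Representation ℂ (Equiv.Perm (Fin m)) W) :
    frobeniusChar (Representation.ind (permSucc m) ρ) = MvPolynomial.X 1 * frobeniusChar ρ := by
  rw [frobeniusChar_ind, frobeniusChar_eq_charSum, charSum, Fintype.card_perm, Fintype.card_fin,
    mul_smul_comm, Finset.mul_sum]
  simp_rw [cycleMonomial_permSucc, mul_smul_comm]

/-- Powers of 2 other than 1 are even, so a monomial of odd degree in the p_{2^a} is divisible by
p_1. -/
theorem sumPowTwo_two_mul_add_one (n : ℕ) :
    sumPowTwo (2 * n + 1) = MvPolynomial.X 1 * sumPowTwo (2 * n) := by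
  classical
  ext w
  rw [MvPolynomial.coeff_X_mul', coeff_sumPowTwo]
  split_ifs with h1 h2 h2
  · have hle : Finsupp.single 1 1 ≤ w := by
      rw [Finsupp.single_le_iff]
      exact Nat.one_le_iff_ne_zero.mpr (Finsupp.mem_support_iff.mp h2)
    have hdeg : psDegree w = psDegree (w - Finsupp.single 1 1) + 1 := by
      conv_lhs => rw [← tsub_add_cancel_of_le hle, map_add, psDegree_single]
      rfl
    rw [coeff_sumPowTwo, if_pos (by omega), coeff_powTwoSeries, coeff_powTwoSeries]
    refine if_congr ⟨fun h k hk => h k (Finsupp.support_tsub hk), fun h k hk => ?_⟩ rfl rfl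
    rcases eq_or_ne k 1 with rfl | hk1
    · exact ⟨0, rfl⟩
    · refine h k ?_
      rw [Finsupp.mem_support_iff, Finsupp.tsub_apply, Finsupp.single_eq_of_ne hk1]
      simpa using hk
  · rw [coeff_powTwoSeries, if_neg]
    intro h
    have : 2 ∣ psDegree w := by
      rw [psDegree, Finsupp.weight_apply]
      refine Finset.dvd_sum fun k hk => Dvd.dvd.mul_left ?_ _
      obtain ⟨a, ha⟩ := h k hk
      rcases a with _ | a
      · have : k = 1 := PNat.coe_injective (by simpa using ha)
        exact absurd (this ▸ hk) h2
      · exact ⟨2 ^ a, by rw [ha, pow_succ']⟩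
    omega
  · have hle : Finsupp.single 1 1 ≤ w := by
      rw [Finsupp.single_le_iff]
      exact Nat.one_le_iff_ne_zero.mpr (Finsupp.mem_support_iff.mp h2)
    have hdeg : psDegree w = psDegree (w - Finsupp.single 1 1) + 1 := by
      conv_lhs => rw [← tsub_add_cancel_of_le hle, map_add, psDegree_single]
      rfl
    rw [coeff_sumPowTwo, if_neg (by omega)]
  · rfl

/-- A permutation of cycle type λ has sign (-1)^(n-ℓ(λ)), and fixed points count as parts of λ. -/
theorem coeff_charSum_sign_mul {n : ℕ} (φ : Equiv.Perm (Fin n) → ℂ) (w : ℕ+ →₀ ℕ) :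
    MvPolynomial.coeff w (charSum fun σ => ((Equiv.Perm.sign σ : ℤ) : ℂ) * φ σ) =
      (-1) ^ (n + w.degree) * MvPolynomial.coeff w (charSum φ) := by
  classical
  rw [charSum, charSum, MvPolynomial.coeff_smul, MvPolynomial.coeff_smul, MvPolynomial.coeff_sum,
    MvPolynomial.coeff_sum, smul_eq_mul, smul_eq_mul, mul_left_comm, Finset.mul_sum (a := (-1) ^ _)]
  congr 1
  refine Finset.sum_congr rfl fun σ _ => ?_
  rw [MvPolynomial.coeff_smul, MvPolynomial.coeff_smul, cycleMonomial, powerSumPart_eq_monomial,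
    MvPolynomial.coeff_monomial]
  split_ifs with h
  · have hs : Equiv.Perm.sign σ = (-1) ^ (n + w.degree) := by
      rw [← h, ← card_parts_eq_degree, Equiv.Perm.parts_partition, Equiv.Perm.sign_of_cycleType,
        Multiset.card_add, Multiset.card_replicate, Fintype.card_fin, ← Equiv.Perm.sum_cycleType]
      have hle := Equiv.Perm.sum_cycleType_le σ
      rw [Fintype.card_fin] at hle
      obtain ⟨d, hd⟩ := Nat.exists_eq_add_of_le hle
      rw [show n + (σ.cycleType.card + (n - σ.cycleType.sum)) =
        (σ.cycleType.sum + σ.cycleType.card) + 2 * d by omega, pow_add _ _ (2 * d), pow_mul]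
      simp
    rw [hs]
    push_cast
    rw [smul_eq_mul, smul_eq_mul, mul_assoc]
  · rw [smul_zero, smul_zero, mul_zero]

end Characteristics

section Family

variable {n : ℕ} {W : Fin (n + 1) → Type u} [∀ r, AddCommGroup (W r)] [∀ r, Module ℂ (W r)]
  {ρ : ∀ r, Representation ℂ (Equiv.Perm (Fin n)) (W r)}

/-- With m = n - r, the left side is the degree n term of Σ ε^m h_m[L], and Q is any solution up to
degree n of its differential equation. -/
theorem IsVhFamily.coeff_sum (hρ : IsVhFamily ρ) (ε : ℂ) {Q : SymmSeries}
    (hQ : eulerDeriv Q - adamsSum ε lieTwoSeries n * Q ∈ degreeIdeal (n + 1))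
    (h0 : MvPowerSeries.constantCoeff Q = 1) (w : ℕ+ →₀ ℕ) :
    ∑ r : Fin (n + 1), ε ^ (n - (r : ℕ)) * MvPolynomial.coeff w (frobeniusChar (ρ r)) =
      if psDegree w = n then MvPowerSeries.coeff w Q else 0 := by
  split_ifs with h
  · have h1 := homogSum_sub_mem ε n hQ h0 w (by omega)
    rw [map_sub, sub_eq_zero, homogSum, map_sum, ← Finset.sum_range_reflect] at h1
    rw [← h1, ← Fin.sum_univ_eq_sum_range (fun j => MvPowerSeries.coeff w (ε ^ (n + 1 - 1 - j) •
      plethysm (completeHomog (n + 1 - 1 - j)) lieTwoSeries))]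
    refine Finset.sum_congr rfl fun r _ => ?_
    rw [← MvPolynomial.coeff_coe, (hρ r).2, MvPowerSeries.coeff_smul]
    congr 1
    exact if_pos h
  · exact Finset.sum_eq_zero fun r _ => by rw [coeff_frobeniusChar_eq_zero _ h, mul_zero]

theorem IsVhFamily.sum_frobeniusChar (hρ : IsVhFamily ρ) :
    ∑ r, frobeniusChar (ρ r) = sumPowTwo n := by
  ext w
  rw [coeff_sumPowTwo, ← hρ.coeff_sum 1 (eulerDeriv_powTwoSeries n), MvPolynomial.coeff_sum]
  · simp
  · rw [← MvPowerSeries.coeff_zero_eq_constantCoeff_apply, coeff_powTwoSeries, if_pos (by simp)]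

/-- The series 1 - p_1 has no term of degree at least 2. The signs (-1)^r and (-1)^(n-r) differ by
the global factor (-1)^n. -/
theorem IsVhFamily.sum_neg_one_pow_smul (hρ : IsVhFamily ρ) (hn : 2 ≤ n) :
    ∑ r : Fin (n + 1), ((-1 : ℂ) ^ (r : ℕ)) • frobeniusChar (ρ r) = 0 := by
  classical
  ext w
  have h := hρ.coeff_sum (-1) (eulerDeriv_one_sub_X n) (by simp) w
  rw [MvPolynomial.coeff_sum, MvPolynomial.coeff_zero]
  have h2 : ∀ r : Fin (n + 1), MvPolynomial.coeff w (((-1 : ℂ) ^ (r : ℕ)) • frobeniusChar (ρ r)) =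
      (-1) ^ n * ((-1) ^ (n - (r : ℕ)) * MvPolynomial.coeff w (frobeniusChar (ρ r))) := fun r => by
    rw [MvPolynomial.coeff_smul, smul_eq_mul, ← mul_assoc, ← pow_add,
      show n + (n - (r : ℕ)) = r + 2 * (n - r) by have := r.2; omega, pow_add, pow_mul]
    simp
  rw [Finset.sum_congr rfl fun r _ => h2 r, ← Finset.mul_sum, h]
  split_ifs with hw
  · rw [map_sub, MvPowerSeries.coeff_one, MvPowerSeries.coeff_X, if_neg, if_neg]
    · simp
    · rintro rfl
      rw [psDegree_single] at hw
      simp at hw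
      omega
    · rintro rfl
      simp at hw
      omega
  · simp

theorem IsVhFamily.frobeniusChar_directSum (hρ : IsVhFamily ρ) (p : Fin (n + 1) → Prop)
    [DecidablePred p] :
    frobeniusChar (Representation.directSum fun r : {r // p r} => ρ r) =
      ∑ r with p r, frobeniusChar (ρ r) := by
  have := fun r => (hρ r).1
  rw [frobeniusChar_eq_charSum, character_directSum, charSum_sum, Finset.sum_subtype _ (p := p)]
  · rfl
  · simp

theorem finiteDimensional_directSum {ι : Type*} [Finite ι] (V : ι → Type*)
    [∀ i, AddCommGroup (V i)] [∀ i, Module ℂ (V i)] [∀ i, FiniteDimensional ℂ (V i)] :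
    FiniteDimensional ℂ (⨁ i, V i) := by
  classical
  have := Fintype.ofFinite ι
  exact Module.Finite.equiv (DirectSum.linearEquivFunOnFintype ℂ ι V).symm

theorem IsVhFamily.finiteDimensional_odd (hρ : IsVhFamily ρ) :
    FiniteDimensional ℂ (⨁ r : {r : Fin (n + 1) // Odd (r : ℕ)}, W r) :=
  have := fun r => (hρ r).1
  finiteDimensional_directSum _

theorem IsVhFamily.finiteDimensional_even (hρ : IsVhFamily ρ) :
    FiniteDimensional ℂ (⨁ r : {r : Fin (n + 1) // Even (r : ℕ)}, W r) :=
  have := fun r => (hρ r).1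
  finiteDimensional_directSum _

theorem frobeniusChar_prod {V V' : Type*} [AddCommGroup V] [Module ℂ V] [AddCommGroup V']
    [Module ℂ V'] [FiniteDimensional ℂ V] [FiniteDimensional ℂ V'] {n : ℕ}
    (ρ : Representation ℂ (Equiv.Perm (Fin n)) V) (ρ' : Representation ℂ (Equiv.Perm (Fin n)) V') :
    frobeniusChar (ρ.prod ρ') = frobeniusChar ρ + frobeniusChar ρ' := by
  rw [frobeniusChar_eq_charSum, character_prod, charSum_add]
  rfl

theorem IsVhFamily.frobeniusChar_total (hρ : IsVhFamily ρ) :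
    frobeniusChar (vhTotal ρ) = sumPowTwo n := by
  have := hρ.finiteDimensional_odd
  have := hρ.finiteDimensional_even
  rw [vhTotal, frobeniusChar_prod, ← hρ.sum_frobeniusChar, vhOdd, vhEven,
    hρ.frobeniusChar_directSum fun r => Odd (r : ℕ), hρ.frobeniusChar_directSum fun r => Even (r : ℕ),
    add_comm, ← Finset.sum_filter_add_sum_filter_not Finset.univ fun r : Fin (n + 1) => Even (r : ℕ)]
  simp only [Nat.not_even_iff_odd]

theorem IsVhFamily.frobeniusChar_odd_eq_even (hρ : IsVhFamily ρ) (hn : 2 ≤ n) :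
    frobeniusChar (vhOdd ρ) = frobeniusChar (vhEven ρ) := by
  have h := hρ.sum_neg_one_pow_smul hn
  rw [← Finset.sum_filter_add_sum_filter_not _ fun r : Fin (n + 1) => Even (r : ℕ)] at h
  simp only [Nat.not_even_iff_odd] at h
  rw [Finset.sum_congr rfl (g := fun r => frobeniusChar (ρ r)),
    Finset.sum_congr (s₁ := Finset.univ.filter fun r : Fin (n + 1) => Odd (r : ℕ)) rfl
      (g := fun r => - frobeniusChar (ρ r)), Finset.sum_neg_distrib, ← sub_eq_add_neg,
    sub_eq_zero] at h
  · rw [vhOdd, vhEven, hρ.frobeniusChar_directSum fun r => Odd (r : ℕ),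
      hρ.frobeniusChar_directSum fun r => Even (r : ℕ), h]
  · intro r hr
    rw [(Finset.mem_filter.mp hr).2.neg_one_pow, neg_one_smul]
  · intro r hr
    rw [(Finset.mem_filter.mp hr).2.neg_one_pow, one_smul]

theorem IsVhFamily.frobeniusChar_odd (hρ : IsVhFamily ρ) (hn : 2 ≤ n) :
    frobeniusChar (vhOdd ρ) = (1 / 2 : ℂ) • sumPowTwo n := by
  have := hρ.finiteDimensional_odd
  have := hρ.finiteDimensional_even
  rw [← hρ.frobeniusChar_total, vhTotal, frobeniusChar_prod, ← hρ.frobeniusChar_odd_eq_even hn,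
    ← two_smul ℂ, smul_smul]
  norm_num

theorem frobeniusChar_signRep_tprod {V : Type*} [AddCommGroup V] [Module ℂ V]
    [FiniteDimensional ℂ V] (ρ : Representation ℂ (Equiv.Perm (Fin n)) V) :
    frobeniusChar ((signRep n).tprod ρ) =
      charSum fun σ => ((Equiv.Perm.sign σ : ℤ) : ℂ) * ρ.character σ := by
  rw [frobeniusChar_eq_charSum, Representation.char_tensor]
  congr 1
  funext σ
  rw [Pi.mul_apply, signRep, character_linearCharRep]
  rfl

theorem IsVhFamily.frobeniusChar_odd_prod_sign (hρ : IsVhFamily ρ) (hn : 2 ≤ n) :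
    frobeniusChar ((vhOdd ρ).prod ((signRep n).tprod (vhOdd ρ))) = sumPowTwoEven n := by
  have := hρ.finiteDimensional_odd
  rw [frobeniusChar_prod, frobeniusChar_signRep_tprod]
  ext w
  rw [MvPolynomial.coeff_add, coeff_charSum_sign_mul, ← frobeniusChar_eq_charSum,
    hρ.frobeniusChar_odd hn, coeff_sumPowTwoEven, MvPolynomial.coeff_smul, smul_eq_mul]
  split_ifs with h
  · rw [h.neg_one_pow]; ring
  · rw [(Nat.not_even_iff_odd.mp h).neg_one_pow]; ring

theorem IsVhFamily.nonempty_equiv_odd_even (hρ : IsVhFamily ρ) (hn : 2 ≤ n) :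
    Nonempty ((vhOdd ρ).Equiv (vhEven ρ)) :=
  have := hρ.finiteDimensional_odd
  have := hρ.finiteDimensional_even
  nonempty_equiv_of_frobeniusChar_eq _ _ (hρ.frobeniusChar_odd_eq_even hn)

theorem nonempty_equiv_ind_permSucc {n : ℕ} {W : Fin (2 * n + 1) → Type u}
    [∀ r, AddCommGroup (W r)] [∀ r, Module ℂ (W r)]
    {ρ : ∀ r, Representation ℂ (Equiv.Perm (Fin (2 * n))) (W r)} {W' : Fin (2 * n + 1 + 1) → Type u}
    [∀ r, AddCommGroup (W' r)] [∀ r, Module ℂ (W' r)]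
    {ρ' : ∀ r, Representation ℂ (Equiv.Perm (Fin (2 * n + 1))) (W' r)} (hρ : IsVhFamily ρ)
    (hρ' : IsVhFamily ρ') :
    Nonempty ((vhTotal ρ').Equiv (Representation.ind (permSucc (2 * n)) (vhTotal ρ))) := by
  have := hρ.finiteDimensional_odd
  have := hρ.finiteDimensional_even
  have := hρ'.finiteDimensional_odd
  have := hρ'.finiteDimensional_even
  have : FiniteDimensional ℂ (MonoidAlgebra ℂ (Equiv.Perm (Fin (2 * n + 1)))) :=
    (MonoidAlgebra.basis _ ℂ).finiteDimensional_of_finite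
  refine nonempty_equiv_of_frobeniusChar_eq _ _ ?_
  rw [hρ'.frobeniusChar_total, frobeniusChar_ind_permSucc, hρ.frobeniusChar_total,
    sumPowTwo_two_mul_add_one]

end Family

/-! ### Polynomial functors on matrices -/

open Equiv (Perm)

section SymmetrizedPower

variable {H ι Ω R S : Type*} [Group H] [Fintype H] [Fintype ι] [CommRing R]
  [Algebra ℂ R] [CommRing S] [Algebra ℂ S]

/-- The action of a matrix on the image of the projector `|H|⁻¹ ∑ χ(h) h` in a tensor power. -/
def symmetrizedPower (φ : H →* Perm ι) (χ : H →* ℂ) (B : Matrix Ω Ω R) :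
    Matrix (ι → Ω) (ι → Ω) R :=
  Matrix.of fun f g => ∑ h, ((Fintype.card H : ℂ)⁻¹ * χ h) • ∏ i, B (f i) (g (φ h i))

/-- In the double sum over H the summand depends only on h'h, so each element occurs |H| times and
one normalising factor cancels. The construction is not unital: the identity matrix goes to the
projector. -/
theorem symmetrizedPower_mul [DecidableEq ι] [Fintype Ω] (φ : H →* Perm ι) (χ : H →* ℂ)
    (A B : Matrix Ω Ω R) :
    symmetrizedPower φ χ (A * B) = symmetrizedPower φ χ A * symmetrizedPower φ χ B := by
  have hH : (Fintype.card H : ℂ) ≠ 0 := by exact_mod_cast Fintype.card_ne_zero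
  have key : ∀ (f g : ι → Ω) (h h' : H),
      ∑ e : ι → Ω, (∏ i, A (f i) (e (φ h i))) * ∏ i, B (e i) (g (φ h' i)) =
        ∏ i, (A * B) (f i) (g (φ (h' * h) i)) := by
    intro f g h h'
    rw [← Equiv.sum_comp ((φ h).arrowCongr (Equiv.refl Ω))]
    simp_rw [Matrix.mul_apply]
    rw [Fintype.prod_sum]
    refine Finset.sum_congr rfl fun e _ => ?_
    rw [← Equiv.prod_comp (φ h) fun i => B _ (g (φ h' i)), ← Finset.prod_mul_distrib]
    refine Finset.prod_congr rfl fun i _ => ?_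
    simp [Equiv.arrowCongr]
  ext f g
  symm
  calc (symmetrizedPower φ χ A * symmetrizedPower φ χ B) f g
      = ∑ e : ι → Ω, (∑ h, ((Fintype.card H : ℂ)⁻¹ * χ h) • ∏ i, A (f i) (e (φ h i))) *
          ∑ h', ((Fintype.card H : ℂ)⁻¹ * χ h') • ∏ i, B (e i) (g (φ h' i)) := rfl
    _ = ∑ h, ∑ h', ((Fintype.card H : ℂ)⁻¹ * ((Fintype.card H : ℂ)⁻¹ * χ (h' * h))) •
          ∏ i, (A * B) (f i) (g (φ (h' * h) i)) := by
        simp_rw [Finset.sum_mul_sum]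
        rw [Finset.sum_comm]
        refine Finset.sum_congr rfl fun h _ => ?_
        rw [Finset.sum_comm]
        refine Finset.sum_congr rfl fun h' _ => ?_
        rw [← key, Finset.smul_sum]
        refine Finset.sum_congr rfl fun e _ => ?_
        rw [smul_mul_smul_comm, map_mul]
        congr 1
        ring
    _ = ∑ _h : H, ∑ k, ((Fintype.card H : ℂ)⁻¹ * ((Fintype.card H : ℂ)⁻¹ * χ k)) •
          ∏ i, (A * B) (f i) (g (φ k i)) :=
        Finset.sum_congr rfl fun h _ => Equiv.sum_comp (Equiv.mulRight h)
          fun k => ((Fintype.card H : ℂ)⁻¹ * ((Fintype.card H : ℂ)⁻¹ * χ k)) •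
            ∏ i, (A * B) (f i) (g (φ k i))
    _ = symmetrizedPower φ χ (A * B) f g := by
        rw [Finset.sum_const, Finset.card_univ, ← Nat.cast_smul_eq_nsmul ℂ, Finset.smul_sum]
        refine Finset.sum_congr rfl fun k _ => ?_
        rw [smul_smul, mul_inv_cancel_left₀ hH]

theorem trace_symmetrizedPower [DecidableEq ι] [Fintype Ω] [DecidableEq Ω] (φ : H →* Perm ι)
    (χ : H →* ℂ) (B : Matrix Ω Ω R) :
    (symmetrizedPower φ χ B).trace = MvPolynomial.aeval (fun k : ℕ+ => (B ^ (k : ℕ)).trace)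
      ((Fintype.card H : ℂ)⁻¹ • ∑ h, χ h • cycleMonomial (φ h)) := by
  simp_rw [map_smul, map_sum, map_smul, ← twistedTrace_eq, twistedTrace, Finset.smul_sum,
    smul_smul]
  rw [Finset.sum_comm]
  rfl

theorem map_symmetrizedPower (φ : H →* Perm ι) (χ : H →* ℂ) (B : Matrix Ω Ω R) (F : R →ₐ[ℂ] S) :
    symmetrizedPower φ χ (B.map F) = (symmetrizedPower φ χ B).map F := by
  ext f g
  simp [symmetrizedPower]

/-- A diagonal matrix of variables records the content of words. This identity and its mirror image
let contents be tracked through the functors. -/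
theorem symmetrizedPower_diagonal_mul [DecidableEq ι] [Fintype Ω] [DecidableEq Ω]
    (φ : H →* Perm ι) (χ : H →* ℂ) (d : Ω → R) (B : Matrix Ω Ω R) : symmetrizedPower φ χ (Matrix.diagonal d * B) =
      Matrix.diagonal (fun f => ∏ i, d (f i)) * symmetrizedPower φ χ B := by
  ext f g
  rw [Matrix.diagonal_mul]
  simp_rw [symmetrizedPower, Matrix.of_apply, Matrix.diagonal_mul, Finset.prod_mul_distrib,
    Finset.mul_sum, mul_smul_comm]

theorem symmetrizedPower_mul_diagonal [DecidableEq ι] [Fintype Ω] [DecidableEq Ω]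
    (φ : H →* Perm ι) (χ : H →* ℂ) (d : Ω → R) (B : Matrix Ω Ω R) : symmetrizedPower φ χ (B * Matrix.diagonal d) =
      symmetrizedPower φ χ B * Matrix.diagonal fun f => ∏ i, d (f i) := by
  ext f g
  rw [Matrix.mul_diagonal]
  simp_rw [symmetrizedPower, Matrix.of_apply, Matrix.mul_diagonal, Finset.prod_mul_distrib,
    Finset.sum_mul, smul_mul_assoc]
  refine Finset.sum_congr rfl fun h _ => ?_
  rw [Equiv.prod_comp (φ h) fun i => d (g i)]

end SymmetrizedPower

/-! ### Matrix functors realising the plethysms h_m[Lie^(2)] in bounded degree -/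

section WordMatrix

variable {Ω R S : Type*} [CommRing R] [Algebra ℂ R] [CommRing S] [Algebra ℂ S]

/-- The functor with characteristic `∑_{1 ≤ k ≤ n} Lie^{(2)}_k`. -/
def lieMatrix (n : ℕ) (B : Matrix Ω Ω R) :
    Matrix (Σ k : Fin n, (Fin ((k : ℕ) + 1) → Ω)) (Σ k : Fin n, (Fin ((k : ℕ) + 1) → Ω)) R :=
  Matrix.blockDiagonal' fun k : Fin n =>
    symmetrizedPower (cyclicToPerm ((k : ℕ) + 1)) (lieTwoCharacter ((k : ℕ) + 1)) B

/-- The partial sums of `Lie^{(2)}`. -/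
def lieTwoPartial (n : ℕ) : SymmFun := ∑ k : Fin n, frobeniusChar (lieTwoRep ((k : ℕ) + 1))

/-- The functor with characteristic `h_m[∑_{1 ≤ k ≤ n} Lie^{(2)}_k]`. -/
def wordMatrix (n m : ℕ) (B : Matrix Ω Ω R) :
    Matrix (Fin m → Σ k : Fin n, (Fin ((k : ℕ) + 1) → Ω))
      (Fin m → Σ k : Fin n, (Fin ((k : ℕ) + 1) → Ω)) R :=
  symmetrizedPower (MonoidHom.id (Perm (Fin m))) 1 (lieMatrix n B)

/-- The weight of a word. -/
def wordWeight {n m : ℕ} (d : Ω → R) (f : Fin m → Σ k : Fin n, (Fin ((k : ℕ) + 1) → Ω)) : R :=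
  ∏ i, ∏ j, d ((f i).2 j)

theorem lieMatrix_mul [Fintype Ω] (n : ℕ) (A B : Matrix Ω Ω R) :
    lieMatrix n (A * B) = lieMatrix n A * lieMatrix n B := by
  simp_rw [lieMatrix, symmetrizedPower_mul, Matrix.blockDiagonal'_mul]

/-- The exponent is positive because `lieMatrix n 1` is an idempotent that need not be the identity
matrix. -/
theorem lieMatrix_pow [Fintype Ω] [DecidableEq Ω] (n : ℕ) (B : Matrix Ω Ω R) (j : ℕ) :
    lieMatrix n (B ^ (j + 1)) = lieMatrix n B ^ (j + 1) := by
  induction j with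
  | zero => rw [zero_add, pow_one, pow_one]
  | succ j ih => rw [pow_succ, lieMatrix_mul, ih, pow_succ _ (j + 1)]

theorem trace_lieMatrix [Fintype Ω] [DecidableEq Ω] (n : ℕ) (B : Matrix Ω Ω R) :
    (lieMatrix n B).trace =
      MvPolynomial.aeval (fun k : ℕ+ => (B ^ (k : ℕ)).trace) (lieTwoPartial n) := by
  rw [lieMatrix, Matrix.trace_blockDiagonal', lieTwoPartial, map_sum]
  refine Finset.sum_congr rfl fun k _ => ?_
  rw [trace_symmetrizedPower, lieTwoRep, frobeniusChar_ind]
  simp_rw [character_linearCharRep]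

theorem map_lieMatrix (n : ℕ) (B : Matrix Ω Ω R) (F : R →ₐ[ℂ] S) :
    lieMatrix n (B.map F) = (lieMatrix n B).map F := by
  simp_rw [lieMatrix, map_symmetrizedPower]
  exact (Matrix.blockDiagonal'_map _ _ (map_zero F)).symm

theorem lieMatrix_diagonal_mul [Fintype Ω] [DecidableEq Ω] (n : ℕ) (d : Ω → R) (B : Matrix Ω Ω R) :
    lieMatrix n (Matrix.diagonal d * B) =
      Matrix.diagonal (fun f => ∏ j, d (f.2 j)) * lieMatrix n B := by
  simp_rw [lieMatrix, symmetrizedPower_diagonal_mul, Matrix.blockDiagonal'_mul,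
    Matrix.blockDiagonal'_diagonal]

theorem lieMatrix_mul_diagonal [Fintype Ω] [DecidableEq Ω] (n : ℕ) (d : Ω → R) (B : Matrix Ω Ω R) :
    lieMatrix n (B * Matrix.diagonal d) =
      lieMatrix n B * Matrix.diagonal fun f => ∏ j, d (f.2 j) := by
  simp_rw [lieMatrix, symmetrizedPower_mul_diagonal, Matrix.blockDiagonal'_mul,
    Matrix.blockDiagonal'_diagonal]

theorem wordMatrix_mul [Fintype Ω] (n m : ℕ) (A B : Matrix Ω Ω R) :
    wordMatrix n m (A * B) = wordMatrix n m A * wordMatrix n m B := by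
  rw [wordMatrix, lieMatrix_mul, symmetrizedPower_mul, wordMatrix, wordMatrix]

theorem map_wordMatrix (n m : ℕ) (B : Matrix Ω Ω R) (F : R →ₐ[ℂ] S) :
    wordMatrix n m (B.map F) = (wordMatrix n m B).map F := by
  rw [wordMatrix, map_lieMatrix, map_symmetrizedPower, wordMatrix]

theorem wordMatrix_diagonal_mul [Fintype Ω] [DecidableEq Ω] (n m : ℕ) (d : Ω → R)
    (B : Matrix Ω Ω R) :
    wordMatrix n m (Matrix.diagonal d * B) =
      Matrix.diagonal (wordWeight d) * wordMatrix n m B := by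
  rw [wordMatrix, lieMatrix_diagonal_mul, symmetrizedPower_diagonal_mul, wordMatrix]
  rfl

theorem wordMatrix_mul_diagonal [Fintype Ω] [DecidableEq Ω] (n m : ℕ) (d : Ω → R)
    (B : Matrix Ω Ω R) :
    wordMatrix n m (B * Matrix.diagonal d) =
      wordMatrix n m B * Matrix.diagonal (wordWeight d) := by
  rw [wordMatrix, lieMatrix_mul_diagonal, symmetrizedPower_mul_diagonal, wordMatrix]
  rfl

/-- The plethysm `h_m[∑_{1 ≤ k ≤ n} Lie^{(2)}_k]`. -/
def homogLiePartial (n m : ℕ) : SymmFun :=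
  MvPolynomial.aeval (fun j : ℕ+ => MvPolynomial.rename (fun i : ℕ+ => j * i) (lieTwoPartial n))
    (completeHomog m)

/-- Composition of functors is plethysm: the j-th power of `lieMatrix n B` is `lieMatrix n (B ^ j)`,
and its trace replaces each p_i by p_{ji}. -/
theorem trace_wordMatrix [Fintype Ω] [DecidableEq Ω] (n m : ℕ) (B : Matrix Ω Ω R) :
    (wordMatrix n m B).trace =
      MvPolynomial.aeval (fun k : ℕ+ => (B ^ (k : ℕ)).trace) (homogLiePartial n m) := by
  have h : ((Fintype.card (Perm (Fin m)) : ℂ)⁻¹ • ∑ h : Perm (Fin m), (1 : Perm (Fin m) →* ℂ) h •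
      cycleMonomial (MonoidHom.id (Perm (Fin m)) h)) = completeHomog m := by
    rw [completeHomog_eq_charSum, charSum, Fintype.card_perm, Fintype.card_fin]
    rfl
  rw [wordMatrix, trace_symmetrizedPower, h, homogLiePartial, MvPolynomial.comp_aeval_apply]
  congr 2
  funext j
  obtain ⟨i, hi⟩ : ∃ i : ℕ, (j : ℕ) = i + 1 := ⟨j - 1, by have := j.pos; omega⟩
  rw [hi, ← lieMatrix_pow, ← hi, trace_lieMatrix, MvPolynomial.aeval_rename]
  congr 2
  funext k
  rw [Function.comp_apply, PNat.mul_coe, pow_mul]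

end WordMatrix

/-! ### Only Lie_1^(2), …, Lie_n^(2) matter in degree n -/

section Truncation

theorem lieTwoSeries_sub_mem (n : ℕ) :
    lieTwoSeries - (lieTwoPartial n : SymmSeries) ∈ degreeIdeal (n + 1) := by
  intro w hw
  rw [map_sub, sub_eq_zero, MvPolynomial.coeff_coe, lieTwoPartial, MvPolynomial.coeff_sum]
  rcases Nat.eq_zero_or_pos (psDegree w) with h0 | h0
  · rw [Finset.sum_eq_zero]
    · exact lieTwoSeries_mem w (by omega)
    · exact fun k _ => coeff_frobeniusChar_eq_zero _ (by omega)
  · obtain ⟨k, hk⟩ : ∃ k, psDegree w = k + 1 := ⟨psDegree w - 1, by omega⟩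
    rw [coeff_lieTwoSeries k.succPNat hk, Finset.sum_eq_single (⟨k, by omega⟩ : Fin n)]
    · rfl
    · intro i _ hi
      refine coeff_frobeniusChar_eq_zero _ fun h => hi (Fin.ext ?_)
      dsimp only
      omega
    · simp

/-- In the quotient by the ideal, plethysm is evaluation at the classes of the p_j[g], and p_j does
not lower degrees. -/
theorem plethysm_sub_mem {k : ℕ} {g g' : SymmSeries} (h : g - g' ∈ degreeIdeal k) (f : SymmFun) :
    plethysm f g - plethysm f g' ∈ degreeIdeal k := by
  rw [← Ideal.Quotient.eq]
  change Ideal.Quotient.mkₐ ℂ (degreeIdeal k) _ = Ideal.Quotient.mkₐ ℂ (degreeIdeal k) _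
  rw [plethysm, plethysm, MvPolynomial.comp_aeval_apply, MvPolynomial.comp_aeval_apply]
  congr 2
  funext j
  refine Ideal.Quotient.eq.mpr ?_
  rw [← map_sub]
  exact degreeIdeal_mono (Nat.le_mul_of_pos_left _ j.pos) (adams_mem j h)

theorem coe_homogLiePartial (n m : ℕ) :
    (homogLiePartial n m : SymmSeries) = plethysm (completeHomog m) (lieTwoPartial n) := by
  have h : ∀ p : SymmFun, (p : SymmSeries) = MvPolynomial.coeToMvPowerSeries.algHom ℂ p := fun p => by
    rw [MvPolynomial.coeToMvPowerSeries.algHom_apply, Algebra.algebraMap_self, MvPowerSeries.map_id]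
    rfl
  rw [h, homogLiePartial, MvPolynomial.comp_aeval_apply, plethysm]
  congr 2
  funext j
  rw [adams, MvPowerSeries.rename_coe, ← h]

theorem degreeTerm_plethysm (n m : ℕ) :
    degreeTerm n (plethysm (completeHomog m) lieTwoSeries) =
      degreeTerm n (homogLiePartial n m : SymmSeries) := by
  funext w
  refine if_ctx_congr Iff.rfl (fun hw => ?_) fun _ => rfl
  have := plethysm_sub_mem (lieTwoSeries_sub_mem n) (completeHomog m) w
    (hw.trans_lt (Nat.lt_succ_self n))
  rw [map_sub, sub_eq_zero] at this
  rw [this, coe_homogLiePartial]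

end Truncation

/-! ### Existence of the modules `Vh_r(n)` -/

section Multilinear

variable {R : Type*} [CommRing R]

/-- The matrix of a permutation. -/
def permMat (R : Type*) [CommRing R] {n : ℕ} (σ : Perm (Fin n)) : Matrix (Fin n) (Fin n) R :=
  Matrix.of fun a b => if a = σ b then 1 else 0

theorem permMat_mul {n : ℕ} (σ τ : Perm (Fin n)) :
    permMat R (σ * τ) = permMat R σ * permMat R τ := by
  ext a b
  simp [permMat, Matrix.mul_apply]
  rfl

theorem map_permMat [Algebra ℂ R] {n : ℕ} (σ : Perm (Fin n)) :
    (permMat ℂ σ).map (Algebra.ofId ℂ R) = permMat R σ := by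
  ext a b
  rw [Matrix.map_apply, permMat, permMat, Matrix.of_apply, Matrix.of_apply]
  split_ifs
  · exact map_one _
  · exact map_zero _

theorem diagonal_mul_permMat {n : ℕ} (d : Fin n → R) (σ : Perm (Fin n)) :
    Matrix.diagonal d * permMat R σ = permMat R σ * Matrix.diagonal (d ∘ σ) := by
  ext a b
  rw [Matrix.diagonal_mul, Matrix.mul_diagonal, permMat, Matrix.of_apply]
  split_ifs with h
  · rw [h, mul_one, one_mul, Function.comp_apply]
  · rw [mul_zero, zero_mul]

/-- The exponent vector of `t_1 ⋯ t_n`. -/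
def allOnes (n : ℕ) : Fin n →₀ ℕ := Finsupp.equivFunOnFinite.symm fun _ => 1

theorem exists_cycleMonomial_eq (w : ℕ+ →₀ ℕ) :
    ∃ π : Perm (Fin (psDegree w)), cycleMonomial π = MvPolynomial.monomial w 1 := by
  obtain ⟨ν, hν⟩ : ∃ ν : (Fintype.card (Fin (psDegree w))).Partition, partExp ν = w :=
    exists_partExp_eq (Fintype.card_fin _).symm
  have h := card_partition_eq ν
  have hne : (Finset.univ.filter fun σ : Perm (Fin (psDegree w)) => σ.partition = ν).Nonempty := by
    rw [Finset.nonempty_iff_ne_empty]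
    intro h0
    rw [h0, Finset.card_empty, zero_mul] at h
    exact Nat.factorial_ne_zero _ h.symm
  obtain ⟨π, hπ⟩ := hne
  refine ⟨π, ?_⟩
  rw [cycleMonomial, (Finset.mem_filter.mp hπ).2, powerSumPart_eq_monomial, hν]

theorem prod_X_eq_monomial {n : ℕ} {ι : Type*} [Fintype ι] (f : ι → Fin n) :
    ∏ i, (MvPolynomial.X (f i) : MvPolynomial (Fin n) ℂ) =
      MvPolynomial.monomial (∑ i, Finsupp.single (f i) 1) 1 := by
  rw [MvPolynomial.monomial_sum_one]
  rfl

theorem sum_single_eq_allOnes_iff {n N : ℕ} (f : Fin N → Fin n) :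
    ∑ i, Finsupp.single (f i) 1 = allOnes n ↔ Function.Bijective f := by
  have h1 : ∀ a, (∑ i, Finsupp.single (f i) 1 : Fin n →₀ ℕ) a =
      (Finset.univ.filter fun i => f i = a).card := fun a => by
    rw [Finsupp.finsetSum_apply, Finset.card_filter]
    exact Finset.sum_congr rfl fun i _ => Finsupp.single_apply
  rw [Function.bijective_iff_existsUnique, Finsupp.ext_iff]
  refine forall_congr' fun a => ?_
  rw [h1]
  change _ = 1 ↔ _
  rw [Finset.card_eq_one]
  simp [Finset.eq_singleton_iff_unique_mem, ExistsUnique]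

/-- Expanding the trace over f, the coefficient of t_1⋯t_n keeps the f that use each letter once.
The permutation matrix imposes f = σ ∘ f ∘ π, so f conjugates π⁻¹ into σ. -/
theorem coeff_trace_cycleMonomial {n N : ℕ} (σ : Perm (Fin n)) (π : Perm (Fin N)) :
    MvPolynomial.coeff (allOnes n) (MvPolynomial.aeval (fun k : ℕ+ =>
      ((Matrix.diagonal MvPolynomial.X * permMat (MvPolynomial (Fin n) ℂ) σ) ^ (k : ℕ)).trace)
        (cycleMonomial π)) =
      open Classical in ((Finset.univ.filter fun f : Fin N → Fin n =>
        Function.Bijective f ∧ ∀ i, f i = σ (f (π i))).card : ℂ) := by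
  classical
  rw [← twistedTrace_eq, twistedTrace, MvPolynomial.coeff_sum, Finset.card_filter, Nat.cast_sum]
  refine Finset.sum_congr rfl fun f _ => ?_
  simp_rw [Matrix.diagonal_mul, permMat, Matrix.of_apply, Finset.prod_mul_distrib,
    prod_X_eq_monomial, Finset.prod_ite_zero, Finset.prod_const_one, mul_ite, mul_one, mul_zero]
  rw [apply_ite (MvPolynomial.coeff (allOnes n)), MvPolynomial.coeff_monomial, MvPolynomial.coeff_zero,
    ← ite_and, Nat.cast_ite, Nat.cast_one, Nat.cast_zero]
  exact if_congr (by rw [sum_single_eq_allOnes_iff]; simp [and_comm]) rfl rfl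

/-- Taking the multilinear part turns a symmetric function into a class function on S_n whose
characteristic is its degree n term. By linearity G is the cycle monomial of some π. In degree n the
n! bijections each contribute one conjugate of π⁻¹; in other degrees there are no bijections. -/
theorem coeff_charSum_trace {n : ℕ} (G : SymmFun) (w : ℕ+ →₀ ℕ) :
    MvPolynomial.coeff w (charSum fun σ : Perm (Fin n) =>
      MvPolynomial.coeff (allOnes n) (MvPolynomial.aeval (fun k : ℕ+ =>
      ((Matrix.diagonal MvPolynomial.X * permMat (MvPolynomial (Fin n) ℂ) σ) ^ (k : ℕ)).trace) G)) =
      if psDegree w = n then MvPolynomial.coeff w G else 0 := by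
  classical
  induction G using MvPolynomial.induction_on' with
  | add p q hp hq =>
    simp_rw [map_add, MvPolynomial.coeff_add]
    refine (congrArg _ (charSum_add _ _)).trans ?_
    rw [MvPolynomial.coeff_add, hp, hq]
    split_ifs <;> simp
  | monomial v a =>
    have hv : (MvPolynomial.monomial v a : SymmFun) = a • MvPolynomial.monomial v 1 := by
      rw [MvPolynomial.smul_monomial, smul_eq_mul, mul_one]
    obtain ⟨π, hπ⟩ := exists_cycleMonomial_eq v
    have hsmul : ∀ φ : Perm (Fin n) → ℂ, charSum (fun σ => a * φ σ) = a • charSum φ := fun φ => by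
      simp_rw [charSum, mul_smul, ← Finset.smul_sum]
      rw [smul_comm]
    rw [hv]
    simp_rw [map_smul, MvPolynomial.coeff_smul, smul_eq_mul]
    rw [hsmul, MvPolynomial.coeff_smul, smul_eq_mul, ← mul_ite_zero]
    have hite : (if psDegree w = n then MvPolynomial.coeff w (MvPolynomial.monomial v (1 : ℂ)) else 0) =
        if psDegree v = n then MvPolynomial.coeff w (MvPolynomial.monomial v (1 : ℂ)) else 0 := by
      rw [MvPolynomial.coeff_monomial]
      rcases eq_or_ne v w with rfl | h
      · rfl
      · simp [h]
    rw [hite]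
    congr 1
    simp_rw [← hπ, coeff_trace_cycleMonomial]
    split_ifs with hn
    · subst hn
      have hcard : ∀ σ : Perm (Fin (psDegree v)),
          ((Finset.univ.filter fun f : Fin (psDegree v) → Fin (psDegree v) =>
            Function.Bijective f ∧ ∀ i, f i = σ (f (π i))).card : ℂ) =
          ∑ e : Perm (Fin (psDegree v)), if e * π⁻¹ * e⁻¹ = σ then 1 else 0 := by
        intro σ
        rw [← Nat.cast_one, ← Nat.cast_zero]
        simp_rw [← Nat.cast_ite]
        rw [← Nat.cast_sum, ← Finset.card_filter]
        congr 1
        symm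
        have hiff : ∀ e : Perm (Fin (psDegree v)),
            e * π⁻¹ * e⁻¹ = σ ↔ ∀ i, e i = σ (e (π i)) := by
          intro e
          rw [mul_inv_eq_iff_eq_mul, mul_inv_eq_iff_eq_mul, Equiv.ext_iff]
          rfl
        refine Finset.card_bij (fun e _ => e) ?_ (fun a _ b _ h => Equiv.coe_fn_injective h) ?_
        · intro e he
          rw [Finset.mem_filter] at he ⊢
          exact ⟨Finset.mem_univ _, e.bijective, (hiff e).mp he.2⟩
        · intro f hf
          rw [Finset.mem_filter] at hf
          exact ⟨Equiv.ofBijective f hf.2.1, Finset.mem_filter.mpr ⟨Finset.mem_univ _,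
            (hiff _).mpr hf.2.2⟩, rfl⟩
      have hconj : ∀ e : Perm (Fin (psDegree v)), cycleMonomial (e * π⁻¹ * e⁻¹) = cycleMonomial π :=
        fun e => cycleMonomial_of_isConj ((isConj_iff.mpr ⟨e, rfl⟩ : IsConj π⁻¹ _).symm.trans
          (Perm.isConj_iff_cycleType_eq.mpr (Perm.cycleType_inv π)))
      simp_rw [hcard, charSum, Finset.sum_smul, ite_smul, one_smul, zero_smul]
      rw [Finset.sum_comm]
      simp_rw [Finset.sum_ite_eq, Finset.mem_univ, if_true, hconj]
      rw [Finset.sum_const, Finset.card_univ, Fintype.card_perm, Fintype.card_fin,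
        ← Nat.cast_smul_eq_nsmul ℂ, smul_smul, inv_mul_cancel₀, one_smul]
      exact_mod_cast Nat.factorial_ne_zero _
    · have hempty : ∀ σ : Perm (Fin n), (Finset.univ.filter fun f : Fin (psDegree v) → Fin n =>
          Function.Bijective f ∧ ∀ i, f i = σ (f (π i))) = ∅ := fun σ =>
        Finset.filter_eq_empty_iff.mpr fun f _ h => hn (by
          simpa using Fintype.card_of_bijective h.1)
      simp_rw [hempty]
      simp [charSum]

end Multilinear

section MatrixRepresentation

/-- A multiplicative family of matrices acts on the range of the idempotent `N 1`. -/
def matrixRep {G J : Type*} [Group G] [Fintype J] [DecidableEq J] (N : G → Matrix J J ℂ)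
    (hN : ∀ g h, N (g * h) = N g * N h) :
    Representation ℂ G (LinearMap.range (Matrix.toLin' (N 1))) where
  toFun g := (Matrix.toLin' (N g)).restrict (p := LinearMap.range (Matrix.toLin' (N 1)))
    (q := LinearMap.range (Matrix.toLin' (N 1))) fun x _ =>
      ⟨Matrix.toLin' (N g) x, by rw [← LinearMap.comp_apply, ← Matrix.toLin'_mul, ← hN, one_mul]⟩
  map_one' := by
    refine LinearMap.ext ?_
    rintro ⟨-, x, rfl⟩
    refine Subtype.ext ?_
    change Matrix.toLin' (N 1) (Matrix.toLin' (N 1) x) = Matrix.toLin' (N 1) x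
    rw [← LinearMap.comp_apply, ← Matrix.toLin'_mul, ← hN, one_mul]
  map_mul' g h := by
    refine LinearMap.ext fun x => Subtype.ext ?_
    change Matrix.toLin' (N (g * h)) x = Matrix.toLin' (N g) (Matrix.toLin' (N h) x)
    rw [hN, Matrix.toLin'_mul, LinearMap.comp_apply]

/-- Since N g = N 1 · N g, the image of N g lies in the range of N 1, and restricting to that range
does not change the trace. -/
theorem character_matrixRep {G J : Type*} [Group G] [Fintype J] [DecidableEq J]
    (N : G → Matrix J J ℂ) (hN : ∀ g h, N (g * h) = N g * N h) (g : G) :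
    (matrixRep N hN).character g = (N g).trace := by
  rw [← Matrix.trace_toLin'_eq]
  exact LinearMap.trace_restrict_eq_of_forall_mem (LinearMap.range (Matrix.toLin' (N 1))) _ fun x =>
    ⟨Matrix.toLin' (N g) x, by rw [← LinearMap.comp_apply, ← Matrix.toLin'_mul, ← hN, one_mul]⟩

end MatrixRepresentation

section MultilinearWords

/-- Words over `Fin n` in which every letter occurs once. -/
def IsMultilinear {n m : ℕ} (f : Fin m → Σ k : Fin n, (Fin ((k : ℕ) + 1) → Fin n)) : Prop :=
  wordWeight (R := MvPolynomial (Fin n) ℂ) MvPolynomial.X f = ∏ a, MvPolynomial.X a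

theorem exists_wordWeight_eq_monomial {n m : ℕ}
    (f : Fin m → Σ k : Fin n, (Fin ((k : ℕ) + 1) → Fin n)) :
    ∃ w, wordWeight (R := MvPolynomial (Fin n) ℂ) MvPolynomial.X f = MvPolynomial.monomial w 1 :=
  ⟨∑ i, ∑ j, Finsupp.single ((f i).2 j) 1, by
    simp_rw [wordWeight, prod_X_eq_monomial, MvPolynomial.monomial_sum_one]⟩

theorem prod_X_univ (n : ℕ) : ∏ a, (MvPolynomial.X a : MvPolynomial (Fin n) ℂ) =
    MvPolynomial.monomial (allOnes n) 1 := by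
  rw [prod_X_eq_monomial, (sum_single_eq_allOnes_iff fun a => a).mpr Function.bijective_id]

theorem coeff_wordWeight {n m : ℕ} (f : Fin m → Σ k : Fin n, (Fin ((k : ℕ) + 1) → Fin n)) :
    MvPolynomial.coeff (allOnes n) (wordWeight (R := MvPolynomial (Fin n) ℂ) MvPolynomial.X f) =
      open Classical in if IsMultilinear f then 1 else 0 := by
  classical
  obtain ⟨w, hw⟩ := exists_wordWeight_eq_monomial f
  have h : IsMultilinear f ↔ w = allOnes n := by
    rw [IsMultilinear, prod_X_univ, hw]
    exact MvPolynomial.monomial_left_inj one_ne_zero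
  rw [hw, MvPolynomial.coeff_monomial]
  exact if_congr h.symm rfl rfl

/-- Moving the diagonal matrix of variables past a permutation matrix renames the variables by σ. At
a nonzero entry the content of f is thus the renamed content of g, and the product of all variables
is invariant under renaming. -/
theorem isMultilinear_iff_of_wordMatrix_ne_zero {n m : ℕ} (σ : Perm (Fin n))
    {f g : Fin m → Σ k : Fin n, (Fin ((k : ℕ) + 1) → Fin n)}
    (h : wordMatrix n m (permMat ℂ σ) f g ≠ 0) : IsMultilinear f ↔ IsMultilinear g := by
  have h1 := congrArg (fun M => M f g) ((wordMatrix_diagonal_mul n m MvPolynomial.X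
    (permMat (MvPolynomial (Fin n) ℂ) σ)).symm.trans ((congrArg (wordMatrix n m)
      (diagonal_mul_permMat MvPolynomial.X σ)).trans (wordMatrix_mul_diagonal n m _ _)))
  simp only [Matrix.diagonal_mul, Matrix.mul_diagonal] at h1
  have h2 : wordMatrix n m (permMat (MvPolynomial (Fin n) ℂ) σ) f g ≠ 0 := by
    rw [← map_permMat, map_wordMatrix, Matrix.map_apply]
    exact (map_ne_zero_iff _ (MvPolynomial.C_injective (Fin n) ℂ)).mpr h
  rw [mul_comm, mul_right_inj' h2] at h1
  have h3 : ∀ τ : Perm (Fin n), MvPolynomial.rename τ (∏ a, (MvPolynomial.X a : MvPolynomial (Fin n) ℂ)) =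
      ∏ a, MvPolynomial.X a := fun τ => by
    simp_rw [map_prod, MvPolynomial.rename_X]
    exact Equiv.prod_comp τ fun a => (MvPolynomial.X a : MvPolynomial (Fin n) ℂ)
  have h4 : wordWeight (MvPolynomial.X ∘ σ) g = MvPolynomial.rename σ
      (wordWeight (R := MvPolynomial (Fin n) ℂ) MvPolynomial.X g) := by
    simp_rw [wordWeight, map_prod, MvPolynomial.rename_X]
    rfl
  rw [IsMultilinear, IsMultilinear, h1, h4]
  constructor
  · intro h
    rw [← h3 σ] at h
    exact MvPolynomial.rename_injective _ σ.injective h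
  · intro h
    rw [h, h3]

/-- The action of `S_n` on multilinear words. -/
def multilinearMatrix (n m : ℕ) (σ : Perm (Fin n)) : Matrix
    (ULift.{u} {f : Fin m → Σ k : Fin n, (Fin ((k : ℕ) + 1) → Fin n) // IsMultilinear f})
    (ULift.{u} {f : Fin m → Σ k : Fin n, (Fin ((k : ℕ) + 1) → Fin n) // IsMultilinear f}) ℂ :=
  Matrix.of fun f g => wordMatrix n m (permMat ℂ σ) f.down g.down

-- In the product of full word matrices, the terms passing through a non-multilinear word vanish, so
-- the multilinear words form an invariant block.
open Classical in
theorem multilinearMatrix_mul (n m : ℕ) (σ τ : Perm (Fin n)) :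
    multilinearMatrix.{u} n m (σ * τ) =
      multilinearMatrix.{u} n m σ * multilinearMatrix.{u} n m τ := by
  ext f g
  rw [Matrix.mul_apply, multilinearMatrix, Matrix.of_apply, permMat_mul, wordMatrix_mul,
    Matrix.mul_apply, ← Equiv.sum_comp Equiv.ulift.symm]
  symm
  refine (Finset.sum_subtype (Finset.univ.filter IsMultilinear) (by simp) fun e =>
    wordMatrix n m (permMat ℂ σ) f.down e * wordMatrix n m (permMat ℂ τ) e g.down).symm.trans ?_
  refine Finset.sum_filter_of_ne fun e _ he => ?_
  exact (isMultilinear_iff_of_wordMatrix_ne_zero σ (left_ne_zero_of_mul he)).mp f.down.2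

-- Multiplying by the diagonal matrix of variables weights each diagonal entry by the content of its
-- word. The coefficient of x_1⋯x_n therefore selects the multilinear words.
open Classical in
theorem trace_multilinearMatrix (n m : ℕ) (σ : Perm (Fin n)) :
    (multilinearMatrix.{u} n m σ).trace =
      MvPolynomial.coeff (allOnes n) (MvPolynomial.aeval (fun k : ℕ+ =>
      ((Matrix.diagonal MvPolynomial.X * permMat (MvPolynomial (Fin n) ℂ) σ) ^ (k : ℕ)).trace)
        (homogLiePartial n m)) := by
  rw [← trace_wordMatrix, wordMatrix_diagonal_mul, Matrix.trace, Matrix.trace,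
    MvPolynomial.coeff_sum, ← Equiv.sum_comp Equiv.ulift.symm]
  refine (Finset.sum_subtype (Finset.univ.filter IsMultilinear) (by simp) fun e =>
    wordMatrix n m (permMat ℂ σ) e e).symm.trans ?_
  rw [Finset.sum_filter]
  refine Finset.sum_congr rfl fun f _ => ?_
  have h : wordMatrix n m (permMat (MvPolynomial (Fin n) ℂ) σ) f f =
      MvPolynomial.C (wordMatrix n m (permMat ℂ σ) f f) := by
    rw [← map_permMat, map_wordMatrix, Matrix.map_apply]
    rfl
  rw [Matrix.diag_apply, Matrix.diagonal_mul, h, mul_comm, MvPolynomial.coeff_C_mul,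
    coeff_wordWeight, mul_ite, mul_one, mul_zero]

-- For m = n - r the module is the range of the idempotent by which the identity of S_n acts on
-- multilinear words. The functor satisfies F(AB) = F(A)F(B), and this gives the group action on the
-- range.
open Classical in
theorem exists_isVhFamily (n : ℕ) :
    ∃ (W : Fin (n + 1) → Type u) (_ : ∀ r, AddCommGroup (W r)) (_ : ∀ r, Module ℂ (W r))
      (ρ : ∀ r, Representation ℂ (Equiv.Perm (Fin n)) (W r)), IsVhFamily ρ := by
  refine ⟨_, _, _, fun r : Fin (n + 1) => matrixRep (multilinearMatrix.{u} n (n - (r : ℕ)))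
    (multilinearMatrix_mul n (n - r)), fun r => ⟨inferInstance, ?_⟩⟩
  ext w
  rw [MvPolynomial.coeff_coe, frobeniusChar_eq_charSum, vhChar, degreeTerm_plethysm]
  simp_rw [funext (character_matrixRep _ _), trace_multilinearMatrix]
  rw [coeff_charSum_trace]
  change _ = if psDegree w = n then _ else _
  rw [MvPolynomial.coeff_coe]

end MultilinearWords

/-! ### Symmetric polynomials and alternants -/

section SymmEval

/-- The symmetric polynomial in `N` variables given by a symmetric function. -/
def symmEval (N : ℕ) : SymmFun →ₐ[ℂ] MvPolynomial (Fin N) ℂ :=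
  MvPolynomial.aeval fun k : ℕ+ => ∑ i, MvPolynomial.X i ^ (k : ℕ)

/-- A function on `Fin N`, as an exponent vector. -/
def expVec {N : ℕ} (l : Fin N → ℕ) : Fin N →₀ ℕ := Finsupp.equivFunOnFinite.symm l

theorem expVec_injective {N : ℕ} : Function.Injective (expVec : (Fin N → ℕ) → Fin N →₀ ℕ) :=
  Finsupp.equivFunOnFinite.symm.injective

theorem prod_X_pow_eq_monomial {N : ℕ} {R : Type*} [CommSemiring R] (l : Fin N → ℕ) :
    ∏ i, (MvPolynomial.X i : MvPolynomial (Fin N) R) ^ l i = MvPolynomial.monomial (expVec l) 1 := by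
  rw [MvPolynomial.monomial_eq, map_one, one_mul, Finsupp.prod_fintype _ _ fun _ => pow_zero _]
  rfl

/-- On the product alphabet p_k becomes p_k(y)·p_k(x), so monomials in power sums split. Averaging
over S_n gives the power sum expansion of the Cauchy kernel. -/
theorem cauchy_cycleMonomial {n N : ℕ} (σ : Perm (Fin n)) :
    MvPolynomial.aeval (fun k : ℕ+ => MvPolynomial.C (MvPolynomial.X k : SymmFun) *
      ∑ i : Fin N, (MvPolynomial.X i : MvPolynomial (Fin N) SymmFun) ^ (k : ℕ)) (cycleMonomial σ) =
      MvPolynomial.C (cycleMonomial σ) *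
        MvPolynomial.map (algebraMap ℂ SymmFun) (symmEval N (cycleMonomial σ)) := by
  rw [cycleMonomial, powerSumPart_eq_monomial, symmEval, MvPolynomial.aeval_monomial,
    MvPolynomial.aeval_monomial, (algebraMap ℂ _).map_one, (algebraMap ℂ _).map_one, one_mul, one_mul]
  simp_rw [mul_pow]
  rw [Finsupp.prod_mul]
  congr 1
  · rw [MvPolynomial.monomial_eq, map_one, one_mul, Finsupp.prod, Finsupp.prod, map_prod]
    simp_rw [map_pow]
  · rw [Finsupp.prod, Finsupp.prod, map_prod]
    simp

/-- The other expansion of the Cauchy kernel: the variables x_i enter additively in the power sums,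
so the generating function is a product over i of Σ_m h_m x_i^m. -/
theorem coeff_cauchy_completeHomog {n N : ℕ} (α : Fin N →₀ ℕ) :
    MvPolynomial.coeff α (MvPolynomial.aeval (fun k : ℕ+ => MvPolynomial.C (MvPolynomial.X k : SymmFun) *
      ∑ i : Fin N, (MvPolynomial.X i : MvPolynomial (Fin N) SymmFun) ^ (k : ℕ)) (completeHomog n)) =
      if ∑ i, α i = n then ∏ i, completeHomog (α i) else 0 := by
  have hsum : (fun k : ℕ+ => MvPolynomial.C (MvPolynomial.X k : SymmFun) *
      ∑ i : Fin N, (MvPolynomial.X i : MvPolynomial (Fin N) SymmFun) ^ (k : ℕ)) =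
      ∑ i : Fin N, fun k : ℕ+ => MvPolynomial.C (MvPolynomial.X k : SymmFun) *
        (MvPolynomial.X i : MvPolynomial (Fin N) SymmFun) ^ (k : ℕ) := by
    funext k
    rw [Finset.sum_apply, Finset.mul_sum]
  have hC : IsNewtonSeq (fun k : ℕ+ => (MvPolynomial.C (MvPolynomial.X k) : MvPolynomial (Fin N) SymmFun))
      fun m => MvPolynomial.C (completeHomog m) := by
    have h := isNewtonSeq_aeval
      (fun k : ℕ+ => (MvPolynomial.C (MvPolynomial.X k) : MvPolynomial (Fin N) SymmFun))
    convert h using 2 with m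
    have := MvPolynomial.comp_aeval_apply (MvPolynomial.X : ℕ+ → SymmFun)
      (Algebra.algHom ℂ SymmFun (MvPolynomial (Fin N) SymmFun)) (completeHomog m)
    rw [MvPolynomial.aeval_X_left_apply] at this
    exact this
  rw [hsum, aeval_completeHomog_sum Finset.univ _
    (fun i m => MvPolynomial.C (completeHomog m) * MvPolynomial.X i ^ m)
    fun i _ => isNewtonSeq_mul_pow _ _ hC _, PowerSeries.coeff_prod, MvPolynomial.coeff_sum]
  have hterm : ∀ l : Fin N →₀ ℕ, MvPolynomial.coeff α (∏ i, PowerSeries.coeff (l i)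
      (PowerSeries.mk fun m => (MvPolynomial.C (completeHomog m) * MvPolynomial.X i ^ m :
        MvPolynomial (Fin N) SymmFun))) = if l = α then ∏ i, completeHomog (l i) else 0 := by
    intro l
    simp_rw [PowerSeries.coeff_mk]
    rw [Finset.prod_mul_distrib, prod_X_pow_eq_monomial, ← map_prod, MvPolynomial.coeff_C_mul,
      MvPolynomial.coeff_monomial, mul_ite, mul_one, mul_zero,
      show expVec l = l from Finsupp.equivFunOnFinite.symm_apply_apply l]
  simp_rw [hterm]
  rw [Finset.sum_ite_eq']
  refine if_congr ?_ rfl rfl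
  rw [Finset.mem_finsuppAntidiag]
  simp

/-- The two expansions of the Cauchy kernel are compared at x^α. -/
theorem charSum_coeff_symmEval {n N : ℕ} (α : Fin N →₀ ℕ) :
    charSum (fun σ : Perm (Fin n) => MvPolynomial.coeff α (symmEval N (cycleMonomial σ))) =
      if ∑ i, α i = n then ∏ i, completeHomog (α i) else 0 := by
  rw [← coeff_cauchy_completeHomog, completeHomog_eq_charSum, charSum, charSum, map_smul, map_sum,
    MvPolynomial.coeff_smul, MvPolynomial.coeff_sum]
  congr 1
  refine Finset.sum_congr rfl fun σ _ => ?_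
  rw [one_smul, cauchy_cycleMonomial, MvPolynomial.coeff_C_mul, MvPolynomial.coeff_map,
    Algebra.smul_def, mul_comm]

end SymmEval

section Alternant

variable {N : ℕ}

/-- The alternant `det (x_j ^ l_i)`. -/
def alternant (l : Fin N → ℕ) : MvPolynomial (Fin N) ℂ :=
  Matrix.det (Matrix.of fun i j => MvPolynomial.X j ^ l i)

theorem alternant_eq (l : Fin N → ℕ) : alternant l =
    ∑ w : Perm (Fin N), MvPolynomial.monomial (expVec (l ∘ w)) ((Perm.sign w : ℤ) : ℂ) := by
  rw [alternant, Matrix.det_apply]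
  refine Finset.sum_congr rfl fun w _ => ?_
  simp_rw [Matrix.of_apply]
  rw [prod_X_pow_eq_monomial fun i => l (w i), ← zsmul_one, Units.smul_def, ← map_zsmul]
  rfl

theorem coeff_mul_alternant (P : MvPolynomial (Fin N) ℂ) (l m : Fin N → ℕ) :
    MvPolynomial.coeff (expVec m) (P * alternant l) = ∑ w : Perm (Fin N), ((Perm.sign w : ℤ) : ℂ) *
      if ∀ i, l (w i) ≤ m i then MvPolynomial.coeff (expVec fun i => m i - l (w i)) P else 0 := by
  rw [alternant_eq, Finset.mul_sum, MvPolynomial.coeff_sum]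
  refine Finset.sum_congr rfl fun w _ => ?_
  rw [MvPolynomial.coeff_mul_monomial', mul_ite, mul_zero, mul_comm]
  have h : expVec m - expVec (l ∘ w) = expVec fun i => m i - l (w i) := by
    ext i
    rfl
  rw [h]
  exact if_congr Iff.rfl rfl rfl

theorem eq_one_of_strictMono {w : Perm (Fin N)} (hw : StrictMono w) : w = 1 :=
  Equiv.coe_fn_injective ((hw.range_inj strictMono_id).mp
    (w.surjective.range_eq.trans Set.range_id.symm))

theorem comp_perm_eq_iff {l m : Fin N → ℕ} (hl : StrictAnti l) (hm : StrictAnti m)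
    (w : Perm (Fin N)) : l ∘ w = m ↔ w = 1 ∧ l = m := by
  constructor
  · intro h
    have hw : w = 1 := eq_one_of_strictMono fun i j hij => by
      have := hm hij
      rw [← h] at this
      exact hl.lt_iff_gt.mp this
    subst hw
    exact ⟨rfl, h⟩
  · rintro ⟨rfl, rfl⟩
    rfl

theorem coeff_alternant {l m : Fin N → ℕ} (hl : StrictAnti l) (hm : StrictAnti m) :
    MvPolynomial.coeff (expVec m) (alternant l) = if l = m then 1 else 0 := by
  classical
  rw [alternant_eq, MvPolynomial.coeff_sum]
  simp_rw [MvPolynomial.coeff_monomial, expVec_injective.eq_iff, comp_perm_eq_iff hl hm]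
  rw [Finset.sum_eq_single 1]
  · simp
  · intro w _ hw
    simp [hw]
  · simp

end Alternant

/-! ### The Jacobi–Trudi determinant as a quotient of alternants -/

section JacobiTrudi

/-- The exponents `N - 1, …, 1, 0`. -/
def staircase (N : ℕ) (i : Fin N) : ℕ := N - 1 - i

theorem strictAnti_staircase (N : ℕ) : StrictAnti (staircase N) := fun i j h => by
  have : (i : ℕ) < j := h
  have := j.2
  simp only [staircase]
  omega

variable {N : ℕ}

/-- The matrix `h_{l_i - δ_j}`. -/
def homogMatrix (l : Fin N → ℕ) : Matrix (Fin N) (Fin N) SymmFun :=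
  Matrix.of fun i j => completeHomogInt ((l i : ℤ) - staircase N j)

theorem mk_symmEval_completeHomog : (PowerSeries.mk fun m => symmEval N (completeHomog m)) =
    ∏ i, PowerSeries.mk fun m => (MvPolynomial.X i : MvPolynomial (Fin N) ℂ) ^ m := by
  have hsum : (fun k : ℕ+ => ∑ i : Fin N, (MvPolynomial.X i : MvPolynomial (Fin N) ℂ) ^ (k : ℕ)) =
      ∑ i : Fin N, fun k : ℕ+ => (MvPolynomial.X i : MvPolynomial (Fin N) ℂ) ^ (k : ℕ) := by
    funext k
    rw [Finset.sum_apply]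
  ext1 m
  rw [PowerSeries.coeff_mk, symmEval, hsum]
  refine aeval_completeHomog_sum _ _ (fun i m => MvPolynomial.X i ^ m) (fun i _ => ?_) m
  simpa using isNewtonSeq_mul_pow (R := MvPolynomial (Fin N) ℂ) _ _ isNewtonSeq_one (MvPolynomial.X i)

theorem mk_pow_mul_one_sub {R : Type*} [CommRing R] (y : R) :
    (PowerSeries.mk fun m => y ^ m) * (1 - PowerSeries.C y * PowerSeries.X) = 1 := by
  ext m
  rcases m with _ | m
  · simp
  · rw [mul_sub, mul_one, map_sub, mul_left_comm, PowerSeries.coeff_C_mul,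
      PowerSeries.coeff_succ_mul_X, PowerSeries.coeff_mk, PowerSeries.coeff_mk, pow_succ',
      sub_self, PowerSeries.coeff_one, if_neg m.succ_ne_zero]

/-- `∏_{i ≠ k} (1 - x_i t)`. -/
def complementPoly (k : Fin N) : Polynomial (MvPolynomial (Fin N) ℂ) :=
  ∏ i ∈ Finset.univ.erase k, (1 - Polynomial.C (MvPolynomial.X i) * Polynomial.X)

theorem coeff_complementPoly {k : Fin N} {r : ℕ} (hr : N ≤ r) : (complementPoly k).coeff r = 0 := by
  refine Polynomial.coeff_eq_zero_of_natDegree_lt ?_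
  have h1 : (complementPoly k).natDegree ≤ ∑ i ∈ Finset.univ.erase k, 1 :=
    (Polynomial.natDegree_prod_le _ _).trans (Finset.sum_le_sum fun i _ =>
      (Polynomial.natDegree_sub_le _ _).trans (max_le (by simp)
        ((Polynomial.natDegree_C_mul_le _ _).trans Polynomial.natDegree_X_le)))
  rw [Finset.sum_const, Finset.card_erase_of_mem (Finset.mem_univ k), Finset.card_univ,
    Fintype.card_fin, smul_eq_mul, mul_one] at h1
  have := k.2
  omega

/-- In ∏ 1/(1 - x_i t) every factor except the one with i = k is cancelled. -/
theorem mk_symmEval_mul_complementPoly (k : Fin N) :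
    (PowerSeries.mk fun m => symmEval N (completeHomog m)) * (complementPoly k : PowerSeries _) =
      PowerSeries.mk fun m => (MvPolynomial.X k : MvPolynomial (Fin N) ℂ) ^ m := by
  have h : (complementPoly k : PowerSeries (MvPolynomial (Fin N) ℂ)) =
      ∏ i ∈ Finset.univ.erase k, (1 - PowerSeries.C (MvPolynomial.X i) * PowerSeries.X) := by
    rw [complementPoly, ← Polynomial.coeToPowerSeries.ringHom_apply, map_prod]
    simp
  rw [mk_symmEval_completeHomog, h, ← Finset.mul_prod_erase _ _ (Finset.mem_univ k), mul_assoc,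
    ← Finset.prod_mul_distrib, Finset.prod_eq_one, mul_one]
  exact fun i _ => mk_pow_mul_one_sub _

/-- This is the coefficient of t^m in the preceding identity. The complementary product has degree
below N, so the N staircase exponents cover all its coefficients. -/
theorem sum_symmEval_mul_coeff_complementPoly (m : ℕ) (k : Fin N) :
    ∑ j, symmEval N (completeHomogInt ((m : ℤ) - staircase N j)) *
      (complementPoly k).coeff (staircase N j) = MvPolynomial.X k ^ m := by
  set F : ℕ → MvPolynomial (Fin N) ℂ := fun r =>
    symmEval N (completeHomogInt ((m : ℤ) - r)) * (complementPoly k).coeff r with hF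
  have h1 : ∑ j, F (staircase N j) = ∑ r ∈ Finset.range N, F r := by
    rw [← Fin.sum_univ_eq_sum_range, ← Equiv.sum_comp Fin.revPerm]
    refine Finset.sum_congr rfl fun j _ => congrArg F ?_
    rw [staircase, Fin.revPerm_apply, Fin.val_rev]
    omega
  have h2 := congrArg (PowerSeries.coeff m) (mk_symmEval_mul_complementPoly k)
  rw [PowerSeries.coeff_mk, mul_comm, PowerSeries.coeff_mul,
    Finset.Nat.sum_antidiagonal_eq_sum_range_succ_mk] at h2
  change ∑ j, F (staircase N j) = _
  rw [h1, ← h2]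
  have h3 : ∑ r ∈ Finset.range N, F r = ∑ r ∈ Finset.range (N + (m + 1)), F r := by
    refine Finset.sum_subset (Finset.range_mono (Nat.le_add_right _ _)) fun r _ hr => ?_
    rw [hF]
    dsimp only
    rw [coeff_complementPoly (by simpa using hr), mul_zero]
  rw [h3]
  symm
  refine (Finset.sum_congr rfl fun r hr => ?_).trans
    (Finset.sum_subset (Finset.range_mono (Nat.le_add_left (m + 1) N)) fun r _ hr => ?_)
  · rw [Finset.mem_range] at hr
    rw [hF]
    dsimp only
    rw [Polynomial.coeff_coe, PowerSeries.coeff_mk, mul_comm, completeHomogInt, if_neg (by omega)]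
    congr 3
    omega
  · rw [Finset.mem_range] at hr
    rw [hF]
    dsimp only
    rw [completeHomogInt, if_pos (by omega), map_zero, zero_mul]

theorem det_homogMatrix_staircase : (homogMatrix (staircase N)).det = 1 := by
  rw [Matrix.det_of_isUpperTriangular, Finset.prod_eq_one]
  · intro i _
    rw [homogMatrix, Matrix.of_apply, sub_self, completeHomogInt, if_neg (by simp), Int.toNat_zero,
      completeHomog_zero]
  · intro i j hij
    have h := strictAnti_staircase N hij
    rw [homogMatrix, Matrix.of_apply, completeHomogInt, if_pos]
    simp only [id] at h
    omega

/-- The bialternant formula. -/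
theorem symmEval_det_homogMatrix_mul_alternant (l : Fin N → ℕ) :
    symmEval N (homogMatrix l).det * alternant (staircase N) = alternant l := by
  -- The matrix of powers factors as (h_{l_i - δ_j}) times a matrix independent of l. At l = δ the
  -- first factor is unitriangular, which identifies the determinant of the second as the alternant
  -- of δ.
  have h : ∀ l : Fin N → ℕ, alternant l = symmEval N (homogMatrix l).det *
      (Matrix.of fun j k : Fin N => (complementPoly k).coeff (staircase N j)).det := by
    intro l
    rw [AlgHom.map_det, ← Matrix.det_mul, alternant]
    congr 1
    ext1 i k
    rw [Matrix.of_apply, ← sum_symmEval_mul_coeff_complementPoly, Matrix.mul_apply]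
    rfl
  rw [h l, h (staircase N), det_homogMatrix_staircase, map_one, one_mul]

end JacobiTrudi

/-! ### Schur functions as characteristics -/

section Padding

theorem completeHomogInt_zero : completeHomogInt 0 = 1 := by
  rw [completeHomogInt, if_neg (lt_irrefl 0), Int.toNat_zero, completeHomog_zero]

theorem completeHomogInt_of_neg {m : ℤ} (h : m < 0) : completeHomogInt m = 0 := if_pos h

theorem completeHomogInt_natCast (m : ℕ) : completeHomogInt m = completeHomog m := by
  rw [completeHomogInt, if_neg (by omega), Int.toNat_natCast]

/-- Appending zeros to a partition does not change the Jacobi–Trudi determinant. -/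
theorem det_jacobiTrudi_add (f : ℕ → ℕ) (a d : ℕ) (hf : ∀ i, a ≤ i → f i = 0) :
    Matrix.det (Matrix.of fun i j : Fin (a + d) =>
      completeHomogInt ((f i : ℤ) - (i : ℤ) + (j : ℤ))) =
    Matrix.det (Matrix.of fun i j : Fin a =>
      completeHomogInt ((f i : ℤ) - (i : ℤ) + (j : ℤ))) := by
  set M := Matrix.of fun i j : Fin (a + d) => completeHomogInt ((f i : ℤ) - (i : ℤ) + (j : ℤ))
    with hM
  have h21 : (M.submatrix finSumFinEquiv finSumFinEquiv).toBlocks₂₁ = 0 := by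
    ext1 i j
    rw [Matrix.toBlocks₂₁, Matrix.of_apply, Matrix.submatrix_apply, hM, Matrix.of_apply,
      finSumFinEquiv_apply_right, finSumFinEquiv_apply_left, Matrix.zero_apply,
      completeHomogInt_of_neg]
    rw [hf _ (by simp), Fin.val_natAdd, Fin.val_castAdd]
    have := j.2
    omega
  have h22 : (M.submatrix finSumFinEquiv finSumFinEquiv).toBlocks₂₂.det = 1 := by
    have hentry : ∀ i j : Fin d, (M.submatrix finSumFinEquiv finSumFinEquiv).toBlocks₂₂ i j =
        completeHomogInt ((j : ℤ) - i) := by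
      intro i j
      rw [Matrix.toBlocks₂₂, Matrix.of_apply, Matrix.submatrix_apply, hM, Matrix.of_apply,
        finSumFinEquiv_apply_right, finSumFinEquiv_apply_right, hf _ (by simp), Fin.val_natAdd,
        Fin.val_natAdd]
      congr 1
      push_cast
      ring
    rw [Matrix.det_of_isUpperTriangular, Finset.prod_eq_one]
    · intro i _
      rw [hentry, sub_self, completeHomogInt_zero]
    · intro i j hij
      rw [hentry, completeHomogInt_of_neg]
      have : (j : ℕ) < i := hij
      omega
  rw [← Matrix.det_submatrix_equiv_self finSumFinEquiv M,
    ← Matrix.fromBlocks_toBlocks (M.submatrix finSumFinEquiv finSumFinEquiv), h21,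
    Matrix.det_fromBlocks_zero₂₁, h22, mul_one]
  rfl

variable {n : ℕ}

/-- The `i`-th largest part of a partition (zero beyond the last part). -/
def nthPart (ν : n.Partition) (i : ℕ) : ℕ := (sortedParts ν).getD i 0

/-- The strictly decreasing sequence `λ + δ`. -/
def shiftedParts (ν : n.Partition) (i : Fin n) : ℕ := nthPart ν i + staircase n i

theorem sum_sortedParts (ν : n.Partition) : (sortedParts ν).sum = n := by
  rw [sortedParts, ← Multiset.sum_coe, Multiset.sort_eq, ν.parts_sum]

theorem length_sortedParts_le (ν : n.Partition) : (sortedParts ν).length ≤ n := by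
  rw [sortedParts, Multiset.length_sort]
  conv_rhs => rw [← ν.parts_sum]
  simpa using Multiset.card_nsmul_le_sum (s := ν.parts) (a := 1) fun i hi => ν.parts_pos hi

theorem nthPart_of_length_le (ν : n.Partition) {i : ℕ} (h : (sortedParts ν).length ≤ i) :
    nthPart ν i = 0 := List.getD_eq_default _ _ h

theorem antitone_nthPart (ν : n.Partition) : Antitone (nthPart ν) := by
  intro i j hij
  by_cases hj : j < (sortedParts ν).length
  · have hi := hij.trans_lt hj
    rw [nthPart, nthPart, List.getD_eq_getElem _ _ hi, List.getD_eq_getElem _ _ hj]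
    rcases hij.eq_or_lt with rfl | hij
    · exact le_rfl
    · exact List.pairwise_iff_getElem.mp (Multiset.pairwise_sort ν.parts (· ≥ ·)) i j hi hj hij
  · rw [nthPart_of_length_le ν (not_lt.mp hj)]
    exact Nat.zero_le _

theorem strictAnti_shiftedParts (ν : n.Partition) : StrictAnti (shiftedParts ν) := fun _ _ h =>
  add_lt_add_of_le_of_lt (antitone_nthPart ν (le_of_lt h)) (strictAnti_staircase n h)

theorem sum_nthPart (ν : n.Partition) : ∑ i : Fin n, nthPart ν i = n := by
  conv_rhs => rw [← sum_sortedParts ν]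
  rw [Fin.sum_univ_eq_sum_range (nthPart ν), ← Fin.sum_univ_getElem,
    ← Finset.sum_subset (Finset.range_mono (length_sortedParts_le ν)), ← Fin.sum_univ_eq_sum_range]
  · exact Finset.sum_congr rfl fun i _ => List.getD_eq_getElem _ _ i.2
  · intro i _ hi
    exact nthPart_of_length_le ν (by simpa using hi)

theorem shiftedParts_injective : Function.Injective (shiftedParts : n.Partition → Fin n → ℕ) := by
  intro ν μ h
  have h1 : ∀ i, nthPart ν i = nthPart μ i := by
    intro i
    rcases lt_or_ge i n with hi | hi
    · exact Nat.add_right_cancel (congrFun h ⟨i, hi⟩)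
    · rw [nthPart_of_length_le ν ((length_sortedParts_le ν).trans hi),
        nthPart_of_length_le μ ((length_sortedParts_le μ).trans hi)]
  have hpos : ∀ (ν : n.Partition) (i : ℕ), 0 < nthPart ν i ↔ i < (sortedParts ν).length := by
    intro ν i
    constructor
    · intro h
      by_contra hi
      exact h.ne' (nthPart_of_length_le ν (not_lt.mp hi))
    · intro hi
      rw [nthPart, List.getD_eq_getElem _ _ hi]
      exact ν.parts_pos ((Multiset.mem_sort _).mp (List.getElem_mem hi))
  have hlen : (sortedParts ν).length = (sortedParts μ).length := by
    have : ∀ i, i < (sortedParts ν).length ↔ i < (sortedParts μ).length := fun i => by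
      rw [← hpos, ← hpos, h1]
    have h2 := this (sortedParts ν).length
    have h3 := this (sortedParts μ).length
    omega
  have hlist : sortedParts ν = sortedParts μ := by
    refine List.ext_getElem hlen fun i hi hi' => ?_
    rw [← List.getD_eq_getElem _ 0 hi, ← List.getD_eq_getElem _ 0 hi']
    exact h1 i
  refine Nat.Partition.ext ?_
  rw [← Multiset.sort_eq ν.parts (· ≥ ·), ← Multiset.sort_eq μ.parts (· ≥ ·)]
  exact congrArg _ hlist

/-- Padding with zeros gives every partition of n the same n rows, and ν_i - i + j = (ν_i + δ_i) -
δ_j. -/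
theorem schurFun_eq_det_homogMatrix (ν : n.Partition) :
    schurFun ν = (homogMatrix (shiftedParts ν)).det := by
  obtain ⟨d, hd⟩ := Nat.exists_eq_add_of_le (length_sortedParts_le ν)
  have key : ∀ m, m = (sortedParts ν).length + d →
      Matrix.det (Matrix.of fun i j : Fin m =>
        completeHomogInt ((nthPart ν i : ℤ) - (i : ℤ) + (j : ℤ))) = schurFun ν := by
    rintro m rfl
    rw [det_jacobiTrudi_add _ _ _ fun i hi => nthPart_of_length_le ν hi, schurFun]
    congr 1
    ext1 i j
    rw [Matrix.of_apply, Matrix.of_apply, nthPart, List.getD_eq_getElem _ _ i.2, List.get_eq_getElem]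
  rw [← key n hd, homogMatrix]
  congr 1
  ext1 i j
  rw [Matrix.of_apply, Matrix.of_apply, shiftedParts]
  congr 1
  have := i.2
  have := j.2
  simp only [staircase]
  omega

end Padding

/-! ### Frobenius's character formula and the Schur expansion of characteristics -/

section SchurCharacter

variable {n : ℕ}

/-- The coefficient of `x^{λ + δ}` in `f(x) a_δ(x)`. -/
def schurCoeff (ν : n.Partition) : SymmFun →ₗ[ℂ] ℂ :=
  (MvPolynomial.lcoeff ℂ (expVec (shiftedParts ν))).comp
    ((LinearMap.mulRight ℂ (alternant (staircase n))).comp (symmEval n).toLinearMap)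

theorem schurCoeff_apply (ν : n.Partition) (f : SymmFun) : schurCoeff ν f =
    MvPolynomial.coeff (expVec (shiftedParts ν)) (symmEval n f * alternant (staircase n)) := rfl

theorem symmEval_schurFun_mul_alternant (ν : n.Partition) :
    symmEval n (schurFun ν) * alternant (staircase n) = alternant (shiftedParts ν) := by
  rw [schurFun_eq_det_homogMatrix, symmEval_det_homogMatrix_mul_alternant]

theorem schurCoeff_schurFun (ν μ : n.Partition) :
    schurCoeff ν (schurFun μ) = if μ = ν then 1 else 0 := by
  rw [schurCoeff_apply, symmEval_schurFun_mul_alternant,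
    coeff_alternant (strictAnti_shiftedParts μ) (strictAnti_shiftedParts ν)]
  simp_rw [shiftedParts_injective.eq_iff]

/-- The irreducible character of `S_n` attached to a partition. -/
def schurCharacter (ν : n.Partition) (σ : Perm (Fin n)) : ℂ := schurCoeff ν (cycleMonomial σ)

theorem schurCharacter_of_isConj (ν : n.Partition) (σ τ : Perm (Fin n)) (h : IsConj σ τ) :
    schurCharacter ν σ = schurCharacter ν τ := by
  rw [schurCharacter, schurCharacter, cycleMonomial_of_isConj h]

theorem charSum_smul (c : ℂ) (φ : Perm (Fin n) → ℂ) : charSum (fun σ => c * φ σ) = c • charSum φ := by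
  simp_rw [charSum, mul_smul, ← Finset.smul_sum]
  rw [smul_comm]

/-- Expanding the alternant writes the character as a signed sum over w of coefficients at
x^(λ+δ-wδ). Their characteristics are products of h's, and the signed sum is the transposed
Jacobi–Trudi determinant. When some exponent would be negative, both terms are 0. -/
theorem charSum_schurCharacter (ν : n.Partition) : charSum (schurCharacter ν) = schurFun ν := by
  have h : schurCharacter ν = fun σ => ∑ w : Perm (Fin n), ((Perm.sign w : ℤ) : ℂ) *
      if ∀ i, staircase n (w i) ≤ shiftedParts ν i then MvPolynomial.coeff
        (expVec fun i => shiftedParts ν i - staircase n (w i)) (symmEval n (cycleMonomial σ)) else 0 :=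
    funext fun σ => coeff_mul_alternant _ _ _
  have hzero : charSum (fun _ : Perm (Fin n) => (0 : ℂ)) = 0 := by simp [charSum]
  rw [h, charSum_sum, schurFun_eq_det_homogMatrix, ← Matrix.det_transpose, Matrix.det_apply]
  refine Finset.sum_congr rfl fun w _ => ?_
  rw [charSum_smul, Units.smul_def, Int.cast_smul_eq_zsmul]
  congr 1
  split_ifs with hw
  · rw [charSum_coeff_symmEval, if_pos]
    · refine Finset.prod_congr rfl fun i _ => ?_
      rw [Matrix.transpose_apply, homogMatrix, Matrix.of_apply, ← Nat.cast_sub (hw i),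
        completeHomogInt_natCast]
      rfl
    · have h1 : ∑ i, (expVec fun i => shiftedParts ν i - staircase n (w i)) i +
          ∑ i, staircase n (w i) = ∑ i, shiftedParts ν i := by
        rw [← Finset.sum_add_distrib]
        exact Finset.sum_congr rfl fun i _ => Nat.sub_add_cancel (hw i)
      have h2 : ∑ i, shiftedParts ν i = n + ∑ i, staircase n i := by
        exact Finset.sum_add_distrib.trans (congrArg (· + _) (sum_nthPart ν))
      rw [Equiv.sum_comp w (staircase n), h2] at h1
      exact Nat.add_right_cancel h1
  · rw [hzero]
    push Not at hw
    obtain ⟨i, hi⟩ := hw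
    rw [Finset.prod_eq_zero (Finset.mem_univ i)]
    rw [Matrix.transpose_apply, homogMatrix, Matrix.of_apply, completeHomogInt_of_neg]
    omega

theorem charSum_eq_sum_powerSumPart (φ : Perm (Fin n) → ℂ) : charSum φ =
    ∑ ν : n.Partition, MvPolynomial.coeff (partExp ν) (charSum φ) • powerSumPart ν := by
  classical
  ext w
  simp_rw [MvPolynomial.coeff_sum, MvPolynomial.coeff_smul, powerSumPart_eq_monomial,
    MvPolynomial.coeff_monomial, smul_eq_mul, mul_ite, mul_one, mul_zero]
  by_cases hw : psDegree w = n
  · obtain ⟨ν, rfl⟩ := exists_partExp_eq hw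
    simp [partExp_injective.eq_iff]
  · rw [Finset.sum_eq_zero]
    · rw [charSum, MvPolynomial.coeff_smul, MvPolynomial.coeff_sum, Finset.sum_eq_zero, smul_zero]
      intro σ _
      rw [cycleMonomial, powerSumPart_eq_monomial, MvPolynomial.coeff_smul,
        MvPolynomial.coeff_monomial, if_neg, smul_zero]
      rintro rfl
      exact hw ((weight_partExp σ.partition).trans (Fintype.card_fin n))
    · intro ν _
      refine if_neg ?_
      rintro rfl
      exact hw (weight_partExp ν)

/-- The functionals `schurCoeff` are dual to the Schur functions. In the power sum basis this is S·T
= 1 for square matrices indexed by partitions; then T·S = 1, which expands each p_μ in Schur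
functions. -/
theorem charSum_eq_sum_schurFun (φ : Perm (Fin n) → ℂ) :
    charSum φ = ∑ ν : n.Partition, schurCoeff ν (charSum φ) • schurFun ν := by
  classical
  set S : Matrix n.Partition n.Partition ℂ :=
    Matrix.of fun ν μ => MvPolynomial.coeff (partExp μ) (schurFun ν) with hS
  set T : Matrix n.Partition n.Partition ℂ :=
    Matrix.of fun μ ν => schurCoeff ν (powerSumPart μ) with hT
  have hexp : ∀ ν : n.Partition, schurFun ν = ∑ μ, S ν μ • powerSumPart μ := fun ν => by
    rw [← charSum_schurCharacter ν, charSum_eq_sum_powerSumPart, charSum_schurCharacter]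
    rfl
  have hST : S * T = 1 := by
    ext ν μ
    have h := schurCoeff_schurFun μ ν
    rw [hexp, map_sum] at h
    simp_rw [map_smul] at h
    rw [Matrix.one_apply, ← h]
    rfl
  have hTS : T * S = 1 := mul_eq_one_comm.mp hST
  have hp : ∀ μ : n.Partition, powerSumPart μ =
      ∑ ν : n.Partition, schurCoeff ν (powerSumPart μ) • schurFun ν := by
    intro μ
    simp_rw [hexp, Finset.smul_sum, smul_smul]
    rw [Finset.sum_comm]
    simp_rw [← Finset.sum_smul]
    have : ∀ κ, ∑ ν, schurCoeff ν (powerSumPart μ) * S ν κ = (1 : Matrix _ _ ℂ) μ κ := fun κ => by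
      rw [← hTS]
      rfl
    simp_rw [this, Matrix.one_apply, ite_smul, one_smul, zero_smul]
    rw [Finset.sum_ite_eq, if_pos (Finset.mem_univ _)]
  conv_lhs => rw [charSum_eq_sum_powerSumPart]
  conv_rhs =>
    enter [2, ν]
    rw [charSum_eq_sum_powerSumPart, map_sum]
  simp_rw [map_smul, Finset.sum_smul]
  rw [Finset.sum_comm]
  refine Finset.sum_congr rfl fun μ _ => ?_
  conv_lhs => rw [hp μ, Finset.smul_sum]
  simp_rw [smul_smul]
  rfl

end SchurCharacter

/-! ### Schur positivity of characteristics -/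

section WordRepresentation

/-- Words of content `α`. -/
abbrev ContentWord (n : ℕ) {N : ℕ} (α : Fin N →₀ ℕ) : Type :=
  {f : Fin n → Fin N // ∑ i, Finsupp.single (f i) 1 = α}

/-- The action of permutations on words of given content. -/
def contentMatrix {n N : ℕ} (α : Fin N →₀ ℕ) (σ : Perm (Fin n)) :
    Matrix (ContentWord n α) (ContentWord n α) ℂ :=
  Matrix.of fun f g => if f.1 ∘ σ = g.1 then 1 else 0

theorem contentMatrix_mul {n N : ℕ} (α : Fin N →₀ ℕ) (σ τ : Perm (Fin n)) :
    contentMatrix α (σ * τ) = contentMatrix α σ * contentMatrix α τ := by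
  ext f h
  have hf : ∑ i, Finsupp.single (f.1 (σ i)) 1 = α :=
    (Equiv.sum_comp σ fun i => Finsupp.single (f.1 i) 1).trans f.2
  rw [Matrix.mul_apply, Finset.sum_eq_single ⟨f.1 ∘ σ, hf⟩]
  · simp only [contentMatrix, Matrix.of_apply, if_true, one_mul]
    rfl
  · intro g _ hg
    rw [contentMatrix, Matrix.of_apply, if_neg fun h => hg (Subtype.ext h.symm), zero_mul]
  · simp

/-- Both sides count the words of content α fixed by σ, that is, constant on its cycles. -/
theorem coeff_symmEval_cycleMonomial {n N : ℕ} (α : Fin N →₀ ℕ) (σ : Perm (Fin n)) :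
    MvPolynomial.coeff α (symmEval N (cycleMonomial σ)) = (contentMatrix α σ).trace := by
  have hX : symmEval N = MvPolynomial.aeval fun k : ℕ+ =>
      ((Matrix.diagonal (MvPolynomial.X : Fin N → MvPolynomial (Fin N) ℂ)) ^ (k : ℕ)).trace := by
    rw [symmEval]
    congr 1
    funext k
    rw [Matrix.diagonal_pow, Matrix.trace_diagonal]
    rfl
  rw [hX, ← twistedTrace_eq, twistedTrace, MvPolynomial.coeff_sum, Matrix.trace]
  have hterm : ∀ f : Fin n → Fin N, MvPolynomial.coeff α (∏ i, Matrix.diagonal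
      (MvPolynomial.X : Fin N → MvPolynomial (Fin N) ℂ) (f i) (f (σ i))) =
      if ∑ i, Finsupp.single (f i) 1 = α then (if f ∘ σ = f then 1 else 0) else 0 := by
    intro f
    simp_rw [Matrix.diagonal_apply]
    rw [Finset.prod_ite_zero, prod_X_eq_monomial, apply_ite (MvPolynomial.coeff α),
      MvPolynomial.coeff_monomial, MvPolynomial.coeff_zero, ← ite_and, ← ite_and]
    have hiff : ((∀ i ∈ Finset.univ, f i = f (σ i)) ∧ ∑ i, Finsupp.single (f i) 1 = α) ↔
        ∑ i, Finsupp.single (f i) 1 = α ∧ f ∘ σ = f := by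
      rw [and_comm, funext_iff]
      simp [eq_comm]
    simp only [hiff]
  simp_rw [hterm]
  rw [← Finset.sum_filter, Finset.sum_subtype _ (p := fun f : Fin n → Fin N =>
    ∑ i, Finsupp.single (f i) 1 = α)]
  · rfl
  · simp

/-- The coefficient is the dimension of a space of intertwiners between ρ and the permutation module
on words of content α. -/
theorem exists_coeff_symmEval_frobeniusChar_eq {n N : ℕ} {V : Type*} [AddCommGroup V] [Module ℂ V]
    [FiniteDimensional ℂ V] (ρ : Representation ℂ (Perm (Fin n)) V) (α : Fin N →₀ ℕ) :
    ∃ m : ℕ, MvPolynomial.coeff α (symmEval N (frobeniusChar ρ)) = m := by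
  have : Invertible (Nat.card (Perm (Fin n)) : ℂ) := invertibleOfNonzero (by
    exact_mod_cast Nat.card_pos.ne')
  refine ⟨_, Eq.trans ?_ (Representation.card_inv_mul_sum_char_mul_char_eq_finrank
    (matrixRep (contentMatrix α) (contentMatrix_mul α)) ρ)⟩
  rw [frobeniusChar_eq_charSum, charSum, map_smul, map_sum, MvPolynomial.coeff_smul,
    MvPolynomial.coeff_sum, Nat.card_eq_fintype_card, Fintype.card_perm, Fintype.card_fin,
    smul_eq_mul]
  congr 1
  refine Finset.sum_congr rfl fun σ _ => ?_
  rw [map_smul, MvPolynomial.coeff_smul, character_inv, character_matrixRep,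
    coeff_symmEval_cycleMonomial, smul_eq_mul]

end WordRepresentation

section LeadingCoefficient

/-- Among the rearrangements of a strictly decreasing l, the sequence l itself is lexicographically
largest, and it has coefficient 1. -/
theorem leadingCoeff_alternant {N : ℕ} {l : Fin N → ℕ} (hl : StrictAnti l) :
    MonomialOrder.lex.leadingCoeff (alternant l) = 1 := by
  have hlt : ∀ w : Perm (Fin N), MonomialOrder.lex.toSyn (expVec (l ∘ w)) ≤
      MonomialOrder.lex.toSyn (expVec l) := by
    intro w
    rcases eq_or_ne w 1 with rfl | hw
    · exact le_rfl
    · refine le_of_lt (MonomialOrder.lex_lt_iff.mpr (Finsupp.Lex.lt_iff.mpr ?_))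
      -- At the first k moved by w all smaller values are already taken, so w k > k and l (w k) < l
      -- k.
      have hex : ∃ k : ℕ, ∃ h : k < N, w ⟨k, h⟩ ≠ ⟨k, h⟩ := by
        by_contra! h
        exact hw (Equiv.ext fun i => h i i.2)
      classical
      obtain ⟨hk, hwk⟩ := Nat.find_spec hex
      have hmin : ∀ j : Fin N, j < ⟨Nat.find hex, hk⟩ → w j = j := fun j hj => by
        by_contra h
        exact Nat.find_min hex hj ⟨j.2, h⟩
      refine ⟨⟨Nat.find hex, hk⟩, fun j hj => congrArg l (hmin j hj), hl ?_⟩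
      refine lt_of_le_of_ne (not_lt.mp fun h => ?_) hwk.symm
      exact hwk (w.injective (hmin _ h))
  have hcoeff : MvPolynomial.coeff (expVec l) (alternant l) = 1 := by
    rw [coeff_alternant hl hl, if_pos rfl]
  have hdeg : MonomialOrder.lex.degree (alternant l) = expVec l := by
    apply MonomialOrder.lex.toSyn.injective
    refine le_antisymm ?_ ?_
    · rw [MonomialOrder.degree_le_iff]
      intro b hb
      rw [alternant_eq] at hb
      obtain ⟨w, -, hw⟩ := Finset.mem_biUnion.mp (MvPolynomial.support_sum hb)
      rw [Finset.mem_singleton.mp (MvPolynomial.support_monomial_subset hw)]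
      exact hlt w
    · refine MonomialOrder.le_degree (MvPolynomial.mem_support_iff.mpr ?_)
      rw [hcoeff]
      exact one_ne_zero
  rw [MonomialOrder.leadingCoeff, hdeg, hcoeff]

end LeadingCoefficient

/-! ### Irreducible characteristics are Schur functions -/

section Positivity

variable {n : ℕ}

theorem schurCoeff_charSum (ν : n.Partition) (φ : Perm (Fin n) → ℂ) :
    schurCoeff ν (charSum φ) = (n.factorial : ℂ)⁻¹ * ∑ σ, φ σ * schurCharacter ν σ := by
  rw [charSum, map_smul, map_sum, smul_eq_mul]
  simp_rw [map_smul, smul_eq_mul]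
  rfl

theorem exists_schurCoeff_frobeniusChar_eq {V : Type*} [AddCommGroup V] [Module ℂ V]
    [FiniteDimensional ℂ V] (ρ : Representation ℂ (Perm (Fin n)) V) (ν : n.Partition) :
    ∃ z : ℤ, schurCoeff ν (frobeniusChar ρ) = z := by
  rw [schurCoeff_apply, coeff_mul_alternant]
  choose m hm using fun α : Fin n →₀ ℕ => exists_coeff_symmEval_frobeniusChar_eq ρ α
  refine ⟨∑ w : Perm (Fin n), (Perm.sign w : ℤ) * if ∀ i, staircase n (w i) ≤ shiftedParts ν i then
    m (expVec fun i => shiftedParts ν i - staircase n (w i)) else 0, ?_⟩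
  push_cast
  simp_rw [hm]

/-- Each coefficient equals the pairing of ρ with a `schurCharacter`. Substituting one factor turns
the sum of squares into the norm of the irreducible character, so orthogonality of the
`schurCharacter`s is not needed. -/
theorem sum_schurCoeff_sq {V : Type*} [AddCommGroup V] [Module ℂ V] [FiniteDimensional ℂ V]
    (ρ : Representation ℂ (Perm (Fin n)) V) [ρ.IsIrreducible] :
    ∑ ν : n.Partition, schurCoeff ν (frobeniusChar ρ) * schurCoeff ν (frobeniusChar ρ) = 1 := by
  have : Invertible (Nat.card (Perm (Fin n)) : ℂ) := invertibleOfNonzero (by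
    exact_mod_cast Nat.card_pos.ne')
  have hχ : ρ.character =
      fun σ => ∑ ν, schurCoeff ν (frobeniusChar ρ) * schurCharacter ν σ := by
    refine charSum_injective (character_eq_of_isConj ρ) ?_ ?_
    · intro σ τ h
      simp_rw [schurCharacter_of_isConj _ σ τ h]
    · rw [charSum_sum, charSum_eq_sum_schurFun]
      refine Finset.sum_congr rfl fun ν _ => ?_
      rw [charSum_smul, charSum_schurCharacter]
      rfl
  have h1 := Representation.char_orthonormal ρ ρ
  rw [if_pos ⟨Representation.Equiv.refl ρ⟩, Nat.card_eq_fintype_card, Fintype.card_perm,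
    Fintype.card_fin] at h1
  simp_rw [character_inv] at h1
  have hc : ∀ ν : n.Partition, schurCoeff ν (frobeniusChar ρ) =
      (n.factorial : ℂ)⁻¹ * ∑ σ, ρ.character σ * schurCharacter ν σ := fun ν =>
    schurCoeff_charSum ν ρ.character
  calc ∑ ν : n.Partition, schurCoeff ν (frobeniusChar ρ) * schurCoeff ν (frobeniusChar ρ)
      = ∑ ν : n.Partition, schurCoeff ν (frobeniusChar ρ) *
          ((n.factorial : ℂ)⁻¹ * ∑ σ, ρ.character σ * schurCharacter ν σ) :=
        Finset.sum_congr rfl fun ν _ => congrArg _ (hc ν)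
    _ = (n.factorial : ℂ)⁻¹ * ∑ σ, ρ.character σ *
          ∑ ν, schurCoeff ν (frobeniusChar ρ) * schurCharacter ν σ := by
        simp_rw [Finset.mul_sum]
        rw [Finset.sum_comm]
        refine Finset.sum_congr rfl fun σ _ => Finset.sum_congr rfl fun ν _ => ?_
        ring
    _ = (n.factorial : ℂ)⁻¹ * ∑ σ, ρ.character σ * ρ.character σ := by
        congr 1
        exact Finset.sum_congr rfl fun σ _ => congrArg _ (congrFun hχ σ).symm
    _ = 1 := h1

/-- Integers with squares summing to 1 leave a single coefficient ±1. After multiplication by the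
alternant of δ, lexicographic leading coefficients are compared. Alternants contribute 1, and the
symmetric polynomial of ρ has natural number coefficients, so the sign is +. -/
theorem exists_frobeniusChar_eq_schurFun {V : Type*} [AddCommGroup V] [Module ℂ V]
    [FiniteDimensional ℂ V] (ρ : Representation ℂ (Perm (Fin n)) V) [ρ.IsIrreducible] :
    ∃ ν : n.Partition, frobeniusChar ρ = schurFun ν := by
  classical
  choose z hz using exists_schurCoeff_frobeniusChar_eq ρ
  have hsq : ∑ ν : n.Partition, z ν * z ν = 1 := by
    have h := sum_schurCoeff_sq ρ
    simp_rw [hz] at h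
    exact_mod_cast h
  have hexp : frobeniusChar ρ = ∑ ν : n.Partition, (z ν : ℂ) • schurFun ν := by
    rw [frobeniusChar_eq_charSum, charSum_eq_sum_schurFun]
    simp_rw [← hz]
    rfl
  obtain ⟨ν, hν⟩ : ∃ ν, z ν ≠ 0 := by
    by_contra! h
    simp [h] at hsq
  have hν1 : 1 ≤ z ν * z ν := by
    have := mul_self_pos.mpr hν
    omega
  have hle : ∀ μ, 0 ≤ z μ * z μ := fun μ => mul_self_nonneg _
  have hsplit := Finset.add_sum_erase Finset.univ (fun ν => z ν * z ν) (Finset.mem_univ ν)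
  have hrest : ∑ μ ∈ Finset.univ.erase ν, z μ * z μ = 0 := by
    have := Finset.sum_nonneg fun μ (_ : μ ∈ Finset.univ.erase ν) => hle μ
    omega
  have hzero : ∀ μ, μ ≠ ν → z μ = 0 := fun μ hμ => by
    have := (Finset.sum_eq_zero_iff_of_nonneg fun μ _ => hle μ).mp hrest μ
      (Finset.mem_erase.mpr ⟨hμ, Finset.mem_univ _⟩)
    exact mul_self_eq_zero.mp this
  rw [Finset.sum_eq_single ν (fun μ _ hμ => by rw [hzero μ hμ, Int.cast_zero, zero_smul])
    (fun h => absurd (Finset.mem_univ _) h)] at hexp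
  have hlead := congrArg (fun f => MonomialOrder.lex.leadingCoeff
    (symmEval n f * alternant (staircase n))) hexp
  rw [map_smul, smul_mul_assoc, symmEval_schurFun_mul_alternant, MonomialOrder.leadingCoeff_mul,
    leadingCoeff_alternant (strictAnti_staircase n), MvPolynomial.smul_eq_C_mul,
    MonomialOrder.leadingCoeff_mul, MonomialOrder.leadingCoeff_C,
    leadingCoeff_alternant (strictAnti_shiftedParts ν), mul_one, mul_one] at hlead
  obtain ⟨m, hm⟩ := exists_coeff_symmEval_frobeniusChar_eq ρ
    (MonomialOrder.lex.degree (symmEval n (frobeniusChar ρ)))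
  have hzm : z ν = m := by
    rw [MonomialOrder.leadingCoeff, hm] at hlead
    exact_mod_cast hlead.symm
  have hz1 : z ν = 1 := by
    have h1 : z ν * z ν = 1 := by
      omega
    rcases mul_self_eq_one_iff.mp h1 with h | h
    · exact h
    · omega
  exact ⟨ν, by rw [hexp, hz1, Int.cast_one, one_smul]⟩

theorem IsSchurPositive.add {f g : SymmFun} (hf : IsSchurPositive n f) (hg : IsSchurPositive n g) :
    IsSchurPositive n (f + g) := by
  obtain ⟨c, rfl⟩ := hf
  obtain ⟨d, rfl⟩ := hg
  refine ⟨c + d, ?_⟩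
  simp [add_smul, Finset.sum_add_distrib]

theorem isSchurPositive_schurFun (ν : n.Partition) : IsSchurPositive n (schurFun ν) := by
  classical
  exact ⟨fun μ => if μ = ν then 1 else 0, by simp⟩

/-- Complete reducibility, splitting off one irreducible at a time. -/
theorem isSchurPositive_frobeniusChar {V : Type*} [AddCommGroup V] [Module ℂ V]
    [FiniteDimensional ℂ V] (ρ : Representation ℂ (Perm (Fin n)) V) :
    IsSchurPositive n (frobeniusChar ρ) := by
  induction hd : Module.finrank ℂ V using Nat.strong_induction_on generalizing V with
  | _ d ih =>
    rcases subsingleton_or_nontrivial V with hV | hV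
    · refine ⟨0, ?_⟩
      have h : ∀ σ, ρ.character σ = 0 := fun σ => by
        rw [Representation.character, Subsingleton.elim (ρ σ) 0, map_zero]
      simp [frobeniusChar_eq_charSum, charSum, h]
    · obtain ⟨U, U', hU, hUU'⟩ := exists_isIrreducible_isCompl ρ
      obtain ⟨e⟩ := nonempty_prod_equiv_of_isCompl hUU'
      have hch : frobeniusChar ρ =
          frobeniusChar U.toRepresentation + frobeniusChar U'.toRepresentation := by
        rw [← frobeniusChar_prod, frobeniusChar_eq_charSum, frobeniusChar_eq_charSum,
          Representation.char_iso e]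
      have hUne : Nontrivial U.toSubmodule := by
        rw [Submodule.nontrivial_iff_ne_bot]
        intro h0
        obtain ⟨a, b, hab⟩ := hU.exists_pair_ne
        have : Subsingleton U.toSubmodule := by rw [h0]; infer_instance
        exact hab (Subrepresentation.toSubmodule_injective (Subsingleton.elim _ _))
      have hlt : Module.finrank ℂ U'.toSubmodule < d := by
        have h3 := e.toLinearEquiv.finrank_eq
        rw [Module.finrank_prod] at h3
        have h4 : 0 < Module.finrank ℂ U.toSubmodule := Module.finrank_pos
        omega
      obtain ⟨ν, hν⟩ := exists_frobeniusChar_eq_schurFun U.toRepresentation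
      rw [hch, hν]
      exact (isSchurPositive_schurFun ν).add (ih _ hlt U'.toRepresentation rfl)

end Positivity

section Main

variable {n : ℕ} {W : Fin (n + 1) → Type u} [∀ r, AddCommGroup (W r)] [∀ r, Module ℂ (W r)]
  {ρ : ∀ r, Representation ℂ (Equiv.Perm (Fin n)) (W r)}

theorem IsVhFamily.isSchurPositive_odd (hρ : IsVhFamily ρ) (hn : 2 ≤ n) :
    IsSchurPositive n ((1 / 2 : ℂ) • sumPowTwo n) := by
  have := hρ.finiteDimensional_odd
  rw [← hρ.frobeniusChar_odd hn]
  exact isSchurPositive_frobeniusChar _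

theorem IsVhFamily.isSchurPositive_total (hρ : IsVhFamily ρ) : IsSchurPositive n (sumPowTwo n) := by
  have := hρ.finiteDimensional_odd
  have := hρ.finiteDimensional_even
  rw [← hρ.frobeniusChar_total, vhTotal]
  exact isSchurPositive_frobeniusChar _

theorem IsVhFamily.isSchurPositive_odd_prod_sign (hρ : IsVhFamily ρ) (hn : 2 ≤ n) :
    IsSchurPositive n (sumPowTwoEven n) := by
  have := hρ.finiteDimensional_odd
  rw [← hρ.frobeniusChar_odd_prod_sign hn]
  exact isSchurPositive_frobeniusChar _

end Main

end

theorem mainTheorem4 :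
    (∀ n : ℕ, ∃ (W : Fin (n + 1) → Type u) (_ : ∀ r, AddCommGroup (W r))
        (_ : ∀ r, Module ℂ (W r)) (ρ : ∀ r, Representation ℂ (Equiv.Perm (Fin n)) (W r)),
        IsVhFamily ρ) ∧
    (∀ (W : (n : ℕ) → Fin (n + 1) → Type u) [∀ n r, AddCommGroup (W n r)]
        [∀ n r, Module ℂ (W n r)]
        (Vh : ∀ n r, Representation ℂ (Equiv.Perm (Fin n)) (W n r)),
        (∀ n, IsVhFamily (Vh n)) →
        (∀ n : ℕ, 2 ≤ n →
          Nonempty ((vhOdd (Vh n)).Equiv (vhEven (Vh n))) ∧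
          frobeniusChar (vhOdd (Vh n)) = (1 / 2 : ℂ) • sumPowTwo n ∧
          frobeniusChar (vhEven (Vh n)) = (1 / 2 : ℂ) • sumPowTwo n) ∧
        (∀ n : ℕ, frobeniusChar (vhTotal (Vh n)) = sumPowTwo n) ∧
        (∀ n : ℕ, 2 ≤ n →
          frobeniusChar ((vhOdd (Vh n)).prod ((signRep n).tprod (vhOdd (Vh n)))) =
            sumPowTwoEven n) ∧
        (∀ n : ℕ, Nonempty ((vhTotal (Vh (2 * n + 1))).Equiv
          (Representation.ind (permSucc (2 * n)) (vhTotal (Vh (2 * n))))))) ∧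
    (∀ n : ℕ, 2 ≤ n → IsSchurPositive n ((1 / 2 : ℂ) • sumPowTwo n)) ∧
    (∀ n : ℕ, IsSchurPositive n (sumPowTwo n)) ∧
    (∀ n : ℕ, 2 ≤ n → IsSchurPositive n (sumPowTwoEven n)) := by
  refine ⟨exists_isVhFamily, ?_, ?_, ?_, ?_⟩
  · intro W _ _ Vh h
    refine ⟨fun n hn => ⟨(h n).nonempty_equiv_odd_even hn, (h n).frobeniusChar_odd hn, ?_⟩,
      fun n => (h n).frobeniusChar_total, fun n hn => (h n).frobeniusChar_odd_prod_sign hn,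
      fun n => nonempty_equiv_ind_permSucc (h (2 * n)) (h (2 * n + 1))⟩
    rw [← (h n).frobeniusChar_odd_eq_even hn, (h n).frobeniusChar_odd hn]
  · intro n hn
    -- The positivity statement mentions no modules, so any universe serves for the witnessing
    -- family.
    obtain ⟨W, _, _, ρ, hρ⟩ := exists_isVhFamily.{0} n
    exact hρ.isSchurPositive_odd hn
  · intro n
    obtain ⟨W, _, _, ρ, hρ⟩ := exists_isVhFamily.{0} n
    exact hρ.isSchurPositive_total
  · intro n hn
    obtain ⟨W, _, _, ρ, hρ⟩ := exists_isVhFamily.{0} n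
    exact hρ.isSchurPositive_odd_prod_sign hn
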